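/- **Conventions.** Let $k$ be a commutative ring, $G$ a finite abelian group and $\Gamma=G^*$ its character group, written additively. A $G$-equivariant formal group law over $k$ is a commutative $k$-algebra $R$ with $k$-algebra homomorphisms $\theta_\gamma:R\to k$ ($\gamma\in\Gamma$), complete and Hausdorff for the topology defined by the finite products of the ideals $\ker\theta_\gamma$; a coassociative, cocommutative homomorphism of $k$-algebras $\Delta:R\to R\hat\otimes_k R$ with counit $\theta_0$ and $(\theta_\gamma\otimes\theta_\delta)\Delta=\theta_{\gamma+\delta}$; and a non-zero-divisor $x\in R$ generating $\ker\theta_0$. It is *multiplicative* if $\Delta x=x\otimes 1+1\otimes x+v\,x\otimes x$ for some $v\in k$. Its *underlying* (non-equivariant) formal group law over $k$ is the image $F(X,Y)=\sum a_{ij}X^iY^j$ of $\Delta x$ in the completion $k[[X,Y]]$ of $R\hat\otimes R$ at $(x\otimes 1,1\otimes x)$; write $F(X,X)=\sum_j c_jX^j$. Let $G=\mathbb Z/2$, let $\alpha$ be the non-trivial character, and put $x_\alpha=(\theta_\alpha\otimes 1)\Delta x$. The *parameters* of an equivariant formal group law are $F$, the Euler class $u=\theta_\alpha(x)$, and elements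 $q_j$, $b_{ij}$ ($j\ge 0$, $i\ge1$) of $k$ defined as follows. For $f\in R$ let $f^{(0)}=f$ and let $f^{(j+1)}$ be the unique element with $f^{(j)}=\theta_0(f^{(j)})+x f^{(j+1)}$. Then $q_j=\theta_\alpha\big(([2]^*x)^{(j)}\big)$, where $[2]^*x$ is $\Delta x$ followed by multiplication, and $b_{ij}=\theta_\alpha(B_i^{(j)})$, where $\Delta x=\sum_i x^i\otimes B_i$ is the expansion in powers of $x\otimes 1$ (modulo $x^n\otimes 1$ for each $n$). They satisfy $$q_0=0,\qquad q_j=c_j+u\,q_{j+1},\qquad b_{ij}=a_{ij}+u\,b_{i,j+1},$$ the defining relations, over the Lazard ring, of the coefficient ring of $\mathbb Z/2$-equivariant stable complex cobordism. **Statement.** Let $A=\mathbb Z[u,w]/(u(u+2)(1-uw))$. Then $A$ is Noetherian and $\operatorname{Spec}A$ is connected. Let $F=X+Y+XY$ (so $a_{10}=a_{01}=a_{11}=1$ and all other $a_{ij}$ vanish). 1. There are unique $q_j$ ($j\ge0$) and $b_{ij}$ ($i\ge1$, $j\ge0$) in $A$ that satisfy the relations above and $q_j=-u(u+2)w^j$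 for $j\ge3$, $b_{11}=1$, and $b_{ij}=0$ whenever $i>1$ or $j>1$. 2. There is a $\mathbb Z/2$-equivariant formal group law over $A$ with the parameters $F,u,q_j,b_{ij}$, and any two such are isomorphic, by an isomorphism that preserves $x$, $\Delta$ and the $\theta_\gamma$. 3. Its underlying formal group law is the multiplicative one, $X+Y+XY$, but the equivariant formal group law is not multiplicative. 4. Its coproduct is given explicitly by $$\Delta x=x\otimes x+1\otimes x+x\otimes 1-u(u+2)\,\iota_1\rho\otimes\iota_1\rho,\qquad \rho=w\,\big(x-\varphi(x x_\alpha)\big).$$ Here $\varphi(t)\in\mathbb Z[w][[t]]$ is the power series with $\varphi(0)=0$ and $(w+1)\varphi^2+\varphi=wt$, and $\iota_1\in R$ is a lift of the idempotent of $R/(1-uw)R$ on which $\theta_0$ takes the value $0$ and $\theta_\alpha$ the value $1$ modulo $1-uw$ (the term does not depend on the lift, since $u(u+2)(1-uw)=0$). -/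

import Mathlib

open scoped TensorProduct

noncomputable section

namespace EqFGL

/-! ### Augmented algebras, their completions, completed tensor products -/

section Completion

variable {k : Type*} [CommRing k]
variable {ι B : Type*} [CommRing B] [Algebra k B]
variable {κ C : Type*} [CommRing C] [Algebra k C]
variable {μ D : Type*} [CommRing D] [Algebra k D]

/-- The ideal defining the topology on a `k`-algebra `B` with a family of augmentations
`θ i : B → k`.  For a finite family, the powers of the intersection of the kernels are cofinal
with the finite products of the kernels `ker (θ i)`. -/
def augIdeal (θ : ι → B →ₐ[k] k) : Ideal B := ⨅ i, RingHom.ker (θ i)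

/-- The completion of `B` with respect to the topology given by the augmentations. -/
abbrev Compl (θ : ι → B →ₐ[k] k) : Type _ := AdicCompletion (augIdeal θ) B

/-- The canonical map from `B` to its completion. -/
def toCompl (θ : ι → B →ₐ[k] k) : B →ₐ[k] Compl θ :=
  (Algebra.ofId B (Compl θ)).restrictScalars k

lemma augIdeal_le (θ : ι → B →ₐ[k] k) (i : ι) {b : B} (hb : b ∈ augIdeal θ) : θ i b = 0 := by
  have h : augIdeal θ ≤ RingHom.ker (θ i) := iInf_le _ i
  exact h hb

/-- The augmentation `θ i`, extended to the completion. -/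
def complAug (θ : ι → B →ₐ[k] k) (i : ι) : Compl θ →ₐ[k] k :=
  (Ideal.Quotient.liftₐ (augIdeal θ) (θ i) (fun _ hb => augIdeal_le θ i hb)).comp
    ((AdicCompletion.evalOneₐ (augIdeal θ)).restrictScalars k)

lemma complAug_toCompl (θ : ι → B →ₐ[k] k) (i : ι) (b : B) :
    complAug θ i (toCompl θ b) = θ i b := rfl

/-- A map of augmented algebras, with values in the completion: an algebra homomorphism
`B → Compl θC` such that each augmentation of the target restricts to an augmentation of `B`.
Such a map is automatically continuous. -/
structure AugHom (θB : ι → B →ₐ[k] k) (θC : κ → C →ₐ[k] k) where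
  /-- the underlying algebra homomorphism -/
  toAlgHom : B →ₐ[k] Compl θC
  /-- the map of index sets of augmentations -/
  idx : κ → ι
  compat : ∀ j b, complAug θC j (toAlgHom b) = θB (idx j) b

lemma factor_eval (I : Ideal B) {m n : ℕ} (h : m ≤ n) (y : AdicCompletion I B) :
    Ideal.Quotient.factor (Ideal.pow_le_pow_right h) (AdicCompletion.evalₐ I n y) =
      AdicCompletion.evalₐ I m y := by
  induction y using AdicCompletion.induction_on with
  | _ s =>
  rw [AdicCompletion.evalₐ_mk, AdicCompletion.evalₐ_mk]
  exact AdicCompletion.Ideal.mk_eq_mk I h s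

lemma complAug_congr (θ : ι → B →ₐ[k] k) (i : ι) {z w : Compl θ}
    (h : AdicCompletion.evalₐ (augIdeal θ) 1 z = AdicCompletion.evalₐ (augIdeal θ) 1 w) :
    complAug θ i z = complAug θ i w :=
  congrArg (fun t => Ideal.Quotient.liftₐ (augIdeal θ) (θ i)
    (fun _ hb => augIdeal_le θ i hb) (Ideal.Quotient.factor
      (show augIdeal θ ^ 1 ≤ augIdeal θ by simp) t)) h

namespace AugHom

variable {θB : ι → B →ₐ[k] k} {θC : κ → C →ₐ[k] k} {θD : μ → D →ₐ[k] k}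

lemma evalOne_eq_zero (f : AugHom θB θC) {b : B} (hb : b ∈ augIdeal θB) :
    AdicCompletion.evalOneₐ (augIdeal θC) (f.toAlgHom b) = 0 := by
  obtain ⟨c, hc⟩ := Ideal.Quotient.mk_surjective
    (AdicCompletion.evalOneₐ (augIdeal θC) (f.toAlgHom b))
  rw [← hc, Ideal.Quotient.eq_zero_iff_mem]
  refine (Submodule.mem_iInf _).2 fun j => ?_
  have h1 : complAug θC j (f.toAlgHom b) = θC j c := by
    change Ideal.Quotient.liftₐ (augIdeal θC) (θC j) (fun _ hb => augIdeal_le θC j hb)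
      (AdicCompletion.evalOneₐ (augIdeal θC) (f.toAlgHom b)) = _
    rw [← hc]
    rfl
  have h2 : θC j c = 0 := by rw [← h1, f.compat, augIdeal_le θB _ hb]
  exact h2

lemma eval_mem (f : AugHom θB θC) {n : ℕ} (hn : 1 ≤ n) {b : B} (hb : b ∈ augIdeal θB) :
    AdicCompletion.evalₐ (augIdeal θC) n (f.toAlgHom b) ∈
      (augIdeal θC).map (Ideal.Quotient.mk (augIdeal θC ^ n)) := by
  have h0 := f.evalOne_eq_zero hb
  induction hx : f.toAlgHom b using AdicCompletion.induction_on with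
  | _ s =>
  rw [hx] at h0
  rw [AdicCompletion.evalₐ_mk]
  refine Ideal.mem_map_of_mem _ ?_
  have h1 : (s.val 1) ∈ augIdeal θC := by
    have h2 : AdicCompletion.evalₐ (augIdeal θC) 1 (AdicCompletion.mk _ _ s) ∈
        RingHom.ker (Ideal.Quotient.factor
          (show augIdeal θC ^ 1 ≤ augIdeal θC by simp)) := h0
    rw [AdicCompletion.evalₐ_mk] at h2
    exact Ideal.Quotient.eq_zero_iff_mem.1 h2
  have h3 := AdicCompletion.Ideal.mk_eq_mk (augIdeal θC) hn s
  rw [Ideal.Quotient.eq, pow_one] at h3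
  have := (augIdeal θC).add_mem h3 h1
  simpa using this

lemma eval_pow_eq_zero (f : AugHom θB θC) (n : ℕ) {b : B} (hb : b ∈ augIdeal θB ^ n) :
    AdicCompletion.evalₐ (augIdeal θC) n (f.toAlgHom b) = 0 := by
  rcases Nat.eq_zero_or_pos n with rfl | hn
  · have : Subsingleton (C ⧸ augIdeal θC ^ 0) :=
      Ideal.Quotient.subsingleton_iff.2 (by simp)
    exact Subsingleton.elim _ _
  let g : B →+* C ⧸ augIdeal θC ^ n :=
    (AdicCompletion.evalₐ (augIdeal θC) n : _ →+* _).comp (f.toAlgHom : B →+* Compl θC)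
  have h1 : (augIdeal θB).map g ≤
      (augIdeal θC).map (Ideal.Quotient.mk (augIdeal θC ^ n)) :=
    Ideal.map_le_iff_le_comap.2 fun c hc => f.eval_mem hn hc
  have h2 : g b ∈ ((augIdeal θB).map g) ^ n := by
    rw [← Ideal.map_pow]
    exact Ideal.mem_map_of_mem g hb
  have h3 := Ideal.pow_right_mono h1 n h2
  rw [← Ideal.map_pow, Ideal.map_quotient_self] at h3
  exact h3

lemma extend_compat (f : AugHom θB θC) {m n : ℕ} (hle : m ≤ n) :
    (Ideal.Quotient.factorₐ k (Ideal.pow_le_pow_right (I := augIdeal θC) hle)).comp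
      ((Ideal.Quotient.liftₐ (augIdeal θB ^ n)
        (((AdicCompletion.evalₐ (augIdeal θC) n).restrictScalars k).comp f.toAlgHom)
        (fun _ hb => f.eval_pow_eq_zero n hb)).comp
          ((AdicCompletion.evalₐ (augIdeal θB) n).restrictScalars k)) =
      (Ideal.Quotient.liftₐ (augIdeal θB ^ m)
        (((AdicCompletion.evalₐ (augIdeal θC) m).restrictScalars k).comp f.toAlgHom)
        (fun _ hb => f.eval_pow_eq_zero m hb)).comp
          ((AdicCompletion.evalₐ (augIdeal θB) m).restrictScalars k) := by
  ext y
  obtain ⟨b, hb⟩ := Ideal.Quotient.mk_surjective (AdicCompletion.evalₐ (augIdeal θB) n y)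
  have hb' := congrArg (Ideal.Quotient.factor (Ideal.pow_le_pow_right hle)) hb
  rw [factor_eval _ hle, Ideal.Quotient.factor_mk] at hb'
  simp only [AlgHom.comp_apply, AlgHom.restrictScalars_apply, ← hb, ← hb']
  exact factor_eval (augIdeal θC) hle (f.toAlgHom b)

/-- The continuous extension of `f : B → Compl θC` to the completion of `B`. -/
def extend (f : AugHom θB θC) : Compl θB →ₐ[k] Compl θC :=
  AdicCompletion.liftAlgHom (augIdeal θC)
    (fun n => (Ideal.Quotient.liftₐ (augIdeal θB ^ n)
      (((AdicCompletion.evalₐ (augIdeal θC) n).restrictScalars k).comp f.toAlgHom)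
      (fun _ hb => f.eval_pow_eq_zero n hb)).comp
        ((AdicCompletion.evalₐ (augIdeal θB) n).restrictScalars k)) (f.extend_compat)

lemma eval_extend (f : AugHom θB θC) (n : ℕ) (y : Compl θB) (b : B)
    (hb : Ideal.Quotient.mk _ b = AdicCompletion.evalₐ (augIdeal θB) n y) :
    AdicCompletion.evalₐ (augIdeal θC) n (f.extend y) =
      AdicCompletion.evalₐ (augIdeal θC) n (f.toAlgHom b) := by
  rw [extend, AdicCompletion.evalₐ_liftAlgHom _ _ f.extend_compat]
  simp only [AlgHom.comp_apply, AlgHom.restrictScalars_apply, ← hb]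
  rfl

lemma extend_toCompl (f : AugHom θB θC) (b : B) : f.extend (toCompl θB b) = f.toAlgHom b :=
  AdicCompletion.ext_evalₐ fun n => f.eval_extend n _ b (AdicCompletion.evalₐ_of _ n b).symm

lemma complAug_extend (f : AugHom θB θC) (j : κ) (y : Compl θB) :
    complAug θC j (f.extend y) = complAug θB (f.idx j) y := by
  obtain ⟨b, hb⟩ := Ideal.Quotient.mk_surjective (AdicCompletion.evalₐ (augIdeal θB) 1 y)
  have h1 := f.eval_extend 1 y b hb
  rw [complAug_congr θC j h1, f.compat, ← complAug_toCompl]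
  exact complAug_congr θB _ ((AdicCompletion.evalₐ_of _ 1 b).trans hb)

/-- Composition of continuous maps. -/
def comp (g : AugHom θC θD) (f : AugHom θB θC) : AugHom θB θD where
  toAlgHom := g.extend.comp f.toAlgHom
  idx := f.idx ∘ g.idx
  compat j b := by
    rw [AlgHom.comp_apply, complAug_extend, f.compat]
    rfl

/-- An algebra homomorphism compatible with the augmentations. -/
def ofAlgHom (f : B →ₐ[k] C) (σ : κ → ι) (h : ∀ j b, θC j (f b) = θB (σ j) b) :
    AugHom θB θC where
  toAlgHom := (toCompl θC).comp f
  idx := σ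
  compat j b := h j b

/-- The canonical map to the completion. -/
def id (θB : ι → B →ₐ[k] k) : AugHom θB θB :=
  ofAlgHom (AlgHom.id k B) (fun i => i) (fun _ _ => rfl)

/-- The composite of the augmentation `θB i` and the unit map of `Compl θC`. -/
def const (θB : ι → B →ₐ[k] k) (θC : κ → C →ₐ[k] k) (i : ι) : AugHom θB θC :=
  ofAlgHom ((Algebra.ofId k C).comp (θB i)) (fun _ => i)
    (fun j b => by simp [Algebra.ofId_apply])

end AugHom

/-- The augmentations `θB i ⊗ θC j` of a tensor product.  The completed tensor product of
`B` and `C` is `Compl (tensorAug θB θC)`. -/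
def tensorAug (θB : ι → B →ₐ[k] k) (θC : κ → C →ₐ[k] k) : ι × κ → B ⊗[k] C →ₐ[k] k :=
  fun p => Algebra.TensorProduct.lift (θB p.1) (θC p.2) (fun _ _ => Commute.all _ _)

namespace AugHom

variable {θB : ι → B →ₐ[k] k} {θC : κ → C →ₐ[k] k} {θD : μ → D →ₐ[k] k}

/-- The map `b ↦ b ⊗ 1` into the completed tensor product. -/
def inl (θB : ι → B →ₐ[k] k) (θC : κ → C →ₐ[k] k) : AugHom θB (tensorAug θB θC) :=
  ofAlgHom Algebra.TensorProduct.includeLeft Prod.fst (fun j b => by simp [tensorAug])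

/-- The map `c ↦ 1 ⊗ c` into the completed tensor product. -/
def inr (θB : ι → B →ₐ[k] k) (θC : κ → C →ₐ[k] k) : AugHom θC (tensorAug θB θC) :=
  ofAlgHom Algebra.TensorProduct.includeRight Prod.snd (fun j b => by simp [tensorAug])

/-- The map `b ⊗ c ↦ f b * g c` out of the tensor product; its `extend` is the induced map out
of the completed tensor product. -/
def pair (f : AugHom θB θD) (g : AugHom θC θD) : AugHom (tensorAug θB θC) θD where
  toAlgHom := Algebra.TensorProduct.lift f.toAlgHom g.toAlgHom (fun _ _ => Commute.all _ _)
  idx := fun j => (f.idx j, g.idx j)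
  compat j y := by
    induction y using TensorProduct.induction_on with
    | zero => simp
    | tmul b c => simp [tensorAug, f.compat, g.compat]
    | add y z hy hz => simp [hy, hz]

end AugHom

end Completion

/-! ### Equivariant formal group laws -/

section FGL

/-- A `G`-equivariant formal group law over `k`, for a finite abelian group `G` with character
group `Γ` (written additively), with coordinate ring `R`.

The map `θ : R → k^Γ` is given by its components `θ γ`; `k^Γ` is the dual of the group ring
`k[Γ]`, so that compatibility of `θ` with the coproducts reads `(θ γ ⊗ θ δ) ∘ Δ = θ (γ + δ)`. -/
structure EquivariantFGL (k Γ R : Type*) [CommRing k] [AddCommGroup Γ] [Finite Γ]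
    [CommRing R] [Algebra k R] where
  /-- the components of the map `R → k^Γ` -/
  θ : Γ → R →ₐ[k] k
  /-- `R` is complete and Hausdorff for the topology given by products of kernels `ker (θ γ)` -/
  complete : IsAdicComplete (augIdeal θ) R
  /-- the coproduct, with values in the completed tensor square -/
  Δ : R →ₐ[k] Compl (tensorAug θ θ)
  aug_Δ : ∀ (p : Γ × Γ) (r : R), complAug (tensorAug θ θ) p (Δ r) = θ (p.1 + p.2) r
  /-- `(θ 0 ⊗ 1) ∘ Δ = 1` -/
  counit : ∀ r, ((AugHom.const θ θ 0).pair (AugHom.id θ)).extend (Δ r) = toCompl θ r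
  /-- the coproduct is cocommutative -/
  cocomm : ∀ r, ((AugHom.inr θ θ).pair (AugHom.inl θ θ)).extend (Δ r) = Δ r
  /-- `(Δ ⊗ 1) ∘ Δ = (1 ⊗ Δ) ∘ Δ` in the completion of `R ⊗ (R ⊗ R)` -/
  coassoc :
    let δ : AugHom θ (tensorAug θ θ) := ⟨Δ, fun p => p.1 + p.2, aug_Δ⟩
    let j₁ : AugHom θ (tensorAug θ (tensorAug θ θ)) := AugHom.inl θ (tensorAug θ θ)
    let j₂₃ : AugHom (tensorAug θ θ) (tensorAug θ (tensorAug θ θ)) :=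
      AugHom.inr θ (tensorAug θ θ)
    let j₂ := j₂₃.comp (AugHom.inl θ θ)
    let j₃ := j₂₃.comp (AugHom.inr θ θ)
    let j₁₂ := j₁.pair j₂
    ∀ r, ((j₁₂.comp δ).pair j₃).extend (Δ r) = (j₁.pair (j₂₃.comp δ)).extend (Δ r)
  /-- the coordinate (orientation) -/
  x : R
  x_regular : x ∈ nonZeroDivisors R
  ker_θ_zero : RingHom.ker (θ 0) = Ideal.span {x}

namespace EquivariantFGL

variable {k Γ R R' : Type*} [CommRing k] [AddCommGroup Γ] [Finite Γ]
variable [CommRing R] [Algebra k R] [CommRing R'] [Algebra k R']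

/-- The completed tensor square of the coordinate ring. -/
abbrev Square (E : EquivariantFGL k Γ R) : Type _ := Compl (tensorAug E.θ E.θ)

/-- The element `r ⊗ s` of the completed tensor square. -/
def tmul (E : EquivariantFGL k Γ R) (r s : R) : E.Square :=
  toCompl (tensorAug E.θ E.θ) (r ⊗ₜ[k] s)

/-- The inverse of the canonical map from `R` to its completion. -/
def ofCompl (E : EquivariantFGL k Γ R) : Compl E.θ →ₐ[k] R :=
  haveI := E.complete
  ((AdicCompletion.ofAlgEquiv (augIdeal E.θ)).symm.restrictScalars k : Compl E.θ ≃ₐ[k] R)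

/-- The translation by the character `γ`, `(θ γ ⊗ 1) ∘ Δ`. -/
def translate (E : EquivariantFGL k Γ R) (γ : Γ) : R →ₐ[k] R :=
  E.ofCompl.comp ((((AugHom.const E.θ E.θ γ).pair (AugHom.id E.θ)).extend).comp E.Δ)

/-- The pullback along multiplication by `2`: the coproduct followed by the multiplication. -/
def pullbackTwo (E : EquivariantFGL k Γ R) : R →ₐ[k] R :=
  E.ofCompl.comp ((((AugHom.id E.θ).pair (AugHom.id E.θ)).extend).comp E.Δ)

/-- The Euler class of the character `γ`. -/
def euler (E : EquivariantFGL k Γ R) (γ : Γ) : k := E.θ γ E.x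

/-- The equivariant formal group law is multiplicative:
`Δ x = x ⊗ 1 + 1 ⊗ x + v (x ⊗ x)` for some scalar `v`. -/
def IsMultiplicative (E : EquivariantFGL k Γ R) : Prop :=
  ∃ v : k, E.Δ E.x = E.tmul E.x 1 + E.tmul 1 E.x + v • E.tmul E.x E.x

end EquivariantFGL

/-- The coefficient of `X ^ i * Y ^ j` in a formal group law `F(X, Y)`. -/
def fglCoeff {k : Type*} [CommRing k] (F : FormalGroup k) (i j : ℕ) : k :=
  F.toPowerSeries.coeff (Finsupp.single 0 i + Finsupp.single 1 j)

/-- The coefficient of `X ^ j` in the `2`-series `F(X, X)`. -/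
def twoSeriesCoeff {k : Type*} [CommRing k] (F : FormalGroup k) (j : ℕ) : k :=
  PowerSeries.coeff j
    (MvPowerSeries.subst ![(PowerSeries.X : PowerSeries k), PowerSeries.X] F.toPowerSeries)

namespace EquivariantFGL

variable {k Γ R R' : Type*} [CommRing k] [AddCommGroup Γ] [Finite Γ]
variable [CommRing R] [Algebra k R] [CommRing R'] [Algebra k R']

/-- `F` is the underlying non-equivariant formal group law of `E`: the completion of `R` at the
ideal `(x)` is `k⟦x⟧`, and `Δ x` becomes `F(x ⊗ 1, 1 ⊗ x)` there. -/
def HasUnderlying (E : EquivariantFGL k Γ R) (F : FormalGroup k) : Prop :=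
  ∀ n : ℕ, E.Δ E.x - ∑ i ∈ Finset.range n, ∑ j ∈ Finset.range n,
      fglCoeff F i j • E.tmul (E.x ^ i) (E.x ^ j) ∈
    Ideal.span {E.tmul (E.x ^ n) 1, E.tmul 1 (E.x ^ n)}

/-- `s = f(t)`: the element `s` is the value at `t` of the power series `f`. -/
def HasValue (E : EquivariantFGL k Γ R) (f : PowerSeries k) (t s : R) : Prop :=
  ∀ n : ℕ, s - ∑ i ∈ Finset.range n, PowerSeries.coeff i f • t ^ i ∈ augIdeal E.θ ^ n

/-- `Q j` is the sequence of remainders of the `x`-adic expansion of `Q 0`: if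
`c_j = θ 0 (Q j)`, then `Q 0 = c_0 + c_1 x + ⋯ + c_(j-1) x^(j-1) + Q j * x^j` for all `j`. -/
def IsRemainderSeq (E : EquivariantFGL k Γ R) (Q : ℕ → R) : Prop :=
  ∀ j, Q j = algebraMap k R (E.θ 0 (Q j)) + E.x * Q (j + 1)

/-- Isomorphisms of equivariant formal group laws, preserving the coordinate. -/
structure Iso (E : EquivariantFGL k Γ R) (E' : EquivariantFGL k Γ R') where
  /-- the isomorphism of coordinate rings -/
  toAlgEquiv : R ≃ₐ[k] R'
  map_x : toAlgEquiv E.x = E'.x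
  map_θ : ∀ γ r, E'.θ γ (toAlgEquiv r) = E.θ γ r
  map_Δ :
    let φ : AugHom E.θ E'.θ := AugHom.ofAlgHom toAlgEquiv (fun γ => γ) map_θ
    ∀ r, E'.Δ (toAlgEquiv r) =
      (((AugHom.inl E'.θ E'.θ).comp φ).pair ((AugHom.inr E'.θ E'.θ).comp φ)).extend (E.Δ r)

end EquivariantFGL
end FGL

/-! ### Parameters of `ℤ/2`-equivariant formal group laws -/

section Parameters

/-- The relations between the generators `u, q j, b i j` (`i ≥ 1`, `j ≥ 0`) over the Lazard ring
in the presentation of the coefficients of `ℤ/2`-equivariant stable complex cobordism: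
`q 0 = 0`, `q j = c j + u * q (j + 1)`, `b i j = a i j + u * b i (j + 1)`, where
`F(X, Y) = ∑ a i j X ^ i Y ^ j` and `F(X, X) = ∑ c j X ^ j`.
Solutions in `k` are the ring homomorphisms from that ring to `k`. -/
structure IsParameterSystem {k : Type*} [CommRing k] (F : FormalGroup k) (u : k) (q : ℕ → k)
    (b : ℕ → ℕ → k) : Prop where
  comm : F.IsComm
  q_zero : q 0 = 0
  q_rel : ∀ j, q j = twoSeriesCoeff F j + u * q (j + 1)
  b_rel : ∀ i j, 1 ≤ i → b i j = fglCoeff F i j + u * b i (j + 1)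

/-- The `ℤ/2`-equivariant formal group law `E` has the parameters `(F, u, q, b)`.  Here
`ZMod 2` is the character group, and `1 : ZMod 2` is the non-trivial character `α`.

* `F` is the underlying formal group law, and `u` is the Euler class of `α`;
* expanding the pullback of `x` along multiplication by `2` in powers of `x`, one gets remainders
  `Q j ∈ R`, with `θ 0 (Q j) = c j`, and `q j = θ α (Q j)`;
* expanding `Δ x` in powers of `x ⊗ 1`, one gets `∑ x ^ i ⊗ B i 0`; expanding `B i 0 ∈ R` in
  powers of `x`, one gets remainders `B i j`, with `θ 0 (B i j) = a i j`,
  and `b i j = θ α (B i j)`. -/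
structure HasParameters {k R : Type*} [CommRing k] [CommRing R] [Algebra k R]
    (E : EquivariantFGL k (ZMod 2) R) (F : FormalGroup k) (u : k) (q : ℕ → k)
    (b : ℕ → ℕ → k) : Prop where
  underlying : E.HasUnderlying F
  euler : E.euler 1 = u
  q_eq : ∃ Q : ℕ → R, Q 0 = E.pullbackTwo E.x ∧ E.IsRemainderSeq Q ∧ ∀ j, q j = E.θ 1 (Q j)
  b_eq : ∃ B : ℕ → ℕ → R,
    (∀ n : ℕ, E.Δ E.x - ∑ i ∈ Finset.range n, E.tmul (E.x ^ i) (B i 0) ∈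
      Ideal.span {E.tmul (E.x ^ n) 1}) ∧
    (∀ i, E.IsRemainderSeq (B i)) ∧ ∀ i j, 1 ≤ i → b i j = E.θ 1 (B i j)

end Parameters

/-! ### The example -/

section Example

open MvPolynomial

/-- The ring `A = ℤ[u, w] / (u (u + 2) (1 - u w))`. -/
abbrev A : Type :=
  MvPolynomial (Fin 2) ℤ ⧸
    Ideal.span {(X 0 * (X 0 + 2) * (1 - X 0 * X 1) : MvPolynomial (Fin 2) ℤ)}

/-- The class of `u` in `A`. -/
def u : A := Ideal.Quotient.mk _ (X 0)

/-- The class of `w` in `A`. -/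
def w : A := Ideal.Quotient.mk _ (X 1)

end Example

end EqFGL
end

/-! Write N = u(u+2). Spec A is the union of the loci u = 0, u = -2 and uw = 1. Where N = 0 one has
(1+u)^2 = 1, and the multiplicative law with Euler class u is already equivariant. Where uw = 1, the
coordinate ring splits into two copies of k[[t]], with t = x x_α, one for each augmentation. There
1+φ is grouplike, and 1+x equals 1+φ on the identity component and (1+u)(1+φ) on the other. Since
(1+u)^2 need not be 1, Δ(1+x) differs from (1+x)⊗(1+x) on the product of the two non-identity
components, by Nσ⊗σ with σ = w(x-φ), which is (1+φ)ι₁ there. Because N(1-uw) = 0, this correction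
makes sense over all of A, and one quadratic k[[t]]-algebra, `CoordRing`, carries the structure
everywhere.

Existence. A map from `CoordRing` to a completion is a pair of images of x and x_α subject to one
relation (`liftCompl`). Since Nσ = u+(1+u)x-x_α (`mul_σ`), the Hopf axioms become polynomial
identities. The only analytic point is that φ(Δt) and (1+φ)⊗(1+φ)-1 agree up to the annihilator of
N, because both are topologically nilpotent roots of one quadratic (`mul_eq_mul_of_root`).

Parameters. Nσ is supported where x is invertible, so every x^n divides it (`exists_mul_σ_eq`,
`mul_σ_eq_pow`). The completion at x = 0 therefore sees only X+Y+XY, while θ_α still sees the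
correction. If the law were multiplicative, restricting to the diagonal and dividing by x^2 would
force u(u+2)w^2 = 0, which fails at u = w = 1.

Uniqueness. In any law with these parameters, the b_ij give x_α = u+(1+u)x modulo every x^n, and
translation by α gives the same with x and x_α exchanged. Hence Δx is known near each of the four
points of the square. These points are separated (`eq_zero_of_forall_mem`): modulo powers of t the
tensor square has coordinates in k, and a coordinate of an element vanishing near all four points is
both a multiple of u and u-power torsion. Such scalars vanish in A because u divides the defining
polynomial only once (`A_eq_zero_of_torsion`). This determines x_α (`xα_eq`) and Δx (`Δ_x_eq`), and
expansion in powers of t with coefficients a+bx identifies R with `CoordRing`.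

Connectedness. The three loci have the domains ℤ[w], ℤ[w] and ℤ[u,1/u] as rings; the first two meet
over 𝔽₂ and the last two over 𝔽₃. An idempotent that vanishes on one locus vanishes on all, and its
cube is then divisible by the defining relation. -/

noncomputable section

namespace EqFGL

/-! ### Calculus of continuous maps between completions. -/

section Completion

variable {k : Type*} [CommRing k]
variable {ι B : Type*} [CommRing B] [Algebra k B]
variable {κ C : Type*} [CommRing C] [Algebra k C]
variable {μ D : Type*} [CommRing D] [Algebra k D]
variable {ν D' : Type*} [CommRing D'] [Algebra k D']

lemma evalₐ_toCompl (θ : ι → B →ₐ[k] k) (n : ℕ) (b : B) :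
    AdicCompletion.evalₐ (augIdeal θ) n (toCompl θ b) = Ideal.Quotient.mk _ b :=
  AdicCompletion.evalₐ_of _ n b

lemma mem_augIdeal {θ : ι → B →ₐ[k] k} {b : B} : b ∈ augIdeal θ ↔ ∀ i, θ i b = 0 := by
  simp [augIdeal, RingHom.mem_ker]

/-- Powers of an element of the completion that is killed by all augmentations tend to zero. -/
lemma evalₐ_pow_eq_zero {θ : ι → B →ₐ[k] k} {y : Compl θ} (hy : ∀ i, complAug θ i y = 0)
    (n : ℕ) : AdicCompletion.evalₐ (augIdeal θ) n y ^ n = 0 := by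
  rcases Nat.eq_zero_or_pos n with rfl | hn
  · have : Subsingleton (B ⧸ augIdeal θ ^ 0) := Ideal.Quotient.subsingleton_iff.2 (by simp)
    exact Subsingleton.elim _ _
  obtain ⟨b, hb⟩ := Ideal.Quotient.mk_surjective (AdicCompletion.evalₐ (augIdeal θ) n y)
  have hb1 := congrArg (Ideal.Quotient.factor (Ideal.pow_le_pow_right hn)) hb
  rw [factor_eval _ hn, Ideal.Quotient.factor_mk] at hb1
  have hmem : b ∈ augIdeal θ := mem_augIdeal.2 fun i => by
    rw [← hy i, ← complAug_toCompl]
    refine complAug_congr θ i ?_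
    rw [evalₐ_toCompl]
    exact hb1
  rw [← hb, ← map_pow, Ideal.Quotient.eq_zero_iff_mem]
  exact Ideal.pow_mem_pow hmem n

/-- An element of the completion is zero if it is annihilated by `1 + y`, where `y` is killed by
all augmentations. -/
lemma eq_zero_of_mul_one_add {θ : ι → B →ₐ[k] k} {y c : Compl θ}
    (hy : ∀ i, complAug θ i y = 0) (h : c * (1 + y) = 0) : c = 0 := by
  -- The hypothesis reads c = -cy; iterating it puts c in every power of the ideal, so no inverse of
  -- 1+y is needed.
  have h1 : ∀ n, c = c * (-y) ^ n := fun n => by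
    induction n with
    | zero => simp
    | succ n ih =>
      have : c = c * (-y) := by linear_combination h
      rw [pow_succ', ← mul_assoc, ← this]
      exact ih
  refine AdicCompletion.ext_evalₐ fun n => ?_
  rw [h1 n, neg_pow, map_mul, map_mul, map_pow _ y, evalₐ_pow_eq_zero hy n]
  simp

namespace AugHom

variable {θB : ι → B →ₐ[k] k} {θC : κ → C →ₐ[k] k} {θD : μ → D →ₐ[k] k}
variable {θD' : ν → D' →ₐ[k] k}

lemma extend_congr {f g : AugHom θB θC} (h : f.toAlgHom = g.toAlgHom) : f.extend = g.extend := by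
  refine AlgHom.ext fun y => ?_
  refine AdicCompletion.ext_evalₐ fun n => ?_
  obtain ⟨b, hb⟩ := Ideal.Quotient.mk_surjective (AdicCompletion.evalₐ (augIdeal θB) n y)
  rw [f.eval_extend n y b hb, g.eval_extend n y b hb, h]

lemma extend_extend (g : AugHom θC θD) (f : AugHom θB θC) (y : Compl θB) :
    g.extend (f.extend y) = (g.comp f).extend y := by
  refine AdicCompletion.ext_evalₐ fun n => ?_
  obtain ⟨b, hb⟩ := Ideal.Quotient.mk_surjective (AdicCompletion.evalₐ (augIdeal θB) n y)
  obtain ⟨c, hc⟩ := Ideal.Quotient.mk_surjective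
    (AdicCompletion.evalₐ (augIdeal θC) n (f.extend y))
  rw [(g.comp f).eval_extend n y b hb, g.eval_extend n _ c hc]
  refine (g.eval_extend n (f.toAlgHom b) c ?_).symm
  rw [hc, f.eval_extend n y b hb]

lemma id_extend (y : Compl θB) : (AugHom.id θB).extend y = y := by
  refine AdicCompletion.ext_evalₐ fun n => ?_
  obtain ⟨b, hb⟩ := Ideal.Quotient.mk_surjective (AdicCompletion.evalₐ (augIdeal θB) n y)
  rw [AugHom.eval_extend _ n y b hb, ← hb]
  exact evalₐ_toCompl _ _ _

@[simp] lemma ofAlgHom_toAlgHom (f : B →ₐ[k] C) (σ : κ → ι)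
    (h : ∀ j b, θC j (f b) = θB (σ j) b) (b : B) :
    (ofAlgHom (θB := θB) (θC := θC) f σ h).toAlgHom b = toCompl θC (f b) := rfl

@[simp] lemma id_toAlgHom (b : B) : (AugHom.id θB).toAlgHom b = toCompl θB b := rfl

@[simp] lemma const_toAlgHom (i : ι) (b : B) :
    (const θB θC i).toAlgHom b = algebraMap k _ (θB i b) := by
  change toCompl θC (algebraMap k C (θB i b)) = _
  exact (toCompl θC).commutes _

@[simp] lemma comp_toAlgHom (g : AugHom θC θD) (f : AugHom θB θC) (b : B) :
    (g.comp f).toAlgHom b = g.extend (f.toAlgHom b) := rfl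

lemma pair_tmul (f : AugHom θB θD) (g : AugHom θC θD) (b : B) (c : C) :
    (f.pair g).toAlgHom (b ⊗ₜ[k] c) = f.toAlgHom b * g.toAlgHom c := by
  simp [pair]

@[simp] lemma pair_extend_inl (f : AugHom θB θD) (g : AugHom θC θD) (b : B) :
    (f.pair g).extend ((inl θB θC).toAlgHom b) = f.toAlgHom b := by
  change (f.pair g).extend (toCompl _ (b ⊗ₜ[k] 1)) = _
  rw [extend_toCompl, pair_tmul, map_one, mul_one]

@[simp] lemma pair_extend_inr (f : AugHom θB θD) (g : AugHom θC θD) (c : C) :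
    (f.pair g).extend ((inr θB θC).toAlgHom c) = g.toAlgHom c := by
  change (f.pair g).extend (toCompl _ (1 ⊗ₜ[k] c)) = _
  rw [extend_toCompl, pair_tmul, map_one, one_mul]

lemma toCompl_tmul (b : B) (c : C) : toCompl (tensorAug θB θC) (b ⊗ₜ[k] c) =
    (inl θB θC).toAlgHom b * (inr θB θC).toAlgHom c := by
  change _ = toCompl _ (b ⊗ₜ[k] 1) * toCompl _ (1 ⊗ₜ[k] c)
  rw [← map_mul, Algebra.TensorProduct.tmul_mul_tmul, mul_one, one_mul]

@[simp] lemma complAug_inl (i : ι) (j : κ) (b : B) :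
    complAug (tensorAug θB θC) (i, j) ((inl θB θC).toAlgHom b) = θB i b :=
  (inl θB θC).compat (i, j) b

@[simp] lemma complAug_inr (i : ι) (j : κ) (c : C) :
    complAug (tensorAug θB θC) (i, j) ((inr θB θC).toAlgHom c) = θC j c :=
  (inr θB θC).compat (i, j) c

lemma pair_congr {f f' : AugHom θB θD} {g g' : AugHom θC θD} (hf : ∀ b, f.toAlgHom b = f'.toAlgHom b)
    (hg : ∀ c, g.toAlgHom c = g'.toAlgHom c) : (f.pair g).extend = (f'.pair g').extend := by
  refine extend_congr (Algebra.TensorProduct.ext' fun b c => ?_)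
  rw [pair_tmul, pair_tmul, hf, hg]

lemma extend_pair (h : AugHom θD θD') (f : AugHom θB θD) (g : AugHom θC θD)
    (y : Compl (tensorAug θB θC)) :
    h.extend ((f.pair g).extend y) = ((h.comp f).pair (h.comp g)).extend y := by
  rw [extend_extend]
  refine DFunLike.congr_fun (extend_congr (Algebra.TensorProduct.ext' fun b c => ?_)) y
  rw [pair_tmul, comp_toAlgHom, pair_tmul, map_mul]
  rfl

lemma extend_eq_pair (g : AugHom (tensorAug θB θC) θD) (y : Compl (tensorAug θB θC)) :
    g.extend y = ((g.comp (inl θB θC)).pair (g.comp (inr θB θC))).extend y := by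
  refine DFunLike.congr_fun (extend_congr (Algebra.TensorProduct.ext' fun b c => ?_)) y
  rw [pair_tmul, comp_toAlgHom, comp_toAlgHom, ← map_mul, ← toCompl_tmul, extend_toCompl]

lemma extend_inr_extend (f : AugHom θB θD) (g : AugHom θC θD) (y : Compl θC) :
    (f.pair g).extend ((inr θB θC).extend y) = g.extend y := by
  rw [extend_extend]
  exact DFunLike.congr_fun (extend_congr (AlgHom.ext fun b => pair_extend_inr f g b)) y

end AugHom

end Completion

/-! ### Translations by characters. -/

namespace EquivariantFGL

variable {k Γ R : Type*} [CommRing k] [AddCommGroup Γ] [Finite Γ] [CommRing R] [Algebra k R]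
variable (E : EquivariantFGL k Γ R)

/-- The inclusion of the first factor of the completed tensor square. -/
def left : R →ₐ[k] E.Square := (AugHom.inl E.θ E.θ).toAlgHom

/-- The inclusion of the second factor of the completed tensor square. -/
def right : R →ₐ[k] E.Square := (AugHom.inr E.θ E.θ).toAlgHom

lemma tmul_eq (r s : R) : E.tmul r s = E.left r * E.right s := AugHom.toCompl_tmul r s

/-- The coproduct, as a map of augmented algebras. -/
def comul : AugHom E.θ (tensorAug E.θ E.θ) := ⟨E.Δ, fun p => p.1 + p.2, E.aug_Δ⟩

@[simp] lemma toCompl_ofCompl (y : Compl E.θ) : toCompl E.θ (E.ofCompl y) = y :=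
  haveI := E.complete
  AdicCompletion.of_ofAlgEquiv_symm (augIdeal E.θ) y

@[simp] lemma ofCompl_toCompl (r : R) : E.ofCompl (toCompl E.θ r) = r :=
  haveI := E.complete
  AdicCompletion.ofAlgEquiv_symm_of (augIdeal E.θ) r

lemma toCompl_injective : Function.Injective (toCompl E.θ) :=
  Function.LeftInverse.injective E.ofCompl_toCompl

lemma toCompl_translate (γ : Γ) (r : R) : toCompl E.θ (E.translate γ r) =
    ((AugHom.const E.θ E.θ γ).pair (AugHom.id E.θ)).extend (E.Δ r) :=
  E.toCompl_ofCompl _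

lemma θ_translate (γ δ : Γ) (r : R) : E.θ δ (E.translate γ r) = E.θ (γ + δ) r := by
  rw [← complAug_toCompl, toCompl_translate, AugHom.complAug_extend]
  exact E.aug_Δ (γ, δ) r

/-- The translation by a character, as a map of augmented algebras. -/
def translateHom (γ : Γ) : AugHom E.θ E.θ :=
  AugHom.ofAlgHom (E.translate γ) (fun δ => γ + δ) (E.θ_translate γ)

lemma translate_zero (r : R) : E.translate 0 r = r :=
  E.toCompl_injective ((E.toCompl_translate 0 r).trans (E.counit r))

/-- The coproduct is equivariant for translations. -/
lemma Δ_translate (γ : Γ) (r : R) : E.Δ (E.translate γ r) =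
    (((AugHom.inl E.θ E.θ).comp (E.translateHom γ)).pair (AugHom.inr E.θ E.θ)).extend (E.Δ r) := by
  -- Apply θ_γ ⊗ 1 ⊗ 1 to coassociativity: one side becomes the coproduct of the translate, the
  -- other translates the first factor of the coproduct.
  have h := congrArg ((AugHom.const E.θ (tensorAug E.θ E.θ) γ).pair
    (AugHom.id (tensorAug E.θ E.θ))).extend (E.coassoc r)
  rw [AugHom.extend_pair, AugHom.extend_pair] at h
  have h1 : E.Δ (E.translate γ r) = E.comul.extend (toCompl E.θ (E.translate γ r)) :=
    (AugHom.extend_toCompl E.comul _).symm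
  rw [h1, toCompl_translate, AugHom.extend_pair]
  refine Eq.trans ?_ (h.symm.trans ?_)
  · refine DFunLike.congr_fun (AugHom.pair_congr (fun b => ?_) fun c => ?_) _
    · simp
    · simp only [AugHom.comp_toAlgHom, AugHom.id_toAlgHom, AugHom.extend_toCompl]
      rw [AugHom.extend_inr_extend, AugHom.id_extend]
      rfl
  · refine DFunLike.congr_fun (AugHom.pair_congr (fun b => ?_) fun c => ?_) _
    · simp only [AugHom.comp_toAlgHom]
      change _ = (AugHom.inl E.θ E.θ).extend (toCompl E.θ (E.translate γ b))
      rw [toCompl_translate, AugHom.extend_pair, AugHom.extend_pair]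
      refine DFunLike.congr_fun (AugHom.pair_congr (fun b => ?_) fun c => ?_) _
      · simp
      · simp only [AugHom.comp_toAlgHom, AugHom.id_toAlgHom, AugHom.extend_toCompl]
        rw [AugHom.extend_inr_extend, AugHom.id_extend]
    · simp only [AugHom.comp_toAlgHom]
      rw [AugHom.extend_inr_extend, AugHom.id_extend]

lemma translate_translate (γ δ : Γ) (r : R) :
    E.translate δ (E.translate γ r) = E.translate (γ + δ) r := by
  refine E.toCompl_injective ?_
  rw [toCompl_translate, Δ_translate, AugHom.extend_pair, toCompl_translate]
  refine DFunLike.congr_fun (AugHom.pair_congr (fun b => ?_) fun c => ?_) _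
  · simp only [AugHom.comp_toAlgHom, translateHom, AugHom.ofAlgHom_toAlgHom,
      AugHom.extend_toCompl, AugHom.pair_extend_inl, AugHom.const_toAlgHom, θ_translate]
  · simp

end EquivariantFGL
end EqFGL
end

noncomputable section

namespace EqFGL

/-! ### Evaluation of power series in completions -/

section Evaluation

variable {k : Type*} [CommRing k] {T : Type*} [CommRing T] [Algebra k T]

open PowerSeries in
lemma aeval_eq_of_coeff_eq {τ : T} {n : ℕ} (hτ : τ ^ n = 0) {p q : Polynomial k}
    (h : ∀ i < n, p.coeff i = q.coeff i) : Polynomial.aeval τ p = Polynomial.aeval τ q := by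
  have h1 : (Polynomial.X : Polynomial k) ^ n ∣ p - q :=
    Polynomial.X_pow_dvd_iff.2 fun i hi => by rw [Polynomial.coeff_sub, h i hi, sub_self]
  obtain ⟨r, hr⟩ := h1
  rw [← sub_eq_zero, ← map_sub, hr, map_mul, map_pow, Polynomial.aeval_X, hτ, zero_mul]

/-- Evaluation of power series at a nilpotent element. -/
def truncEval (n : ℕ) (τ : T) (hτ : τ ^ n = 0) : PowerSeries k →ₐ[k] T :=
  AlgHom.ofLinearMap ((Polynomial.aeval τ).toLinearMap ∘ₗ PowerSeries.trunc n)
    ((aeval_eq_of_coeff_eq hτ (q := 1) fun i hi => by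
      rw [PowerSeries.coeff_trunc, if_pos hi, PowerSeries.coeff_one, Polynomial.coeff_one]).trans
      (map_one _))
    (fun f g => (aeval_eq_of_coeff_eq hτ
      (q := PowerSeries.trunc n f * PowerSeries.trunc n g) fun i hi => by
        rw [PowerSeries.coeff_trunc, if_pos hi,
          PowerSeries.coeff_mul_eq_coeff_trunc_mul_trunc f g hi, ← Polynomial.coe_mul,
          Polynomial.coeff_coe]).trans (map_mul _ _ _))

lemma truncEval_apply (n : ℕ) (τ : T) (hτ : τ ^ n = 0) (f : PowerSeries k) :
    truncEval n τ hτ f = Polynomial.aeval τ (PowerSeries.trunc n f) := rfl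

variable {κ C : Type*} [CommRing C] [Algebra k C] {θ : κ → C →ₐ[k] k}

lemma truncEval_compat (τ : Compl θ) (hτ : ∀ i, complAug θ i τ = 0) {m n : ℕ} (hle : m ≤ n) :
    (Ideal.Quotient.factorₐ k (Ideal.pow_le_pow_right (I := augIdeal θ) hle)).comp
      (truncEval n (AdicCompletion.evalₐ (augIdeal θ) n τ) (evalₐ_pow_eq_zero hτ n)) =
      truncEval m (AdicCompletion.evalₐ (augIdeal θ) m τ) (evalₐ_pow_eq_zero hτ m) := by
  ext f
  simp only [AlgHom.comp_apply, truncEval_apply]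
  rw [← Polynomial.aeval_algHom_apply, Ideal.Quotient.factorₐ_apply, factor_eval _ hle]
  refine aeval_eq_of_coeff_eq (evalₐ_pow_eq_zero hτ m) fun i hi => ?_
  rw [PowerSeries.coeff_trunc, PowerSeries.coeff_trunc, if_pos hi, if_pos (hi.trans_le hle)]

/-- Evaluation of power series at an element of a completion that is killed by all
augmentations. -/
def evalSeries (τ : Compl θ) (hτ : ∀ i, complAug θ i τ = 0) : PowerSeries k →ₐ[k] Compl θ :=
  AdicCompletion.liftAlgHom (augIdeal θ)
    (fun n => truncEval n (AdicCompletion.evalₐ (augIdeal θ) n τ) (evalₐ_pow_eq_zero hτ n))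
    (truncEval_compat τ hτ)

lemma evalₐ_evalSeries (τ : Compl θ) (hτ : ∀ i, complAug θ i τ = 0) (n : ℕ)
    (f : PowerSeries k) : AdicCompletion.evalₐ (augIdeal θ) n (evalSeries τ hτ f) =
      Polynomial.aeval (AdicCompletion.evalₐ (augIdeal θ) n τ) (PowerSeries.trunc n f) :=
  AdicCompletion.evalₐ_liftAlgHom _ _ (truncEval_compat τ hτ) _ _

@[simp] lemma evalSeries_X (τ : Compl θ) (hτ : ∀ i, complAug θ i τ = 0) :
    evalSeries τ hτ PowerSeries.X = τ := by
  refine AdicCompletion.ext_evalₐ fun n => ?_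
  rw [evalₐ_evalSeries, aeval_eq_of_coeff_eq (evalₐ_pow_eq_zero hτ n) (q := Polynomial.X)
    (fun i hi => by
      rw [PowerSeries.coeff_trunc, if_pos hi, PowerSeries.coeff_X, Polynomial.coeff_X]
      simp [eq_comm]), Polynomial.aeval_X]

/-- An algebra homomorphism from power series to a completion that sends `X` to a topologically
nilpotent element is continuous. -/
lemma evalₐ_algHom (g : PowerSeries k →ₐ[k] Compl θ)
    (hg : ∀ i, complAug θ i (g PowerSeries.X) = 0) (n : ℕ) (f : PowerSeries k) :
    AdicCompletion.evalₐ (augIdeal θ) n (g f) =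
      Polynomial.aeval (AdicCompletion.evalₐ (augIdeal θ) n (g PowerSeries.X))
        (PowerSeries.trunc n f) := by
  have h1 : ∀ p : Polynomial k, g (p : PowerSeries k) = Polynomial.aeval (g PowerSeries.X) p :=
    fun p => by
      have := DFunLike.congr_fun (Polynomial.algHom_ext (f := g.comp (Polynomial.coeToPowerSeries.algHom k))
        (g := Polynomial.aeval (g PowerSeries.X)) (by simp)) p
      simpa using this
  -- The tail is a multiple of X^n, whose image vanishes at level n whatever the map does to the
  -- cofactor; continuity is thus automatic.
  conv_lhs => rw [PowerSeries.eq_X_pow_mul_shift_add_trunc n f]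
  rw [map_add, map_mul, map_pow, map_add, map_mul, map_pow, evalₐ_pow_eq_zero hg, zero_mul,
    zero_add, h1]
  exact (Polynomial.aeval_algHom_apply
    ((AdicCompletion.evalₐ (augIdeal θ) n).restrictScalars k) _ _).symm

lemma powerSeries_algHom_ext {g g' : PowerSeries k →ₐ[k] Compl θ}
    (hg : ∀ i, complAug θ i (g PowerSeries.X) = 0) (h : g PowerSeries.X = g' PowerSeries.X) :
    g = g' := by
  refine AlgHom.ext fun f => AdicCompletion.ext_evalₐ fun n => ?_
  rw [evalₐ_algHom g hg, evalₐ_algHom g' (h ▸ hg), h]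

lemma algHom_apply_algHom (g : PowerSeries k →ₐ[k] T) (p : T →ₐ[k] k)
    (hg : p (g PowerSeries.X) = 0) (f : PowerSeries k) :
    p (g f) = PowerSeries.constantCoeff f := by
  conv_lhs => rw [PowerSeries.eq_X_mul_shift_add_const f]
  rw [map_add, map_mul, map_add, map_mul, hg, zero_mul, zero_add]
  exact (p.comp g).commutes _

end Evaluation

/-! ### The power series `φ` -/

section RootSeries

open PowerSeries

/-- The power series `φ` over `ℤ[w]` with `φ(0) = 0` and `(w + 1) φ² + φ = w t`. -/
def universalRoot : PowerSeries (Polynomial ℤ) :=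
  C Polynomial.X * X * PowerSeries.rescale (-((Polynomial.X + 1) * Polynomial.X))
    (catalanSeries.map (Nat.castRingHom (Polynomial ℤ)))

lemma constantCoeff_universalRoot : constantCoeff universalRoot = 0 := by
  simp [universalRoot]

/-- The Catalan series satisfies c = 1 + s c². At s = -w(w+1)t, multiplying by wt gives the
quadratic equation for φ = wt·c. This form also keeps the coefficients integral in w. -/
lemma universalRoot_eq :
    C (Polynomial.X + 1) * universalRoot ^ 2 + universalRoot = C Polynomial.X * X := by
  have h := congrArg (fun f => PowerSeries.rescale (-((Polynomial.X + 1) * Polynomial.X))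
    (f.map (Nat.castRingHom (Polynomial ℤ)))) catalanSeries_sq_mul_X_add_one
  simp only [map_add, map_mul, map_pow, map_one, PowerSeries.map_X, PowerSeries.rescale_X] at h
  rw [universalRoot, map_add, map_one]
  rw [map_neg, map_mul, map_add, map_one] at h
  linear_combination -C Polynomial.X * X * h

variable {k : Type*} [CommRing k] (w : k)

/-- The power series `φ` over `k`, for `w` in `k`. -/
def rootSeries : PowerSeries k := universalRoot.map (Polynomial.eval₂RingHom (Int.castRingHom k) w)

lemma constantCoeff_rootSeries : constantCoeff (rootSeries w) = 0 := by
  rw [rootSeries, ← coeff_zero_eq_constantCoeff_apply, coeff_map, coeff_zero_eq_constantCoeff_apply,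
    constantCoeff_universalRoot, map_zero]

lemma rootSeries_eq : C (w + 1) * rootSeries w ^ 2 + rootSeries w = C w * X := by
  have h := congrArg (PowerSeries.map (Polynomial.eval₂RingHom (Int.castRingHom k) w))
    universalRoot_eq
  simpa [rootSeries] using h

end RootSeries

end EqFGL
end

noncomputable section

namespace EqFGL

/-! ### The coordinate ring -/

/-- Algebra homomorphisms out of a quadratic algebra. -/
def quadraticLift {k S T : Type*} [CommRing k] [CommRing S] [Algebra k S] [CommRing T]
    [Algebra k T] {a b : S} (ev : S →ₐ[k] T) (y : T) (hy : y * y = ev a + ev b * y) :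
    QuadraticAlgebra S a b →ₐ[k] T where
  toFun r := ev r.re + ev r.im * y
  map_one' := by
    change ev 1 + ev 0 * y = 1
    simp
  map_zero' := by
    change ev 0 + ev 0 * y = 0
    simp
  map_add' r s := by
    simp only [QuadraticAlgebra.re_add, QuadraticAlgebra.im_add, map_add]
    ring
  map_mul' r s := by
    simp only [QuadraticAlgebra.re_mul, QuadraticAlgebra.im_mul, map_mul, map_add]
    linear_combination (-ev r.im * ev s.im) * hy
  commutes' c := by
    change ev (algebraMap k S c) + ev 0 * y = _
    rw [AlgHom.commutes, map_zero, zero_mul, add_zero]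

section CoordRing

open PowerSeries

variable {k : Type*} [CommRing k]

/-- The coordinate ring `k⟦t⟧[x] / (x² - (u + u (u + 2) w φ) x - (1 + u - u (u + 2) w) t)`. -/
abbrev CoordRing (u w : k) : Type _ :=
  QuadraticAlgebra k⟦X⟧ (C (1 + u - u * (u + 2) * w) * X)
    (C u + C (u * (u + 2) * w) * rootSeries w)

namespace CoordRing

variable (u w : k)

/-- The coordinate. -/
def x : CoordRing u w := ⟨0, 1⟩

/-- The inclusion of the power series. -/
def ofSeries : k⟦X⟧ →ₐ[k] CoordRing u w :=
  IsScalarTower.toAlgHom k k⟦X⟧ (CoordRing u w)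

/-- The element `t = x x_α`. -/
def t : CoordRing u w := ofSeries u w X

/-- The element `φ(t)`. -/
def φ : CoordRing u w := ofSeries u w (rootSeries w)

/-- The translate `x_α` of the coordinate. -/
def z : CoordRing u w :=
  algebraMap k _ u + algebraMap k _ (1 + u - u * (u + 2) * w) * x u w +
    algebraMap k _ (u * (u + 2) * w) * φ u w

/-- The element `w (x - φ(t))`. -/
def σ : CoordRing u w := algebraMap k _ w * (x u w - φ u w)

lemma ofSeries_apply (f : k⟦X⟧) : ofSeries u w f = ⟨f, 0⟩ := rfl

lemma eq_add (r : CoordRing u w) : r = ofSeries u w r.re + ofSeries u w r.im * x u w := by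
  ext1 <;> simp [ofSeries_apply, x]

lemma ofSeries_C (c : k) : ofSeries u w (C c) = algebraMap k _ c :=
  (ofSeries u w).commutes c

lemma x_mul_x : x u w * x u w = algebraMap k _ (1 + u - u * (u + 2) * w) * t u w +
    (algebraMap k _ u + algebraMap k _ (u * (u + 2) * w) * φ u w) * x u w := by
  simp only [t, φ, ← ofSeries_C, ← map_mul, ← map_add]
  ext1 <;> simp [ofSeries_apply, x]

lemma root_eq : algebraMap k _ (w + 1) * φ u w ^ 2 + φ u w = algebraMap k _ w * t u w := by
  simp only [t, φ, ← ofSeries_C, ← map_mul, ← map_add, ← map_pow, rootSeries_eq]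

variable {u w}

lemma t_dvd_φ : t u w ∣ φ u w := by
  have h : (X : k⟦X⟧) ∣ rootSeries w := X_dvd_iff.2 (constantCoeff_rootSeries w)
  exact map_dvd (ofSeries u w) h

section Lift

variable {T : Type*} [CommRing T] [Algebra k T]

/-- Algebra homomorphisms out of the coordinate ring. -/
def lift (ev : k⟦X⟧ →ₐ[k] T) (y : T)
    (hy : y * y = ev (C (1 + u - u * (u + 2) * w) * X) +
      ev (C u + C (u * (u + 2) * w) * rootSeries w) * y) : CoordRing u w →ₐ[k] T :=
  quadraticLift ev y hy

lemma lift_ofSeries (ev : k⟦X⟧ →ₐ[k] T) (y : T) (hy) (f : k⟦X⟧) :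
    lift (u := u) (w := w) ev y hy (ofSeries u w f) = ev f := by
  change ev f + ev 0 * y = _
  simp

@[simp] lemma lift_x (ev : k⟦X⟧ →ₐ[k] T) (y : T) (hy) :
    lift (u := u) (w := w) ev y hy (x u w) = y := by
  change ev 0 + ev 1 * y = _
  simp

end Lift

/-- The augmentation with `x ↦ v` and `t ↦ 0`. -/
def aug (v : k) (hv : v * v = u * v) : CoordRing u w →ₐ[k] k :=
  lift ({ constantCoeff with commutes' := fun c => by simp } : k⟦X⟧ →ₐ[k] k) v (by
    change _ = constantCoeff _ + constantCoeff _ * v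
    simp [constantCoeff_rootSeries, hv])

@[simp] lemma aug_x (v : k) (hv : v * v = u * v) : aug (w := w) v hv (x u w) = v := lift_x _ _ _

lemma aug_ofSeries (v : k) (hv : v * v = u * v) (f : k⟦X⟧) :
    aug v hv (ofSeries u w f) = constantCoeff f := lift_ofSeries _ _ _ _

@[simp] lemma aug_t (v : k) (hv : v * v = u * v) : aug v hv (t u w) = 0 := by
  simp [t, aug_ofSeries]

@[simp] lemma aug_φ (v : k) (hv : v * v = u * v) : aug v hv (φ u w) = 0 := by
  simp [φ, aug_ofSeries, constantCoeff_rootSeries]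

lemma eq_aug (p : CoordRing u w →ₐ[k] k) (hp : p (t u w) = 0) (r : CoordRing u w) :
    p r = constantCoeff r.re + constantCoeff r.im * p (x u w) := by
  refine (congrArg p (eq_add u w r)).trans ?_
  rw [map_add, map_mul p, algHom_apply_algHom (ofSeries u w) p hp r.re,
    algHom_apply_algHom (ofSeries u w) p hp r.im]

variable (u w) in
/-- The augmentations. -/
def θ (γ : ZMod 2) : CoordRing u w →ₐ[k] k :=
  if γ = 0 then aug 0 (by simp) else aug u rfl

@[simp] lemma θ_t (γ : ZMod 2) : θ u w γ (t u w) = 0 := by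
  rw [θ]
  split_ifs <;> simp

@[simp] lemma θ_φ (γ : ZMod 2) : θ u w γ (φ u w) = 0 := by
  rw [θ]
  split_ifs <;> simp

@[simp] lemma θ_zero_x : θ u w 0 (x u w) = 0 := aug_x _ (by simp)

@[simp] lemma θ_one_x : θ u w 1 (x u w) = u := aug_x _ rfl

/-- The relation between the coordinates on the two components of the locus `u w = 1`. -/
lemma sub_mul_sub : (x u w - φ u w) *
    (x u w - algebraMap k _ u - algebraMap k _ (1 + u) * φ u w) =
    algebraMap k _ (1 - u * w) * (φ u w ^ 2 - t u w +
      algebraMap k _ (u + 2) * (t u w - φ u w * x u w)) := by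
  have h1 := x_mul_x u w
  have h2 := root_eq u w
  simp only [map_sub, map_add, map_mul, map_one, map_ofNat] at h1 h2 ⊢
  linear_combination h1 + algebraMap k _ u * h2

variable (h : u * (u + 2) * (1 - u * w) = 0)

include h in
-- Put N = u(u+2) and c = 1+u-Nw. The relation on u and w gives c² = 1, cu = -u and cNw = -Nw. So in
-- xz = cx² + (u+Nwφ)x, substituting the quadratic relation for x² turns the t-term into c²t = t and
-- cancels the rest.
lemma x_mul_z : x u w * z u w = t u w := by
  have h1 := x_mul_x u w
  have h3 := congrArg (algebraMap k (CoordRing u w)) h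
  rw [z]
  simp only [map_sub, map_add, map_mul, map_one, map_ofNat, map_zero] at h1 h3 ⊢
  grind

variable (u w) in
lemma t_mul (r : CoordRing u w) : t u w * r = ⟨X * r.re, X * r.im⟩ := by
  ext1 <;> simp [t, ofSeries_apply]

lemma mem_span_t_pow {n : ℕ} {r : CoordRing u w} :
    r ∈ Ideal.span {t u w ^ n} ↔ X ^ n ∣ r.re ∧ X ^ n ∣ r.im := by
  have h1 : t u w ^ n = ⟨X ^ n, 0⟩ := (map_pow (ofSeries u w) X n).symm
  rw [Ideal.mem_span_singleton, h1]
  constructor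
  · rintro ⟨c, rfl⟩
    simp
  · rintro ⟨⟨a, ha⟩, ⟨b, hb⟩⟩
    exact ⟨⟨a, b⟩, by ext1 <;> simp [ha, hb]⟩

lemma t_mul_eq_zero {r : CoordRing u w} (hr : t u w * r = 0) : r = 0 := by
  rw [t_mul] at hr
  have h1 := congrArg QuadraticAlgebra.re hr
  have h2 := congrArg QuadraticAlgebra.im hr
  have h3 : ∀ f : k⟦X⟧, X * f = 0 → f = 0 := fun f hf => by
    ext n
    simpa using congrArg (coeff (n + 1)) hf
  ext1
  · exact h3 _ h1
  · exact h3 _ h2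

include h in
lemma x_mem_nonZeroDivisors : x u w ∈ nonZeroDivisors (CoordRing u w) := by
  refine mem_nonZeroDivisors_iff_right.2 fun r hr => t_mul_eq_zero ?_
  rw [← x_mul_z h]
  linear_combination z u w * hr

@[simp] lemma θ_zero_z : θ u w 0 (z u w) = u := by simp [z]

include h in
@[simp] lemma θ_one_z : θ u w 1 (z u w) = 0 := by
  simp only [z, map_add, map_mul, AlgHom.commutes, Algebra.algebraMap_self, RingHom.id_apply,
    θ_one_x, θ_φ]
  linear_combination h

lemma exists_eq_add_t_mul (r : CoordRing u w) : ∃ r', r = algebraMap k _ (constantCoeff r.re) +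
    algebraMap k _ (constantCoeff r.im) * x u w + t u w * r' := by
  refine ⟨⟨mk fun p => coeff (p + 1) r.re, mk fun p => coeff (p + 1) r.im⟩, ?_⟩
  rw [← ofSeries_C, ← ofSeries_C, t_mul]
  ext1
  · conv_lhs => rw [eq_X_mul_shift_add_const r.re]
    simp [ofSeries_apply, x, add_comm]
  · conv_lhs => rw [eq_X_mul_shift_add_const r.im]
    simp [ofSeries_apply, x, add_comm]

include h in
lemma ker_θ_zero : RingHom.ker (θ u w 0) = Ideal.span {x u w} := by
  ext r
  rw [RingHom.mem_ker, Ideal.mem_span_singleton]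
  constructor
  · intro hr
    rw [eq_aug _ (θ_t 0), θ_zero_x, mul_zero, add_zero] at hr
    obtain ⟨r', h1⟩ := exists_eq_add_t_mul r
    rw [h1, hr, map_zero, zero_add, ← x_mul_z h]
    exact ⟨algebraMap k _ (constantCoeff r.im) + z u w * r', by ring⟩
  · rintro ⟨c, rfl⟩
    simp

include h in
lemma ker_θ_one : RingHom.ker (θ u w 1) = Ideal.span {z u w} := by
  ext r
  rw [RingHom.mem_ker, Ideal.mem_span_singleton]
  constructor
  · intro hr
    rw [eq_aug _ (θ_t 1), θ_one_x] at hr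
    obtain ⟨r', h1⟩ := exists_eq_add_t_mul r
    obtain ⟨c, hc⟩ := t_dvd_φ (u := u) (w := w)
    -- Multiplying z by 1+u-u(u+2)w, a square root of 1, gives x-u-u(u+2)wφ; the φ-term is restored
    -- as a multiple of z because φ is divisible by t = xz.
    have h2 : x u w - algebraMap k _ u = z u w * (algebraMap k _ (1 + u - u * (u + 2) * w) +
        algebraMap k _ (u * (u + 2) * w) * x u w * c) := by
      have h3 := congrArg (algebraMap k (CoordRing u w)) h
      have h4 := x_mul_z (w := w) h
      rw [z] at h4 ⊢
      simp only [map_sub, map_add, map_mul, map_one, map_ofNat, map_zero] at h3 h4 ⊢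
      grind
    have h3 := congrArg (algebraMap k (CoordRing u w)) (eq_neg_of_add_eq_zero_left hr)
    rw [map_neg, map_mul (algebraMap k (CoordRing u w))] at h3
    rw [h1, h3, ← x_mul_z h]
    exact ⟨algebraMap k _ (constantCoeff r.im) * (algebraMap k _ (1 + u - u * (u + 2) * w) +
        algebraMap k _ (u * (u + 2) * w) * x u w * c) + x u w * r',
      by linear_combination algebraMap k _ (constantCoeff r.im) * h2⟩
  · rintro ⟨c, rfl⟩
    simp [θ_one_z h]

lemma t_mem_augIdeal : t u w ∈ augIdeal (θ u w) := mem_augIdeal.2 θ_t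

include h in
-- An element killed by both augmentations is a multiple of x and also of x_α, so a product of two
-- such elements is a multiple of x x_α. The topology is therefore the t-adic one, with exponents
-- doubled.
lemma augIdeal_sq_le : augIdeal (θ u w) ^ 2 ≤ Ideal.span {t u w} := by
  rw [pow_two, Ideal.mul_le]
  intro a ha b hb
  have h1 : a ∈ RingHom.ker (θ u w 0) := mem_augIdeal.1 ha 0
  have h2 : b ∈ RingHom.ker (θ u w 1) := mem_augIdeal.1 hb 1
  rw [ker_θ_zero h, Ideal.mem_span_singleton] at h1
  rw [ker_θ_one h, Ideal.mem_span_singleton] at h2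
  rw [Ideal.mem_span_singleton, ← x_mul_z h]
  exact mul_dvd_mul h1 h2

include h in
lemma augIdeal_pow_le (n : ℕ) : augIdeal (θ u w) ^ (2 * n) ≤ Ideal.span {t u w ^ n} := by
  rw [pow_mul, ← Ideal.span_singleton_pow]
  exact Ideal.pow_right_mono (augIdeal_sq_le h) n

include h in
lemma coeff_eq_of_sub_mem {n i : ℕ} (hi : i < n) {r s : CoordRing u w}
    (hrs : r - s ∈ augIdeal (θ u w) ^ (2 * n)) :
    coeff i r.re = coeff i s.re ∧ coeff i r.im = coeff i s.im := by
  obtain ⟨h1, h2⟩ := mem_span_t_pow.1 (augIdeal_pow_le h n hrs)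
  rw [X_pow_dvd_iff] at h1 h2
  have h3 := h1 i hi
  have h4 := h2 i hi
  rw [QuadraticAlgebra.re_sub, map_sub, sub_eq_zero] at h3
  rw [QuadraticAlgebra.im_sub, map_sub, sub_eq_zero] at h4
  exact ⟨h3, h4⟩

include h in
lemma isAdicComplete : IsAdicComplete (augIdeal (θ u w)) (CoordRing u w) where
  haus' r hr := by
    have h1 : ∀ n, coeff n r.re = 0 ∧ coeff n r.im = 0 := fun n => by
      have h2 := hr (2 * (n + 1))
      rw [SModEq.zero, smul_eq_mul, Ideal.mul_top] at h2
      exact coeff_eq_of_sub_mem h (Nat.lt_succ_self n) (s := 0) (by simpa using h2)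
    ext n
    · exact (h1 n).1
    · exact (h1 n).2
  prec' f hf := by
    have hf' : ∀ {m n}, m ≤ n → f n - f m ∈ augIdeal (θ u w) ^ m := fun {m n} hmn => by
      have h1 := (hf hmn).symm
      rwa [SModEq.sub_mem, smul_eq_mul, Ideal.mul_top] at h1
    -- The power 2(n+1) of the ideal lies in (t^(n+1)), so the n-th coefficients are stable from
    -- index 2(n+1) on.
    refine ⟨⟨mk fun n => coeff n (f (2 * (n + 1))).re, mk fun n => coeff n (f (2 * (n + 1))).im⟩,
      fun n => ?_⟩
    rw [SModEq.sub_mem, smul_eq_mul, Ideal.mul_top, ← neg_mem_iff, neg_sub]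
    refine (Submodule.sub_mem_iff_left _ (hf' (show n ≤ 2 * n by omega))).1 ?_
    rw [sub_sub_sub_cancel_right]
    have h2 : Ideal.span {t u w ^ n} ≤ augIdeal (θ u w) ^ n :=
      (Ideal.span_singleton_le_iff_mem _).2 (Ideal.pow_mem_pow t_mem_augIdeal n)
    refine h2 (mem_span_t_pow.2 ⟨X_pow_dvd_iff.2 fun i hi => ?_, X_pow_dvd_iff.2 fun i hi => ?_⟩)
    · have := (coeff_eq_of_sub_mem h (Nat.lt_succ_self i)
        (hf' (show 2 * (i + 1) ≤ 2 * n by omega))).1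
      simp [this]
    · have := (coeff_eq_of_sub_mem h (Nat.lt_succ_self i)
        (hf' (show 2 * (i + 1) ≤ 2 * n by omega))).2
      simp [this]

end CoordRing
end CoordRing
end EqFGL
end

noncomputable section

namespace EqFGL

/-! ### Maps from the coordinate ring to a completion, and the identities behind the coproduct. -/

section Coproduct

open PowerSeries

variable {k : Type*} [CommRing k]

lemma zmod_two_cases (γ : ZMod 2) : γ = 0 ∨ γ = 1 := by
  fin_cases γ
  · exact Or.inl rfl
  · exact Or.inr rfl

/-- Two approximate roots of `(w + 1) f² + f = w τ` agree up to the annihilator of `n`. -/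
lemma mul_eq_mul_of_root {κ C : Type*} [CommRing C] [Algebra k C] {θ : κ → C →ₐ[k] k}
    {n W τ f g : Compl θ} (hf : ∀ i, complAug θ i f = 0) (hg : ∀ i, complAug θ i g = 0)
    (hf' : n * ((W + 1) * f ^ 2 + f - W * τ) = 0)
    (hg' : n * ((W + 1) * g ^ 2 + g - W * τ) = 0) : n * f = n * g := by
  refine sub_eq_zero.1 (eq_zero_of_mul_one_add (y := (W + 1) * (f + g)) (fun i => ?_) ?_)
  · rw [map_mul, map_add _ f, hf, hg, add_zero, mul_zero]
  · linear_combination hf' - hg'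

lemma complAug_evalSeries_rootSeries {κ C : Type*} [CommRing C] [Algebra k C]
    {θ : κ → C →ₐ[k] k} (τ : Compl θ) (hτ : ∀ i, complAug θ i τ = 0) (w : k) (i : κ) :
    complAug θ i (evalSeries τ hτ (rootSeries w)) = 0 := by
  rw [algHom_apply_algHom _ _ (by rw [evalSeries_X, hτ]), constantCoeff_rootSeries]

lemma evalSeries_rootSeries {κ C : Type*} [CommRing C] [Algebra k C]
    {θ : κ → C →ₐ[k] k} (τ : Compl θ) (hτ : ∀ i, complAug θ i τ = 0) (w : k) :
    (algebraMap k _ w + 1) * evalSeries τ hτ (rootSeries w) ^ 2 +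
      evalSeries τ hτ (rootSeries w) = algebraMap k _ w * τ := by
  have h3 := congrArg (evalSeries τ hτ) (rootSeries_eq w)
  have h4 : ∀ c : k, evalSeries τ hτ (PowerSeries.C c) = algebraMap k _ c :=
    fun c => AlgHom.commutes _ c
  rwa [map_add, map_mul, map_mul, h4, h4, evalSeries_X, map_pow, map_add, map_one] at h3

namespace CoordRing

variable {u w : k} (h : u * (u + 2) * (1 - u * w) = 0)

section LiftCompl

variable {κ C : Type*} [CommRing C] [Algebra k C] {ϑ : κ → C →ₐ[k] k}

/-- Multiply the formula for e by (1+u-u(u+2)w)d. That scalar squares to 1 and changes the sign of u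
and of u(u+2)w, so the linear relation for e turns into the quadratic relation for d. -/
lemma liftCompl_aux {T : Type*} [CommRing T] {u w d e f : T}
    (h : u * (u + 2) * (1 - u * w) = 0)
    (he : e = u + (1 + u - u * (u + 2) * w) * d + u * (u + 2) * w * f) :
    d * d = (1 + u - u * (u + 2) * w) * (d * e) + (u + u * (u + 2) * w * f) * d := by
  grind

include h in
/-- Homomorphisms from the coordinate ring to a completion. -/
def liftCompl (d e : Compl ϑ) (hτ : ∀ i, complAug ϑ i (d * e) = 0)
    (he : e = algebraMap k _ u + algebraMap k _ (1 + u - u * (u + 2) * w) * d +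
      algebraMap k _ (u * (u + 2) * w) * evalSeries (d * e) hτ (rootSeries w)) :
    CoordRing u w →ₐ[k] Compl ϑ :=
  lift (evalSeries (d * e) hτ) d (by
    have h1 := congrArg (algebraMap k (Compl ϑ)) h
    have h2 : ∀ c : k, evalSeries (d * e) hτ (PowerSeries.C c) = algebraMap k _ c := fun c =>
      (evalSeries (d * e) hτ).commutes c
    rw [map_mul, map_add, map_mul, evalSeries_X, h2, h2, h2]
    simp only [map_sub, map_add, map_mul, map_one, map_ofNat, map_zero] at h1 he ⊢
    exact liftCompl_aux h1 he)

variable (d e : Compl ϑ) (hτ : ∀ i, complAug ϑ i (d * e) = 0)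
  (he : e = algebraMap k _ u + algebraMap k _ (1 + u - u * (u + 2) * w) * d +
      algebraMap k _ (u * (u + 2) * w) * evalSeries (d * e) hτ (rootSeries w))

lemma liftCompl_x : liftCompl h d e hτ he (x u w) = d := lift_x _ _ _

lemma liftCompl_z : liftCompl h d e hτ he (z u w) = e := by
  have h1 : liftCompl h d e hτ he (φ u w) = evalSeries (d * e) hτ (rootSeries w) :=
    lift_ofSeries _ _ _ _
  rw [z, map_add, map_add, map_mul (liftCompl h d e hτ he), map_mul (liftCompl h d e hτ he),
    liftCompl_x, h1, AlgHom.commutes, AlgHom.commutes, AlgHom.commutes]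
  exact he.symm

include h in
lemma algHom_ext {g g' : CoordRing u w →ₐ[k] Compl ϑ} (hx : g (x u w) = g' (x u w))
    (hz : g (z u w) = g' (z u w)) (ht : ∀ i, complAug ϑ i (g (t u w)) = 0) : g = g' := by
  have h1 : g.comp (ofSeries u w) = g'.comp (ofSeries u w) := by
    refine powerSeries_algHom_ext ht ?_
    change g (t u w) = g' (t u w)
    rw [← x_mul_z h, map_mul g, map_mul g', hx, hz]
  refine AlgHom.ext fun r => ?_
  rw [eq_add u w r, map_add, map_add, map_mul g, map_mul g', hx]
  exact congrArg₂ (fun a b => a + b * _) (DFunLike.congr_fun h1 _) (DFunLike.congr_fun h1 _)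

end LiftCompl

include h in
-- On the locus uw = 1 the element σ is the unit 1+φ times the idempotent of the non-identity
-- component. The factor u(u+2) kills 1-uw, which confines the identity to this locus.
lemma σ_sq : algebraMap k _ (u * (u + 2)) * σ u w ^ 2 =
    algebraMap k _ (u * (u + 2)) * (σ u w * (1 + φ u w)) := by
  have h1 := sub_mul_sub (u := u) (w := w)
  have h2 := congrArg (algebraMap k (CoordRing u w)) h
  rw [σ]
  simp only [map_sub, map_add, map_mul, map_one, map_ofNat, map_zero] at h1 h2 ⊢
  set U := algebraMap k (CoordRing u w) u
  set W := algebraMap k (CoordRing u w) w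
  linear_combination U * (U + 2) * W ^ 2 * h1 + (W ^ 2 * (φ u w ^ 2 - t u w +
    (U + 2) * (t u w - φ u w * x u w)) - W * (x u w - φ u w) * (1 + φ u w)) * h2

include h in
lemma mul_x : algebraMap k _ (u * (u + 2)) * x u w =
    algebraMap k _ (u * (u + 2)) * (φ u w + algebraMap k _ u * σ u w) := by
  have h2 := congrArg (algebraMap k (CoordRing u w)) h
  rw [σ]
  simp only [map_sub, map_add, map_mul, map_one, map_ofNat, map_zero] at h2 ⊢
  linear_combination (x u w - φ u w) * h2

/-- Only u(u+2)σ enters the coproduct, and this makes it linear in x and x_α. Its image under a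
homomorphism is thus known from the images of these two elements. -/
lemma mul_σ : algebraMap k _ (u * (u + 2)) * σ u w =
    algebraMap k _ u + algebraMap k _ (1 + u) * x u w - z u w := by
  rw [σ, z]
  simp only [map_sub, map_add, map_mul, map_one, map_ofNat]
  ring

/-- The defining relation between x and x_α, tested on the proposed coproducts, with the grouplike
expression (1+f₁)(1+f₂)-1 in the place of φ(Δt). -/
lemma comul_aux {T : Type*} [CommRing T] {u w x₁ x₂ σ₁ σ₂ f₁ f₂ : T}
    (h : u * (u + 2) * (1 - u * w) = 0)
    (hx₁ : u * (u + 2) * x₁ = u * (u + 2) * (f₁ + u * σ₁))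
    (hx₂ : u * (u + 2) * x₂ = u * (u + 2) * (f₂ + u * σ₂)) :
    (1 + u) * ((1 + x₁) * (1 + x₂)) - u * (u + 2) * ((1 + x₁) * σ₂ + σ₁ * (1 + x₂)) +
        u * (u + 2) * (1 + u) * (σ₁ * σ₂) - 1 =
      u + (1 + u - u * (u + 2) * w) * ((1 + x₁) * (1 + x₂) - 1 - u * (u + 2) * (σ₁ * σ₂)) +
        u * (u + 2) * w * ((1 + f₁) * (1 + f₂) - 1) := by
  grind

/-- Grouplikeness of 1+φ, in the form that ψ satisfies the equation of φ at t = de, up to the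
annihilator of u(u+2). -/
lemma comul_aux_root {T : Type*} [CommRing T] {u w x₁ x₂ σ₁ σ₂ f₁ f₂ d e ψ : T}
    (h : u * (u + 2) * (1 - u * w) = 0)
    (hx₁ : u * (u + 2) * x₁ = u * (u + 2) * (f₁ + u * σ₁))
    (hx₂ : u * (u + 2) * x₂ = u * (u + 2) * (f₂ + u * σ₂))
    (hσ₁ : u * (u + 2) * σ₁ ^ 2 = u * (u + 2) * (σ₁ * (1 + f₁)))
    (hσ₂ : u * (u + 2) * σ₂ ^ 2 = u * (u + 2) * (σ₂ * (1 + f₂)))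
    (hd : d = (1 + x₁) * (1 + x₂) - 1 - u * (u + 2) * (σ₁ * σ₂))
    (hψ : ψ = (1 + f₁) * (1 + f₂) - 1)
    (he : e = u + (1 + u - u * (u + 2) * w) * d + u * (u + 2) * w * ψ) :
    u * (u + 2) * ((w + 1) * ψ ^ 2 + ψ - w * (d * e)) = 0 := by
  -- S plays the role of Δσ: it is supported where exactly one factor lies on the non-identity
  -- component, and there it is (1+f₁)(1+f₂).
  set S := (1 + f₁) * σ₂ + σ₁ * (1 + f₂) - 2 * σ₁ * σ₂ with hS
  have h1 : u * (u + 2) * d = u * (u + 2) * (ψ + u * S) := by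
    rw [hd, hψ, hS]
    linear_combination (1 + x₂) * hx₁ + (1 + f₁ + u * σ₁) * hx₂
  have h2 : u * (u + 2) * e = u * (u + 2) * ((1 + u) * ψ + u - u * S) := by
    linear_combination u * (u + 2) * he + (u + 2) * (d - ψ) * h - h1
  have h3 : u * (u + 2) * S ^ 2 = u * (u + 2) * (S * (1 + ψ)) := by
    rw [hψ, hS]
    linear_combination (1 + f₁ - 2 * σ₁) ^ 2 * hσ₂ + (1 + f₂) ^ 2 * hσ₁
  have h7 : u * (u + 2) * (d * e) =
      u * (u + 2) * ((ψ + u * S) * ((1 + u) * ψ + u - u * S)) := by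
    linear_combination e * h1 + (ψ + u * S) * h2
  linear_combination -w * h7 + w * u ^ 2 * h3 + (ψ ^ 2 + ψ) * h

end CoordRing
end Coproduct
end EqFGL
end

noncomputable section

namespace EqFGL

/-! ### Construction of the coproduct. -/

section Coproduct

variable {k : Type*} [CommRing k]

namespace CoordRing

variable (u w : k)

/-- The inclusion of the first factor of the completed tensor square. -/
def left : CoordRing u w →ₐ[k] Compl (tensorAug (θ u w) (θ u w)) :=
  (AugHom.inl (θ u w) (θ u w)).toAlgHom

/-- The inclusion of the second factor of the completed tensor square. -/
def right : CoordRing u w →ₐ[k] Compl (tensorAug (θ u w) (θ u w)) :=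
  (AugHom.inr (θ u w) (θ u w)).toAlgHom

/-- The coproduct of `x`. -/
def comulX : Compl (tensorAug (θ u w) (θ u w)) :=
  (1 + left u w (x u w)) * (1 + right u w (x u w)) - 1 -
    algebraMap k _ (u * (u + 2)) * (left u w (σ u w) * right u w (σ u w))

/-- The coproduct of `x_α`. -/
def comulZ : Compl (tensorAug (θ u w) (θ u w)) :=
  algebraMap k _ (1 + u) * ((1 + left u w (x u w)) * (1 + right u w (x u w))) -
    algebraMap k _ (u * (u + 2)) * ((1 + left u w (x u w)) * right u w (σ u w) +
      left u w (σ u w) * (1 + right u w (x u w))) +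
    algebraMap k _ (u * (u + 2) * (1 + u)) * (left u w (σ u w) * right u w (σ u w)) - 1

variable {u w}

@[simp] lemma complAug_left (i j : ZMod 2) (r : CoordRing u w) :
    complAug (tensorAug (θ u w) (θ u w)) (i, j) (left u w r) = θ u w i r :=
  AugHom.complAug_inl i j r

@[simp] lemma complAug_right (i j : ZMod 2) (r : CoordRing u w) :
    complAug (tensorAug (θ u w) (θ u w)) (i, j) (right u w r) = θ u w j r :=
  AugHom.complAug_inr i j r

@[simp] lemma θ_zero_σ : θ u w 0 (σ u w) = 0 := by simp [σ]

@[simp] lemma θ_one_σ : θ u w 1 (σ u w) = w * u := by simp [σ]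

variable (h : u * (u + 2) * (1 - u * w) = 0)

include h

lemma complAug_comulX (p : ZMod 2 × ZMod 2) :
    complAug (tensorAug (θ u w) (θ u w)) p (comulX u w) = θ u w (p.1 + p.2) (x u w) := by
  obtain ⟨i, j⟩ := p
  have h2 : (1 + 1 : ZMod 2) = 0 := rfl
  rcases zmod_two_cases i with rfl | rfl <;> rcases zmod_two_cases j with rfl | rfl <;>
    simp only [comulX, map_sub, map_add, map_mul, map_one, complAug_left, complAug_right,
      AlgHom.commutes, Algebra.algebraMap_self, RingHom.id_apply, θ_zero_x, θ_one_x, θ_zero_σ,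
      θ_one_σ, add_zero, zero_add, h2, map_ofNat]
  · ring
  · ring
  · ring
  · linear_combination (1 + u * w) * h

lemma complAug_comulZ (p : ZMod 2 × ZMod 2) :
    complAug (tensorAug (θ u w) (θ u w)) p (comulZ u w) = θ u w (p.1 + p.2) (z u w) := by
  obtain ⟨i, j⟩ := p
  have h2 : (1 + 1 : ZMod 2) = 0 := rfl
  rcases zmod_two_cases i with rfl | rfl <;> rcases zmod_two_cases j with rfl | rfl <;>
    simp only [comulZ, map_sub, map_add, map_mul, map_one, complAug_left, complAug_right,
      AlgHom.commutes, Algebra.algebraMap_self, RingHom.id_apply, θ_zero_x, θ_one_x, θ_zero_σ,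
      θ_one_σ, add_zero, zero_add, h2, map_ofNat, θ_zero_z, θ_one_z h]
  · ring
  · linear_combination h
  · linear_combination h
  · linear_combination (1 + u) * (1 - u * w) * h

lemma complAug_comulX_mul_comulZ (p : ZMod 2 × ZMod 2) :
    complAug (tensorAug (θ u w) (θ u w)) p (comulX u w * comulZ u w) = 0 := by
  rw [map_mul, complAug_comulX h, complAug_comulZ h, ← map_mul (θ u w _), x_mul_z h, θ_t]

lemma map_relations {T : Type*} [CommRing T] [Algebra k T] (g : CoordRing u w →ₐ[k] T) :
    algebraMap k T u * (algebraMap k T u + 2) * g (x u w) =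
      algebraMap k T u * (algebraMap k T u + 2) *
        (g (φ u w) + algebraMap k T u * g (σ u w)) ∧
    algebraMap k T u * (algebraMap k T u + 2) * g (σ u w) ^ 2 =
      algebraMap k T u * (algebraMap k T u + 2) * (g (σ u w) * (1 + g (φ u w))) := by
  have h1 := congrArg g (mul_x h)
  have h2 := congrArg g (σ_sq h)
  simp only [map_mul g, map_add g, map_pow g, map_one g, AlgHom.commutes] at h1 h2
  simp only [map_add, map_mul, map_ofNat] at h1 h2
  exact ⟨h1, h2⟩

lemma comulZ_eq : comulZ u w = algebraMap k _ u +
    algebraMap k _ (1 + u - u * (u + 2) * w) * comulX u w +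
      algebraMap k _ (u * (u + 2) * w) * evalSeries (comulX u w * comulZ u w)
        (complAug_comulX_mul_comulZ h) (rootSeries w) := by
  have h0 := congrArg (algebraMap k (Compl (tensorAug (θ u w) (θ u w)))) h
  obtain ⟨hx₁, hσ₁⟩ := map_relations h (left u w)
  obtain ⟨hx₂, hσ₂⟩ := map_relations h (right u w)
  simp only [map_sub, map_add, map_mul, map_one, map_ofNat, map_zero] at h0
  have h1 : comulZ u w = algebraMap k _ u +
    algebraMap k _ (1 + u - u * (u + 2) * w) * comulX u w +
      algebraMap k _ (u * (u + 2) * w) *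
        ((1 + left u w (φ u w)) * (1 + right u w (φ u w)) - 1) := by
    simp only [comulZ, comulX]
    simp only [map_sub, map_add, map_mul, map_one, map_ofNat]
    exact comul_aux h0 hx₁ hx₂
  refine h1.trans ?_
  -- Two topologically nilpotent roots of the same quadratic, the second only up to the annihilator
  -- of u(u+2); that factor stands in front of φ in the relation anyway.
  have h2 : algebraMap k (Compl (tensorAug (θ u w) (θ u w))) (u * (u + 2)) *
      evalSeries (comulX u w * comulZ u w) (complAug_comulX_mul_comulZ h) (rootSeries w) =
      algebraMap k _ (u * (u + 2)) *
        ((1 + left u w (φ u w)) * (1 + right u w (φ u w)) - 1) := by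
    refine mul_eq_mul_of_root (W := algebraMap k _ w) (τ := comulX u w * comulZ u w)
      (fun p => ?_) (fun ⟨i, j⟩ => ?_) ?_ ?_
    · exact complAug_evalSeries_rootSeries _ _ _ p
    · simp
    · rw [evalSeries_rootSeries, sub_self, mul_zero]
    · simp only [map_add, map_mul, map_ofNat]
      refine comul_aux_root h0 hx₁ hx₂ hσ₁ hσ₂ ?_ rfl ?_
      · simp only [comulX, map_add, map_mul, map_ofNat]
      · refine h1.trans ?_
        simp only [map_sub, map_add, map_mul, map_one, map_ofNat]
  have h3 := map_mul (algebraMap k (Compl (tensorAug (θ u w) (θ u w)))) (u * (u + 2)) w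
  rw [h3]
  linear_combination -algebraMap k _ w * h2

/-- The coproduct. -/
def comul : CoordRing u w →ₐ[k] Compl (tensorAug (θ u w) (θ u w)) :=
  liftCompl h (comulX u w) (comulZ u w) (complAug_comulX_mul_comulZ h) (comulZ_eq h)

lemma comul_x : comul h (x u w) = comulX u w := liftCompl_x _ _ _ _ _

lemma comul_z : comul h (z u w) = comulZ u w := liftCompl_z _ _ _ _ _

lemma complAug_comul (p : ZMod 2 × ZMod 2) (r : CoordRing u w) :
    complAug (tensorAug (θ u w) (θ u w)) p (comul h r) = θ u w (p.1 + p.2) r := by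
  have h1 : complAug (tensorAug (θ u w) (θ u w)) p (comul h (t u w)) = 0 := by
    rw [← x_mul_z h, map_mul (comul h), comul_x, comul_z, complAug_comulX_mul_comulZ h]
  have h2 := eq_aug ((complAug (tensorAug (θ u w) (θ u w)) p).comp (comul h)) h1 r
  rw [eq_aug _ (θ_t _)]
  rw [AlgHom.comp_apply, AlgHom.comp_apply, comul_x, complAug_comulX h] at h2
  exact h2

end CoordRing
end Coproduct
end EqFGL
end

noncomputable section

namespace EqFGL

/-! ### The axioms of an equivariant formal group law. -/

section Coproduct

variable {k : Type*} [CommRing k]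

namespace CoordRing

variable {u w : k} (h : u * (u + 2) * (1 - u * w) = 0)

/-- The coproduct, as a map of augmented algebras. -/
def comulHom : AugHom (θ u w) (tensorAug (θ u w) (θ u w)) :=
  ⟨comul h, fun p => p.1 + p.2, complAug_comul h⟩

include h in
-- Every axiom is an equality of maps out of the coordinate ring; it need only be checked on x and
-- x_α, as t = x x_α goes to a topologically nilpotent element.
lemma extend_comul_ext {κ C : Type*} [CommRing C] [Algebra k C] {ϑ : κ → C →ₐ[k] k}
    {f : AugHom (tensorAug (θ u w) (θ u w)) ϑ} {g : CoordRing u w →ₐ[k] Compl ϑ}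
    (hx : f.extend (comulX u w) = g (x u w)) (hz : f.extend (comulZ u w) = g (z u w))
    (r : CoordRing u w) : f.extend (comul h r) = g r := by
  refine DFunLike.congr_fun (algHom_ext h (g := f.extend.comp (comul h)) (g' := g) ?_ ?_ ?_) r
  · rw [AlgHom.comp_apply, comul_x h, hx]
  · rw [AlgHom.comp_apply, comul_z h, hz]
  · intro i
    rw [AlgHom.comp_apply, AugHom.complAug_extend, complAug_comul h, θ_t]

variable {T : Type*} [CommRing T] [Algebra k T]

lemma map_mul_σ (g : CoordRing u w →ₐ[k] T) :
    algebraMap k T u * (algebraMap k T u + 2) * g (σ u w) =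
    algebraMap k T u + (1 + algebraMap k T u) * g (x u w) - g (z u w) := by
  have h1 := congrArg g (mul_σ (u := u) (w := w))
  simp only [map_mul g, map_add g, map_sub g, AlgHom.commutes] at h1
  simp only [map_add, map_mul, map_ofNat, map_one] at h1
  exact h1

variable {κ C : Type*} [CommRing C] [Algebra k C] {ϑ : κ → C →ₐ[k] k}

lemma pair_extend_comulX (f g : AugHom (θ u w) ϑ) : (f.pair g).extend (comulX u w) =
    (1 + f.toAlgHom (x u w)) * (1 + g.toAlgHom (x u w)) - 1 -
      algebraMap k _ u * (algebraMap k _ u + 2) *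
        (f.toAlgHom (σ u w) * g.toAlgHom (σ u w)) := by
  simp only [comulX, left, right, map_sub, map_add, map_mul, map_one, map_ofNat,
    AlgHom.commutes, AugHom.pair_extend_inl, AugHom.pair_extend_inr]

lemma pair_extend_comulZ (f g : AugHom (θ u w) ϑ) : (f.pair g).extend (comulZ u w) =
    (1 + algebraMap k _ u) * ((1 + f.toAlgHom (x u w)) * (1 + g.toAlgHom (x u w))) -
      algebraMap k _ u * (algebraMap k _ u + 2) *
        ((1 + f.toAlgHom (x u w)) * g.toAlgHom (σ u w) +
          f.toAlgHom (σ u w) * (1 + g.toAlgHom (x u w))) +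
      algebraMap k _ u * (algebraMap k _ u + 2) * (1 + algebraMap k _ u) *
        (f.toAlgHom (σ u w) * g.toAlgHom (σ u w)) - 1 := by
  simp only [comulZ, left, right, map_sub, map_add, map_mul, map_one, map_ofNat,
    AlgHom.commutes, AugHom.pair_extend_inl, AugHom.pair_extend_inr]

lemma counit (r : CoordRing u w) :
    ((AugHom.const (θ u w) (θ u w) 0).pair (AugHom.id (θ u w))).extend (comul h r) =
      toCompl (θ u w) r := by
  have h1 := map_mul_σ (toCompl (θ u w))
  refine extend_comul_ext h ?_ ?_ r
  · simp [pair_extend_comulX]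
  · rw [pair_extend_comulZ]
    simp only [AugHom.const_toAlgHom, AugHom.id_toAlgHom, θ_zero_x, θ_zero_σ, map_zero]
    linear_combination -h1

lemma cocomm (r : CoordRing u w) :
    ((AugHom.inr (θ u w) (θ u w)).pair (AugHom.inl (θ u w) (θ u w))).extend (comul h r) =
      comul h r := by
  refine extend_comul_ext h ?_ ?_ r
  · rw [pair_extend_comulX, comul_x h, comulX]
    simp only [map_add, map_mul, map_ofNat, left, right]
    ring
  · rw [pair_extend_comulZ, comul_z h, comulZ]
    simp only [map_add, map_mul, map_ofNat, map_one, left, right]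
    ring

/-- The iterated coproduct of σ never has to be computed: it occurs only with the factor u(u+2),
where it is linear in the coproducts of x and x_α. What remains is a polynomial identity. -/
lemma coassoc_aux {T : Type*} [CommRing T] {u x₁ x₂ x₃ σ₁ σ₂ σ₃ x₁₂ x₂₃ z₁₂ z₂₃ σ₁₂ σ₂₃ : T}
    (h₁₂ : u * (u + 2) * σ₁₂ = u + (1 + u) * x₁₂ - z₁₂)
    (h₂₃ : u * (u + 2) * σ₂₃ = u + (1 + u) * x₂₃ - z₂₃)
    (hx₁₂ : x₁₂ = (1 + x₁) * (1 + x₂) - 1 - u * (u + 2) * (σ₁ * σ₂))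
    (hx₂₃ : x₂₃ = (1 + x₂) * (1 + x₃) - 1 - u * (u + 2) * (σ₂ * σ₃))
    (hz₁₂ : z₁₂ = (1 + u) * ((1 + x₁) * (1 + x₂)) -
      u * (u + 2) * ((1 + x₁) * σ₂ + σ₁ * (1 + x₂)) + u * (u + 2) * (1 + u) * (σ₁ * σ₂) - 1)
    (hz₂₃ : z₂₃ = (1 + u) * ((1 + x₂) * (1 + x₃)) -
      u * (u + 2) * ((1 + x₂) * σ₃ + σ₂ * (1 + x₃)) + u * (u + 2) * (1 + u) * (σ₂ * σ₃) - 1) :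
    (1 + x₁₂) * (1 + x₃) - 1 - u * (u + 2) * (σ₁₂ * σ₃) =
      (1 + x₁) * (1 + x₂₃) - 1 - u * (u + 2) * (σ₁ * σ₂₃) ∧
    (1 + u) * ((1 + x₁₂) * (1 + x₃)) -
      u * (u + 2) * ((1 + x₁₂) * σ₃ + σ₁₂ * (1 + x₃)) + u * (u + 2) * (1 + u) * (σ₁₂ * σ₃) - 1 =
    (1 + u) * ((1 + x₁) * (1 + x₂₃)) -
      u * (u + 2) * ((1 + x₁) * σ₂₃ + σ₁ * (1 + x₂₃)) + u * (u + 2) * (1 + u) * (σ₁ * σ₂₃) - 1 := by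
  rw [hx₁₂, hz₁₂] at h₁₂
  rw [hx₂₃, hz₂₃] at h₂₃
  subst hx₁₂ hx₂₃
  constructor
  · linear_combination σ₁ * h₂₃ - σ₃ * h₁₂
  · linear_combination (-(1 + x₃) + (1 + u) * σ₃) * h₁₂ - (-(1 + x₁) + (1 + u) * σ₁) * h₂₃

lemma coassoc :
    let δ : AugHom (θ u w) (tensorAug (θ u w) (θ u w)) := comulHom h
    let j₁ : AugHom (θ u w) (tensorAug (θ u w) (tensorAug (θ u w) (θ u w))) :=
      AugHom.inl (θ u w) (tensorAug (θ u w) (θ u w))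
    let j₂₃ : AugHom (tensorAug (θ u w) (θ u w))
        (tensorAug (θ u w) (tensorAug (θ u w) (θ u w))) :=
      AugHom.inr (θ u w) (tensorAug (θ u w) (θ u w))
    let j₂ := j₂₃.comp (AugHom.inl (θ u w) (θ u w))
    let j₃ := j₂₃.comp (AugHom.inr (θ u w) (θ u w))
    let j₁₂ := j₁.pair j₂
    ∀ r, ((j₁₂.comp δ).pair j₃).extend (comul h r) = (j₁.pair (j₂₃.comp δ)).extend (comul h r) := by
  intro δ j₁ j₂₃ j₂ j₃ j₁₂ r
  have hx₁₂ : (j₁₂.comp δ).toAlgHom (x u w) = _ :=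
    (congrArg j₁₂.extend (comul_x h)).trans (pair_extend_comulX j₁ j₂)
  have hz₁₂ : (j₁₂.comp δ).toAlgHom (z u w) = _ :=
    (congrArg j₁₂.extend (comul_z h)).trans (pair_extend_comulZ j₁ j₂)
  have hx₂₃ : (j₂₃.comp δ).toAlgHom (x u w) = _ :=
    (congrArg j₂₃.extend (comul_x h)).trans
      ((AugHom.extend_eq_pair j₂₃ _).trans (pair_extend_comulX j₂ j₃))
  have hz₂₃ : (j₂₃.comp δ).toAlgHom (z u w) = _ :=
    (congrArg j₂₃.extend (comul_z h)).trans
      ((AugHom.extend_eq_pair j₂₃ _).trans (pair_extend_comulZ j₂ j₃))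
  obtain ⟨h1, h2⟩ := coassoc_aux (map_mul_σ (j₁₂.comp δ).toAlgHom)
    (map_mul_σ (j₂₃.comp δ).toAlgHom) hx₁₂ hx₂₃ hz₁₂ hz₂₃
  refine extend_comul_ext h (g := (j₁.pair (j₂₃.comp δ)).extend.comp (comul h)) ?_ ?_ r
  · exact (pair_extend_comulX _ _).trans (h1.trans (((congrArg (j₁.pair (j₂₃.comp δ)).extend
      (comul_x h)).trans (pair_extend_comulX _ _)).symm))
  · exact (pair_extend_comulZ _ _).trans (h2.trans (((congrArg (j₁.pair (j₂₃.comp δ)).extend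
      (comul_z h)).trans (pair_extend_comulZ _ _)).symm))

/-- The equivariant formal group law on the coordinate ring. -/
def fgl : EquivariantFGL k (ZMod 2) (CoordRing u w) where
  θ := θ u w
  complete := isAdicComplete h
  Δ := comul h
  aug_Δ := complAug_comul h
  counit := counit h
  cocomm := cocomm h
  coassoc := coassoc h
  x := x u w
  x_regular := x_mem_nonZeroDivisors h
  ker_θ_zero := ker_θ_zero h

end CoordRing
end Coproduct
end EqFGL
end

noncomputable section

namespace EqFGL

/-! ### The multiplicative formal group law -/

section Multiplicative

variable {k : Type*} [CommRing k]

open MvPowerSeries in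
lemma fglCoeff_multiplicative (i j : ℕ) : fglCoeff (FormalGroup.𝔾ₘ (R := k)) i j =
    if i ≤ 1 ∧ j ≤ 1 ∧ 1 ≤ i + j then 1 else 0 := by
  have key : ∀ a b : ℕ, (Finsupp.single 0 i + Finsupp.single 1 j : Fin 2 →₀ ℕ) =
      Finsupp.single 0 a + Finsupp.single 1 b ↔ i = a ∧ j = b := fun a b => by
    constructor
    · intro h
      exact ⟨by simpa using DFunLike.congr_fun h 0, by simpa using DFunLike.congr_fun h 1⟩
    · rintro ⟨rfl, rfl⟩
      rfl
  have h1 := key 1 0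
  have h2 := key 0 1
  have h3 := key 1 1
  simp only [Finsupp.single_zero, add_zero, zero_add] at h1 h2
  rw [fglCoeff, FormalGroup.𝔾ₘ_toPowerSeries, map_add, map_add, MvPowerSeries.X,
    MvPowerSeries.X, monomial_mul_monomial, coeff_monomial, coeff_monomial, coeff_monomial]
  simp only [h1, h2, h3, mul_one]
  rcases i with _ | _ | i <;> rcases j with _ | _ | j <;> simp

lemma twoSeriesCoeff_multiplicative (j : ℕ) : twoSeriesCoeff (FormalGroup.𝔾ₘ (R := k)) j =
    if j = 1 then 2 else if j = 2 then 1 else 0 := by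
  have h : MvPowerSeries.HasSubst ![(PowerSeries.X : PowerSeries k), PowerSeries.X] :=
    MvPowerSeries.hasSubst_of_constantCoeff_nilpotent fun s => by
      fin_cases s <;> exact (PowerSeries.constantCoeff_X (R := k)) ▸ IsNilpotent.zero
  rw [twoSeriesCoeff, FormalGroup.𝔾ₘ_toPowerSeries, MvPowerSeries.subst_add h,
    MvPowerSeries.subst_add h, MvPowerSeries.subst_mul h, MvPowerSeries.subst_X h,
    MvPowerSeries.subst_X h]
  change PowerSeries.coeff j (PowerSeries.X + PowerSeries.X + PowerSeries.X * PowerSeries.X) = _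
  rw [← pow_two, map_add, map_add, PowerSeries.coeff_X, PowerSeries.coeff_X_pow]
  rcases j with _ | _ | _ | j <;> norm_num

namespace EquivariantFGL

variable {Γ R : Type*} [AddCommGroup Γ] [Finite Γ] [CommRing R] [Algebra k R]
variable (E : EquivariantFGL k Γ R)

/-- From n = 2 on the truncated sum is all of X+Y+XY. For n = 0 the ideal is the whole ring, and for
n = 1 it contains X+Y+XY. -/
lemma hasUnderlying_multiplicative_iff : E.HasUnderlying FormalGroup.𝔾ₘ ↔
    ∀ n, E.Δ E.x - (E.left E.x + E.right E.x + E.left E.x * E.right E.x) ∈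
      Ideal.span {E.left E.x ^ n, E.right E.x ^ n} := by
  refine forall_congr' fun n => ?_
  have h1 : E.tmul (E.x ^ n) 1 = E.left E.x ^ n := by simp [tmul_eq]
  have h2 : E.tmul 1 (E.x ^ n) = E.right E.x ^ n := by simp [tmul_eq]
  rw [h1, h2]
  rcases n with _ | _ | n
  · simp
  · have h3 : E.left E.x + E.right E.x + E.left E.x * E.right E.x ∈
        Ideal.span {E.left E.x ^ (0 + 1), E.right E.x ^ (0 + 1)} := by
      rw [Ideal.mem_span_pair]
      exact ⟨1 + E.right E.x, 1, by ring⟩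
    simp [fglCoeff_multiplicative] at h3 ⊢
    exact (Submodule.sub_mem_iff_left _ h3).symm
  · refine iff_of_eq (congrArg (fun y => E.Δ E.x - y ∈ _) ?_)
    simp only [Finset.sum_range_succ', fglCoeff_multiplicative, tmul_eq]
    simp
    ring

end EquivariantFGL
end Multiplicative

/-! ### The solution of the relations between the parameters. -/

section Params

variable {k : Type*} [CommRing k]

/-- The parameters `q j`. -/
def qParam (u w : k) (j : ℕ) : k :=
  twoSeriesCoeff FormalGroup.𝔾ₘ j + (if j = 0 then u * (u + 2) else if j = 1 then u else 0) -
    u * (u + 2) * w ^ j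

/-- The parameters `b i j`. -/
def bParam (u : k) (i j : ℕ) : k :=
  if i = 1 then if j = 0 then 1 + u else if j = 1 then 1 else 0 else 0

variable {u w : k} (h : u * (u + 2) * (1 - u * w) = 0)

include h in
lemma isParameterSystem : IsParameterSystem FormalGroup.𝔾ₘ u (qParam u w) (bParam u) where
  comm := inferInstance
  q_zero := by simp [qParam, twoSeriesCoeff_multiplicative]
  q_rel j := by
    rcases j with _ | _ | j <;> simp [qParam, twoSeriesCoeff_multiplicative]
    · linear_combination -h
    · linear_combination -w * h
    · linear_combination -w ^ (j + 2) * h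
  b_rel i j hi := by
    rcases i with _ | _ | i <;> rcases j with _ | _ | j <;>
      simp [bParam, fglCoeff_multiplicative] at hi ⊢

lemma qParam_of_le {j : ℕ} (hj : 3 ≤ j) : qParam u w j = -(u * (u + 2)) * w ^ j := by
  rw [qParam, twoSeriesCoeff_multiplicative, if_neg, if_neg, if_neg, if_neg] <;> first | omega | ring

/-- The relations express each entry through the next one, so they propagate equality downwards from
the prescribed tails. -/
lemma parameterSystem_unique {q q' : ℕ → k} {b b' : ℕ → ℕ → k}
    (hq : ∀ j, 3 ≤ j → q' j = q j) (hb₁ : b' 1 1 = b 1 1)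
    (hb : ∀ i j, 1 ≤ i → (1 < i ∨ 1 < j) → b' i j = b i j) {F : FormalGroup k}
    (hs : IsParameterSystem F u q b) (hs' : IsParameterSystem F u q' b') :
    q' = q ∧ ∀ i j, 1 ≤ i → b' i j = b i j := by
  have h2 : q' 2 = q 2 := by rw [hs.q_rel, hs'.q_rel, hq 3 le_rfl]
  have h1 : q' 1 = q 1 := by rw [hs.q_rel, hs'.q_rel, h2]
  refine ⟨funext fun j => ?_, fun i j hi => ?_⟩
  · rcases j with _ | _ | _ | j
    · rw [hs.q_zero, hs'.q_zero]
    · exact h1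
    · exact h2
    · exact hq _ (by omega)
  · rcases i with _ | _ | i
    · omega
    · rcases j with _ | _ | j
      · rw [hs.b_rel 1 0 le_rfl, hs'.b_rel 1 0 le_rfl, hb₁]
      · exact hb₁
      · exact hb _ _ le_rfl (Or.inr (by omega))
    · exact hb _ _ hi (Or.inl (by omega))

end Params

/-! ### The standard law: its underlying law and its failure to be multiplicative. -/

section Example

variable {k : Type*} [CommRing k]

namespace CoordRing

variable {u w : k} (h : u * (u + 2) * (1 - u * w) = 0)

lemma exists_ofSeries_mul_eq_one {f : PowerSeries k} (hf : PowerSeries.constantCoeff f = 1) :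
    ∃ V, ofSeries u w f * V = 1 := by
  obtain ⟨g, hg⟩ := (PowerSeries.isUnit_iff_constantCoeff.2 (hf ▸ isUnit_one)).exists_right_inv
  exact ⟨ofSeries u w g, by rw [← map_mul (ofSeries u w), hg, map_one]⟩

include h in
-- The element u(u+2)σ lives on the non-identity component of uw = 1, where x = u+(1+u)φ =
-- u(1+(1+u)wφ) is invertible with inverse η = w(1+(1+u)wφ)⁻¹. By iteration every power of x divides
-- u(u+2)σ, so the correction term is invisible near x = 0.
lemma exists_mul_σ_eq : ∃ η : CoordRing u w, algebraMap k _ (u * (u + 2)) * σ u w =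
    x u w * η * (algebraMap k _ (u * (u + 2)) * σ u w) ∧ θ u w 1 η = w := by
  obtain ⟨V, hV⟩ := exists_ofSeries_mul_eq_one (u := u) (w := w)
    (f := 1 + PowerSeries.C ((1 + u) * w) * rootSeries w) (by simp [constantCoeff_rootSeries])
  rw [map_add, map_one (ofSeries u w), map_mul (ofSeries u w), ofSeries_C] at hV
  change (1 + algebraMap k _ ((1 + u) * w) * φ u w) * V = 1 at hV
  refine ⟨algebraMap k _ w * V, ?_, ?_⟩
  · have h1 := sub_mul_sub (u := u) (w := w)
    have h2 := congrArg (algebraMap k (CoordRing u w)) h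
    rw [σ]
    simp only [map_sub, map_add, map_mul, map_one, map_ofNat, map_zero] at h1 h2 hV ⊢
    set U := algebraMap k (CoordRing u w) u
    set W := algebraMap k (CoordRing u w) w
    linear_combination -U * (U + 2) * W ^ 2 * V * h1 + (-W ^ 2 * V * (φ u w ^ 2 - t u w +
      (U + 2) * (t u w - φ u w * x u w)) + W * V * (x u w - φ u w)) * h2
      - U * (U + 2) * W * (x u w - φ u w) * hV
  · have h3 := congrArg (θ u w 1) hV
    rw [map_mul (θ u w 1), map_add, map_mul (θ u w 1), θ_φ, mul_zero, map_one, add_zero,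
      one_mul] at h3
    rw [map_mul (θ u w 1), h3, mul_one]
    exact AlgHom.commutes _ _

lemma mul_σ_eq_pow {η : CoordRing u w} (hη : algebraMap k _ (u * (u + 2)) * σ u w =
    x u w * η * (algebraMap k _ (u * (u + 2)) * σ u w)) (n : ℕ) :
    algebraMap k _ (u * (u + 2)) * σ u w =
      x u w ^ n * (η ^ n * (algebraMap k _ (u * (u + 2)) * σ u w)) := by
  induction n with
  | zero => simp
  | succ n ih =>
    refine hη.trans ?_
    conv_lhs => rw [ih]
    ring

lemma fgl_Δ_x : (fgl h).Δ (fgl h).x = comulX u w := comul_x h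

/-- Evaluating the first factor at α sends x to u and σ to wu, and wu acts as 1 on u(u+2); the
result is the expression of x_α through x and u(u+2)σ. -/
lemma fgl_translate_x : (fgl h).translate 1 (fgl h).x = z u w := by
  refine (fgl h).toCompl_injective (((fgl h).toCompl_translate 1 _).trans ?_)
  rw [fgl_Δ_x]
  refine (pair_extend_comulX _ _).trans ?_
  have h0 := congrArg (algebraMap k (Compl (θ u w))) h
  have h1 := map_mul_σ (toCompl (θ u w))
  have h2 : algebraMap k (Compl (θ u w)) (θ u w 1 (x u w)) = algebraMap k _ u :=
    congrArg _ θ_one_x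
  have h3 : algebraMap k (Compl (θ u w)) (θ u w 1 (σ u w)) = algebraMap k _ (w * u) :=
    congrArg _ θ_one_σ
  simp only [AugHom.const_toAlgHom, AugHom.id_toAlgHom]
  change (1 + algebraMap k (Compl (θ u w)) (θ u w 1 (x u w))) * _ - 1 - _ *
    (algebraMap k (Compl (θ u w)) (θ u w 1 (σ u w)) * _) = _
  rw [h2, h3]
  change (1 + algebraMap k (Compl (θ u w)) u) * (1 + toCompl (θ u w) (x u w)) - 1 -
    algebraMap k (Compl (θ u w)) u * (algebraMap k (Compl (θ u w)) u + 2) *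
    (algebraMap k (Compl (θ u w)) (w * u) * toCompl (θ u w) (σ u w)) = toCompl (θ u w) (z u w)
  simp only [map_sub, map_add, map_mul, map_one, map_ofNat, map_zero] at h0 h1 ⊢
  linear_combination -h1 + toCompl (θ u w) (σ u w) * h0

lemma fgl_pullbackTwo_x : (fgl h).pullbackTwo (fgl h).x =
    (1 + x u w) * (1 + x u w) - 1 - algebraMap k _ (u * (u + 2)) * (σ u w * σ u w) := by
  refine (fgl h).toCompl_injective (((fgl h).toCompl_ofCompl _).trans ?_)
  change ((AugHom.id (θ u w)).pair (AugHom.id (θ u w))).extend ((fgl h).Δ (fgl h).x) =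
    toCompl (θ u w) _
  rw [fgl_Δ_x]
  refine (pair_extend_comulX _ _).trans ?_
  simp only [AugHom.id_toAlgHom, map_sub, map_add, map_mul (toCompl (θ u w)), map_one,
    AlgHom.commutes]
  simp only [map_add, map_mul, map_ofNat]

lemma fgl_hasUnderlying : (fgl h).HasUnderlying FormalGroup.𝔾ₘ := by
  rw [EquivariantFGL.hasUnderlying_multiplicative_iff]
  intro n
  obtain ⟨η, hη, -⟩ := exists_mul_σ_eq h
  have h1 := congrArg (left u w) (mul_σ_eq_pow hη n)
  rw [map_mul (left u w), AlgHom.commutes, map_mul (left u w), map_pow (left u w)] at h1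
  have h2 : comulX u w - (left u w (x u w) + right u w (x u w) +
      left u w (x u w) * right u w (x u w)) ∈
      Ideal.span {left u w (x u w) ^ n, right u w (x u w) ^ n} := by
    rw [comulX, Ideal.mem_span_pair]
    exact ⟨-left u w (η ^ n * (algebraMap k _ (u * (u + 2)) * σ u w)) * right u w (σ u w), 0, by
      linear_combination right u w (σ u w) * h1⟩
  rw [← comul_x h] at h2
  exact h2

include h in
lemma toCompl_injective : Function.Injective (toCompl (θ u w)) := (fgl h).toCompl_injective

include h in
lemma mul_self_of_comulX_eq {v : k} (hv : comulX u w = left u w (x u w) + right u w (x u w) +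
      algebraMap k _ v * (left u w (x u w) * right u w (x u w))) :
    (1 + x u w) * (1 + x u w) - 1 - algebraMap k _ (u * (u + 2)) * (σ u w * σ u w) =
      x u w + x u w + algebraMap k _ v * (x u w * x u w) := by
  have h1 := congrArg (((AugHom.id (θ u w)).pair (AugHom.id (θ u w))).extend) hv
  refine toCompl_injective h ?_
  rw [pair_extend_comulX] at h1
  simp only [left, right, map_add, map_mul, AugHom.pair_extend_inl, AugHom.pair_extend_inr,
    AlgHom.commutes, AugHom.id_toAlgHom] at h1
  simp only [map_add, map_sub, map_mul (toCompl (θ u w)), AlgHom.commutes, map_one]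
  simp only [map_add, map_mul, map_ofNat]
  exact h1

omit h in
-- On the diagonal, multiplicativity reads (1-v)x² = u(u+2)σ², and the right side is x² times
-- η²u(u+2)σ². After cancelling x², the augmentation at 0 gives v = 1, and the one at α gives 1-v =
-- u(u+2)w².
lemma eq_zero_of_mul_self_eq {R : Type*} [CommRing R] [Algebra k R] {u w v : k} {x σ η : R}
    (h : u * (u + 2) * (1 - u * w) = 0) (hx : x ∈ nonZeroDivisors R) (p₀ p₁ : R →ₐ[k] k)
    (h0 : p₀ σ = 0) (h1 : p₁ σ = w * u) (h2 : p₁ η = w)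
    (h3 : algebraMap k R (u * (u + 2)) * σ = x ^ 2 * (η ^ 2 * (algebraMap k R (u * (u + 2)) * σ)))
    (hv : (1 + x) * (1 + x) - 1 - algebraMap k _ (u * (u + 2)) * (σ * σ) =
      x + x + algebraMap k _ v * (x * x)) :
    u * (u + 2) * w ^ 2 = 0 := by
  have h4 : x * (x * (1 - algebraMap k _ v -
      η ^ 2 * (algebraMap k _ (u * (u + 2)) * σ) * σ)) = 0 := by
    linear_combination hv + σ * h3
  have h5 := (mul_left_mem_nonZeroDivisors_eq_zero_iff hx).1
    ((mul_left_mem_nonZeroDivisors_eq_zero_iff hx).1 h4)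
  have h6 := congrArg p₀ h5
  have h7 := congrArg p₁ h5
  simp only [map_sub, map_mul p₀, map_one, AlgHom.commutes, h0, mul_zero, sub_zero, map_zero,
    Algebra.algebraMap_self, RingHom.id_apply] at h6
  simp only [map_sub, map_mul p₁, map_pow, map_one, AlgHom.commutes, h1, h2, map_zero,
    Algebra.algebraMap_self, RingHom.id_apply] at h7
  linear_combination h6 - h7 + w ^ 2 * (1 + w * u) * h

include h in
lemma eq_zero_of_comulX_eq {v : k} (hv : comulX u w = left u w (x u w) + right u w (x u w) +
      algebraMap k _ v * (left u w (x u w) * right u w (x u w))) : u * (u + 2) * w ^ 2 = 0 := by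
  obtain ⟨η, hη, hη1⟩ := exists_mul_σ_eq h
  have h3 := mul_σ_eq_pow hη 2
  have h4 := x_mem_nonZeroDivisors h
  exact eq_zero_of_mul_self_eq h h4 (θ u w 0) (θ u w 1) θ_zero_σ θ_one_σ hη1 h3
    (mul_self_of_comulX_eq h hv)

lemma comulX_eq_of_fgl_Δ_eq {v : k} (hv : (fgl h).Δ (fgl h).x = (fgl h).tmul (fgl h).x 1 +
      (fgl h).tmul 1 (fgl h).x + v • (fgl h).tmul (fgl h).x (fgl h).x) :
    comulX u w = left u w (x u w) + right u w (x u w) +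
      algebraMap k _ v * (left u w (x u w) * right u w (x u w)) := by
  rw [← comul_x h]
  refine Eq.trans hv ?_
  rw [EquivariantFGL.tmul_eq, EquivariantFGL.tmul_eq, EquivariantFGL.tmul_eq, Algebra.smul_def,
    map_one, map_one, mul_one, one_mul]
  rfl

lemma fgl_not_isMultiplicative (h0 : u * (u + 2) * w ^ 2 ≠ 0) : ¬ (fgl h).IsMultiplicative := by
  rintro ⟨v, hv⟩
  exact h0 (eq_zero_of_comulX_eq h (comulX_eq_of_fgl_Δ_eq h hv))

end CoordRing
end Example
end EqFGL
end

noncomputable section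

namespace EqFGL

/-! ### Parameters of the standard law and the explicit form of its coproduct. -/

section Example

variable {k : Type*} [CommRing k]

/-- The remainders of the expansion of `[2]^* x`. -/
lemma exists_remainders_aux {R : Type*} [CommRing R] [Algebra k R] {u w : k} {x σ η : R}
    (h : u * (u + 2) * (1 - u * w) = 0) (p₀ p₁ : R →ₐ[k] k) (hx₀ : p₀ x = 0) (hx₁ : p₁ x = u)
    (h0 : p₀ σ = 0) (h1 : p₁ σ = w * u) (h2 : p₁ η = w)
    (hη : algebraMap k R (u * (u + 2)) * σ = x * η * (algebraMap k R (u * (u + 2)) * σ)) :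
    ∃ Q : ℕ → R, Q 0 = (1 + x) * (1 + x) - 1 - algebraMap k _ (u * (u + 2)) * (σ * σ) ∧
      (∀ j, Q j = algebraMap k R (p₀ (Q j)) + x * Q (j + 1)) ∧ ∀ j, qParam u w j = p₁ (Q j) := by
  -- Remainders of 2x+x² minus those of u(u+2)σ². The latter has zero x-adic expansion, and dividing
  -- it by x amounts to multiplying by η, the inverse of x on its support.
  refine ⟨fun j => algebraMap k R (twoSeriesCoeff FormalGroup.𝔾ₘ j) +
    (if j = 0 then x * (x + 2) else if j = 1 then x else 0) -
      η ^ j * (algebraMap k R (u * (u + 2)) * σ) * σ, ?_, fun j => ?_, fun j => ?_⟩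
  · simp [twoSeriesCoeff_multiplicative, map_ofNat]
    ring
  · have h3 : p₀ (algebraMap k R (twoSeriesCoeff FormalGroup.𝔾ₘ j) +
      (if j = 0 then x * (x + 2) else if j = 1 then x else 0) -
      η ^ j * (algebraMap k R (u * (u + 2)) * σ) * σ) = twoSeriesCoeff FormalGroup.𝔾ₘ j := by
      rw [map_sub, map_mul p₀ _ σ, h0, mul_zero, sub_zero, map_add, AlgHom.commutes]
      split_ifs <;> simp [hx₀]
    simp only [h3]
    have h4 : ∀ i : ℕ, η ^ i * (algebraMap k R (u * (u + 2)) * σ) * σ =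
        x * (η ^ (i + 1) * (algebraMap k R (u * (u + 2)) * σ) * σ) := fun i => by
      linear_combination η ^ i * σ * hη
    rw [h4 j]
    rcases j with _ | _ | j <;> simp [twoSeriesCoeff_multiplicative, map_ofNat] <;> ring
  · have h4 : u * (u + 2) * (w * u) * (w * u) = u * (u + 2) := by
      linear_combination -(1 + w * u) * h
    have h3 : p₁ (η ^ j * (algebraMap k R (u * (u + 2)) * σ) * σ) = u * (u + 2) * w ^ j := by
      simp only [map_mul p₁, map_pow, h1, h2, AlgHom.commutes, Algebra.algebraMap_self,
        RingHom.id_apply]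
      linear_combination w ^ j * h4
    simp only [map_sub p₁, h3, map_add p₁, AlgHom.commutes, qParam]
    rcases j with _ | _ | j <;> simp [hx₁, map_ofNat]

namespace CoordRing

variable {u w : k} (h : u * (u + 2) * (1 - u * w) = 0)

lemma fgl_x : (fgl h).x = x u w := rfl

lemma fgl_q_eq : ∃ Q : ℕ → CoordRing u w, Q 0 = (fgl h).pullbackTwo (fgl h).x ∧
    (fgl h).IsRemainderSeq Q ∧ ∀ j, qParam u w j = (fgl h).θ 1 (Q j) := by
  obtain ⟨η, hη, hη1⟩ := exists_mul_σ_eq h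
  rw [fgl_pullbackTwo_x]
  exact exists_remainders_aux h (θ u w 0) (θ u w 1) θ_zero_x θ_one_x θ_zero_σ θ_one_σ hη1 hη

/-- The coefficients of the expansion of the coproduct, and their remainders. -/
def bSeries (u w : k) (i j : ℕ) : CoordRing u w :=
  if i = 0 then if j = 0 then x u w else if j = 1 then 1 else 0
  else if i = 1 then if j = 0 then 1 + x u w else if j = 1 then 1 else 0 else 0

lemma θ_zero_bSeries (i j : ℕ) : θ u w 0 (bSeries u w i j) =
    if i = 0 then if j = 1 then 1 else 0 else if i = 1 ∧ j ≤ 1 then 1 else 0 := by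
  rcases i with _ | _ | i <;> rcases j with _ | _ | j <;> simp [bSeries]

lemma θ_one_bSeries {i : ℕ} (j : ℕ) (hi : 1 ≤ i) :
    bParam u i j = θ u w 1 (bSeries u w i j) := by
  rcases i with _ | _ | i <;> rcases j with _ | _ | j <;> simp [bSeries, bParam] at hi ⊢

lemma bSeries_eq (i j : ℕ) : bSeries u w i j =
    algebraMap k _ (θ u w 0 (bSeries u w i j)) + x u w * bSeries u w i (j + 1) := by
  rw [θ_zero_bSeries]
  rcases i with _ | _ | i <;> rcases j with _ | _ | j <;> simp [bSeries]

/-- The correction is divisible by every power of a, so the expansion is that of b + a(1+b), with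
only two terms. -/
lemma sub_sum_mem_span {S : Type*} [CommRing S] {a b N p q : S} {B : ℕ → S}
    (h0 : B 0 = b) (h1 : B 1 = 1 + b) (h2 : ∀ i, B (i + 2) = 0)
    (hp : ∀ n, ∃ c, N * p = a ^ n * c) (n : ℕ) :
    (1 + a) * (1 + b) - 1 - N * (p * q) - ∑ i ∈ Finset.range n, a ^ i * B i ∈
      Ideal.span {a ^ n} := by
  rw [Ideal.mem_span_singleton]
  obtain ⟨c, hc⟩ := hp n
  rcases n with _ | _ | n
  · simp
  · rw [zero_add, Finset.sum_range_one, h0]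
    exact ⟨1 + b - c * q, by linear_combination -q * hc⟩
  · rw [Finset.sum_range_succ', Finset.sum_range_succ', Finset.sum_eq_zero fun i _ => by
      rw [h2, mul_zero], h0, h1]
    exact ⟨-c * q, by linear_combination -q * hc⟩

include h in
lemma comulX_sub_sum_mem (n : ℕ) : comulX u w - ∑ i ∈ Finset.range n,
    left u w (x u w) ^ i * right u w (bSeries u w i 0) ∈
      Ideal.span {left u w (x u w) ^ n} := by
  obtain ⟨η, hη, -⟩ := exists_mul_σ_eq h
  rw [comulX]
  refine sub_sum_mem_span (by simp [bSeries]) (by simp [bSeries]) (fun i => by simp [bSeries])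
    (fun n => ⟨left u w (η ^ n * (algebraMap k _ (u * (u + 2)) * σ u w)), ?_⟩) n
  have h1 := congrArg (left u w) (mul_σ_eq_pow hη n)
  rw [map_mul (left u w), AlgHom.commutes, map_mul (left u w), map_pow (left u w)] at h1
  exact h1

lemma fgl_b_eq : ∃ B : ℕ → ℕ → CoordRing u w,
    (∀ n : ℕ, (fgl h).Δ (fgl h).x - ∑ i ∈ Finset.range n, (fgl h).tmul ((fgl h).x ^ i) (B i 0) ∈
      Ideal.span {(fgl h).tmul ((fgl h).x ^ n) 1}) ∧
    (∀ i, (fgl h).IsRemainderSeq (B i)) ∧ ∀ i j, 1 ≤ i → bParam u i j = (fgl h).θ 1 (B i j) := by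
  refine ⟨bSeries u w, fun n => ?_, bSeries_eq, fun i j hi => θ_one_bSeries j hi⟩
  have h1 := comulX_sub_sum_mem h n
  rw [← comul_x h] at h1
  simp only [EquivariantFGL.tmul_eq, map_one, mul_one]
  simp only [← map_pow (left u w)] at h1
  exact h1

lemma fgl_hasParameters :
    HasParameters (fgl h) FormalGroup.𝔾ₘ u (qParam u w) (bParam u) where
  underlying := fgl_hasUnderlying h
  euler := θ_one_x
  q_eq := fgl_q_eq h
  b_eq := fgl_b_eq h

lemma fgl_hasValue : (fgl h).HasValue (rootSeries w)
    ((fgl h).x * (fgl h).translate 1 (fgl h).x) (φ u w) := by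
  rw [fgl_translate_x, fgl_x, x_mul_z h]
  intro n
  have h1 : φ u w - ∑ i ∈ Finset.range n, PowerSeries.coeff i (rootSeries w) • t u w ^ i ∈
      Ideal.span {t u w ^ n} := by
    have h2 : ∑ i ∈ Finset.range n, PowerSeries.coeff i (rootSeries w) • t u w ^ i =
        ofSeries u w (PowerSeries.trunc n (rootSeries w) : PowerSeries k) := by
      induction n with
      | zero => simp
      | succ n ih =>
        rw [Finset.sum_range_succ, ih, PowerSeries.trunc_succ, Polynomial.coe_add, map_add,
          ← Polynomial.C_mul_X_pow_eq_monomial, Polynomial.coe_mul, Polynomial.coe_pow,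
          Polynomial.coe_C, Polynomial.coe_X, map_mul (ofSeries u w), map_pow, ofSeries_C,
          Algebra.smul_def, t]
    rw [h2, Ideal.mem_span_singleton, φ, ← map_sub, t, ← map_pow]
    refine map_dvd (ofSeries u w) ⟨_, sub_eq_iff_eq_add.2
      (PowerSeries.eq_X_pow_mul_shift_add_trunc n (rootSeries w))⟩
  exact ((Ideal.span_singleton_le_iff_mem _).2
    (Ideal.pow_mem_pow t_mem_augIdeal n) : Ideal.span {t u w ^ n} ≤ _) h1

lemma idempotent_aux {R : Type*} [CommRing R] {u w x f t Y : R}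
    (hY : (1 + f) * Y = 1)
    (h1 : (x - f) * (x - u - (1 + u) * f) =
      (1 - u * w) * (f ^ 2 - t + (u + 2) * (t - f * x))) :
    w * (x - f) * Y * (w * (x - f) * Y) - w * (x - f) * Y = (1 - u * w) *
      (Y ^ 2 * (w ^ 2 * (f ^ 2 - t + (u + 2) * (t - f * x)) - w * (x - f) * (1 + f))) := by
  linear_combination Y ^ 2 * w ^ 2 * h1 + w * (x - f) * Y * hY

include h in
/-- A lift of the idempotent `ι₁`, and the explicit coproduct. -/
lemma exists_idempotent : ∃ e : CoordRing u w,
    e * e - e ∈ Ideal.span {algebraMap k (CoordRing u w) (1 - u * w)} ∧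
    θ u w 0 e = 0 ∧ θ u w 1 e = w * u ∧
    algebraMap k _ (u * (u + 2)) * (e * σ u w) = algebraMap k _ (u * (u + 2)) * σ u w := by
  obtain ⟨Y, hY⟩ := exists_ofSeries_mul_eq_one (u := u) (w := w)
    (f := 1 + rootSeries w) (by simp [constantCoeff_rootSeries])
  rw [map_add, map_one (ofSeries u w)] at hY
  change (1 + φ u w) * Y = 1 at hY
  have h1 := sub_mul_sub (u := u) (w := w)
  -- Where uw = 1, σ is the idempotent times the unit 1+φ; here Y is the inverse of this unit.
  refine ⟨σ u w * Y, ?_, ?_, ?_, ?_⟩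
  · rw [Ideal.mem_span_singleton, σ]
    simp only [map_sub, map_add, map_mul, map_one, map_ofNat] at h1 ⊢
    exact ⟨_, idempotent_aux hY h1⟩
  · rw [map_mul (θ u w 0), θ_zero_σ, zero_mul]
  · have h3 := congrArg (θ u w 1) hY
    rw [map_mul (θ u w 1), map_add, θ_φ, map_one, add_zero, one_mul] at h3
    rw [map_mul (θ u w 1), h3, mul_one, θ_one_σ]
  · have h4 := σ_sq h
    linear_combination Y * h4 + algebraMap k _ (u * (u + 2)) * σ u w * hY

/-- The lifted idempotent acts as the identity on u(u+2)σ, so it may be inserted in each factor of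
the correction term. This is also why the choice of lift does not matter. -/
lemma fgl_Δ_x_eq {e : CoordRing u w} (he : algebraMap k _ (u * (u + 2)) * (e * σ u w) =
      algebraMap k _ (u * (u + 2)) * σ u w) :
    (fgl h).Δ (fgl h).x = (fgl h).tmul (fgl h).x (fgl h).x + (fgl h).tmul 1 (fgl h).x +
      (fgl h).tmul (fgl h).x 1 - (u * (u + 2)) • (fgl h).tmul (e * σ u w) (e * σ u w) := by
  have hg : ∀ g : CoordRing u w →ₐ[k] Compl (tensorAug (θ u w) (θ u w)),
      algebraMap k _ (u * (u + 2)) * g (e * σ u w) = algebraMap k _ (u * (u + 2)) * g (σ u w) :=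
    fun g => by
      have h1 := congrArg g he
      rwa [map_mul g (algebraMap k _ (u * (u + 2))), map_mul g (algebraMap k _ (u * (u + 2))),
        AlgHom.commutes] at h1
  have h3 : comulX u w = left u w (x u w) * right u w (x u w) + right u w (x u w) +
      left u w (x u w) - algebraMap k _ (u * (u + 2)) *
        (left u w (e * σ u w) * right u w (e * σ u w)) := by
    rw [comulX]
    linear_combination right u w (e * σ u w) * hg (left u w) + left u w (σ u w) * hg (right u w)
  rw [← comul_x h] at h3
  rw [Algebra.smul_def]
  simp only [EquivariantFGL.tmul_eq, map_one, mul_one, one_mul]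
  exact h3

end CoordRing
end Example
end EqFGL
end

noncomputable section

namespace EqFGL

/-! ### Separation of points in completed tensor squares -/

section Division

variable {k R : Type*} [CommRing k] [CommRing R] [Algebra k R]

/-- Division by a regular generator of the kernel of an augmentation. -/
lemma exists_div {p : R →ₐ[k] k} {a : R} (ha : a ∈ nonZeroDivisors R)
    (hp : RingHom.ker p = Ideal.span {a}) :
    ∃ D : R →ₗ[k] R, ∀ r, r = algebraMap k R (p r) + a * D r := by
  have h1 : ∀ r, ∃ s, r = algebraMap k R (p r) + a * s := fun r => by
    have h2 : r - algebraMap k R (p r) ∈ RingHom.ker p := by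
      simp [RingHom.mem_ker]
    rw [hp, Ideal.mem_span_singleton] at h2
    obtain ⟨s, hs⟩ := h2
    exact ⟨s, by linear_combination hs⟩
  choose D hD using h1
  refine ⟨⟨⟨D, fun r s => ?_⟩, fun c r => ?_⟩, hD⟩
  · refine (mul_cancel_left_mem_nonZeroDivisors ha).1 ?_
    have h2 := hD (r + s)
    simp only [map_add] at h2
    linear_combination hD r + hD s - h2
  · refine (mul_cancel_left_mem_nonZeroDivisors ha).1 ?_
    have h2 := hD (c • r)
    simp only [Algebra.smul_def, map_mul, AlgHom.commutes, Algebra.algebraMap_self,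
      RingHom.id_apply] at h2 ⊢
    linear_combination algebraMap k R c * hD r - h2

/-- Expansions with respect to a sequence of regular generators of kernels of augmentations. -/
lemma exists_coeff {p : ℕ → R →ₐ[k] k} {a : ℕ → R} (ha : ∀ i, a i ∈ nonZeroDivisors R)
    (hp : ∀ i, RingHom.ker (p i) = Ideal.span {a i}) : ∃ c : ℕ → R →ₗ[k] k,
    (∀ n r, r - ∑ i ∈ Finset.range n, c i r • ∏ j ∈ Finset.range i, a j ∈
      Ideal.span {∏ j ∈ Finset.range n, a j}) ∧
    ∀ n i, i < n → ∀ r, c i ((∏ j ∈ Finset.range n, a j) * r) = 0 := by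
  choose D hD using fun i => exists_div (ha i) (hp i)
  -- The remainder after successive division by a 0, …, a (n-1); the i-th coefficient is the i-th
  -- augmentation of the i-th remainder.
  let rem : ℕ → R →ₗ[k] R := fun n => Nat.rec LinearMap.id (fun i f => D i ∘ₗ f) n
  have hrem : ∀ n r, rem (n + 1) r = D n (rem n r) := fun n r => rfl
  have h1 : ∀ n r, r = ∑ i ∈ Finset.range n, p i (rem i r) • ∏ j ∈ Finset.range i, a j +
      (∏ j ∈ Finset.range n, a j) * rem n r := by
    intro n r
    induction n with
    | zero => simp [rem]
    | succ n ih =>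
      rw [Finset.sum_range_succ, Finset.prod_range_succ, hrem, Algebra.smul_def]
      linear_combination ih + (∏ j ∈ Finset.range n, a j) * hD n (rem n r)
  have hpa : ∀ i s, p i (a i * s) = 0 := fun i s => by
    have : a i * s ∈ RingHom.ker (p i) := by
      rw [hp]
      exact Ideal.mul_mem_right _ _ (Ideal.mem_span_singleton_self _)
    exact this
  have h2 : ∀ n s, rem n ((∏ j ∈ Finset.range n, a j) * s) = s := by
    intro n
    induction n with
    | zero => simp [rem]
    | succ n ih =>
      intro s
      rw [hrem, Finset.prod_range_succ, mul_assoc, ih]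
      refine (mul_cancel_left_mem_nonZeroDivisors (ha n)).1 ?_
      have h3 := hD n (a n * s)
      rw [hpa, map_zero, zero_add] at h3
      exact h3.symm
  refine ⟨fun i => (p i).toLinearMap ∘ₗ rem i, fun n r => ?_, fun n i hi r => ?_⟩
  · rw [Ideal.mem_span_singleton]
    exact ⟨rem n r, by
      simp only [LinearMap.comp_apply, AlgHom.toLinearMap_apply]
      linear_combination h1 n r⟩
  · obtain ⟨q, hq⟩ := Finset.prod_dvd_prod_of_subset _ _ a
      (Finset.range_mono (Nat.succ_le_of_lt hi))
    rw [hq, Nat.succ_eq_add_one, Finset.prod_range_succ, mul_assoc, mul_assoc,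
      LinearMap.comp_apply, h2]
    exact hpa i _

/-- The tensor product of two linear functionals. -/
def tensorFunctional (c d : R →ₗ[k] k) : R ⊗[k] R →ₗ[k] k :=
  LinearMap.mul' k k ∘ₗ TensorProduct.map c d

@[simp] lemma tensorFunctional_tmul (c d : R →ₗ[k] k) (r s : R) :
    tensorFunctional c d (r ⊗ₜ s) = c r * d s := rfl

variable (k) in
/-- The ideal of the tensor square generated by `a ⊗ 1` and `1 ⊗ b`. -/
def tensorSpan (a b : R) : Ideal (R ⊗[k] R) := Ideal.span {a ⊗ₜ 1, 1 ⊗ₜ b}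

lemma tmul_mem_tensorSpan_left {a b r : R} (hr : r ∈ Ideal.span {a}) (s : R) :
    r ⊗ₜ s ∈ tensorSpan k a b := by
  obtain ⟨r', rfl⟩ := Ideal.mem_span_singleton.1 hr
  rw [show (a * r') ⊗ₜ[k] s = (r' ⊗ₜ[k] s) * (a ⊗ₜ[k] 1) by
    rw [Algebra.TensorProduct.tmul_mul_tmul, mul_one, mul_comm]]
  exact Ideal.mul_mem_left _ _ (Ideal.subset_span (by simp))

lemma tmul_mem_tensorSpan_right {a b s : R} (r : R) (hs : s ∈ Ideal.span {b}) :
    r ⊗ₜ s ∈ tensorSpan k a b := by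
  obtain ⟨s', rfl⟩ := Ideal.mem_span_singleton.1 hs
  rw [show r ⊗ₜ[k] (b * s') = (r ⊗ₜ[k] s') * (1 ⊗ₜ[k] b) by
    rw [Algebra.TensorProduct.tmul_mul_tmul, mul_one, mul_comm b]]
  exact Ideal.mul_mem_left _ _ (Ideal.subset_span (by simp))

lemma tensorFunctional_eq_zero {c d : R →ₗ[k] k} {q : R} (hc : ∀ r, c (q * r) = 0)
    (hd : ∀ r, d (q * r) = 0) {y : R ⊗[k] R} (hy : y ∈ tensorSpan k q q) :
    tensorFunctional c d y = 0 := by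
  obtain ⟨a, b, rfl⟩ := Ideal.mem_span_pair.1 hy
  have h1 : ∀ a : R ⊗[k] R, tensorFunctional c d (a * (q ⊗ₜ 1)) = 0 := fun a => by
    induction a using TensorProduct.induction_on with
    | zero => simp
    | tmul r s => simp [mul_comm r, hc]
    | add a b ha hb => rw [add_mul, map_add, ha, hb, add_zero]
  have h2 : ∀ a : R ⊗[k] R, tensorFunctional c d (a * (1 ⊗ₜ q)) = 0 := fun a => by
    induction a using TensorProduct.induction_on with
    | zero => simp
    | tmul r s => simp [mul_comm s, hd]
    | add a b ha hb => rw [add_mul, map_add, ha, hb, add_zero]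
  rw [map_add, h1, h2, add_zero]

/-- The products e i ⊗ e j span the tensor square modulo q ⊗ 1 and 1 ⊗ q, with coefficients given by
c i ⊗ c j. With `tensorFunctional_eq_zero` this turns membership in the ideal into a question about
scalars. -/
lemma mem_tensorSpan_of_functionals {c : ℕ → R →ₗ[k] k} {e : ℕ → R} {n : ℕ} {q : R}
    (h : ∀ r, r - ∑ i ∈ Finset.range n, c i r • e i ∈ Ideal.span {q}) {y : R ⊗[k] R}
    (hy : ∀ i < n, ∀ j < n, tensorFunctional (c i) (c j) y = 0) : y ∈ tensorSpan k q q := by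
  have key : ∀ y : R ⊗[k] R, y - ∑ i ∈ Finset.range n, ∑ j ∈ Finset.range n,
      tensorFunctional (c i) (c j) y • (e i ⊗ₜ[k] e j) ∈ tensorSpan k q q := fun y => by
    induction y using TensorProduct.induction_on with
    | zero => simp
    | tmul r s =>
      have h1 : ∑ i ∈ Finset.range n, ∑ j ∈ Finset.range n,
          tensorFunctional (c i) (c j) (r ⊗ₜ[k] s) • (e i ⊗ₜ[k] e j) =
          (∑ i ∈ Finset.range n, c i r • e i) ⊗ₜ[k] (∑ j ∈ Finset.range n, c j s • e j) := by
        rw [TensorProduct.sum_tmul]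
        refine Finset.sum_congr rfl fun i _ => ?_
        rw [TensorProduct.tmul_sum]
        refine Finset.sum_congr rfl fun j _ => ?_
        rw [tensorFunctional_tmul, TensorProduct.smul_tmul_smul]
      rw [h1, show ∀ r' s' : R, r ⊗ₜ[k] s - r' ⊗ₜ s' = (r - r') ⊗ₜ s + r' ⊗ₜ (s - s') from
        fun r' s' => by rw [TensorProduct.sub_tmul, TensorProduct.tmul_sub]; abel]
      exact add_mem (tmul_mem_tensorSpan_left (h r) _) (tmul_mem_tensorSpan_right _ (h s))
    | add a b ha hb =>
      refine (congrArg (· ∈ tensorSpan k q q) ?_).mp (add_mem ha hb)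
      simp only [map_add, add_smul, Finset.sum_add_distrib]
      abel
  have h1 := key y
  rwa [Finset.sum_eq_zero, sub_zero] at h1
  intro i hi
  refine Finset.sum_eq_zero fun j hj => ?_
  rw [hy i (Finset.mem_range.1 hi) j (Finset.mem_range.1 hj), zero_smul]

lemma span_pair_mul_span_pair_le {S : Type*} [CommRing S] (a a' b : S) :
    Ideal.span {a, b} * Ideal.span {a', b} ≤ Ideal.span {a * a', b} := by
  refine Ideal.mul_le.2 fun p hp q hq => ?_
  obtain ⟨p₁, p₂, rfl⟩ := Ideal.mem_span_pair.1 hp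
  obtain ⟨q₁, q₂, rfl⟩ := Ideal.mem_span_pair.1 hq
  exact Ideal.mem_span_pair.2 ⟨p₁ * q₁, p₁ * a * q₂ + p₂ * q₁ * a' + p₂ * q₂ * b, by ring⟩

lemma span_pair_pow_le {S : Type*} [CommRing S] (a b : S) (n : ℕ) :
    Ideal.span {a, b} ^ (n + n) ≤ Ideal.span {a ^ n, b ^ n} := by
  rw [Ideal.span_insert, Ideal.span_insert, ← Ideal.span_singleton_pow,
    ← Ideal.span_singleton_pow]
  exact Ideal.sup_pow_add_le_pow_sup_pow

/-- Write v through a and a'; multiply a by the expression of c in (a', b), and a' by the expression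
of c in (a, b). -/
lemma mul_mem_span_pair {S : Type*} [CommRing S] {v a a' b c : S} (hv : v ∈ Ideal.span {a, a'})
    (h1 : c ∈ Ideal.span {a, b}) (h2 : c ∈ Ideal.span {a', b}) :
    v * c ∈ Ideal.span {a * a', b} := by
  obtain ⟨v₁, v₂, rfl⟩ := Ideal.mem_span_pair.1 hv
  obtain ⟨p, q, h1⟩ := Ideal.mem_span_pair.1 h1
  obtain ⟨p', q', h2⟩ := Ideal.mem_span_pair.1 h2
  exact Ideal.mem_span_pair.2 ⟨v₁ * p' + v₂ * p, v₁ * a * q' + v₂ * a' * q, by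
    linear_combination v₁ * a * h2 + v₂ * a' * h1⟩

end Division
end EqFGL
end

noncomputable section

namespace EqFGL

/-! ### Ideals of the four points in the uncompleted tensor square. -/

section Separation

variable {k R : Type*} [CommRing k] [CommRing R] [Algebra k R]

lemma pow_mem_span_pair {S : Type*} [CommRing S] {v a b y : S} (hv : v = b - a * y) (n : ℕ) :
    v ^ (n + n) ∈ Ideal.span {a ^ n, b ^ n} := by
  rw [hv, sub_eq_add_neg]
  refine Ideal.add_pow_mem_of_pow_mem_of_le _ (m := n) (n := n)
    (Ideal.subset_span (by simp)) ?_ (Nat.le_succ _)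
  rw [neg_pow, mul_pow]
  exact Ideal.mul_mem_left _ _ (Ideal.mul_mem_right _ _ (Ideal.subset_span (by simp)))

/-- Modulo v, the square of a is a multiple of ab. For a = x, b = x_α and v = u: modulo the Euler
class the two points coincide. -/
lemma pow_mem_span_pair' {S : Type*} [CommRing S] {v a b y : S} (ha : a = v + b * y) (n : ℕ) :
    a ^ (n + n) ∈ Ideal.span {v, (a * b) ^ n} := by
  rw [← two_mul, pow_mul, show a ^ 2 = v * a + a * b * y by linear_combination a * ha]
  refine Ideal.add_pow_mem_of_pow_mem_of_le _ (m := 1) (n := n) ?_ ?_ (by omega)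
  · rw [pow_one]
    exact Ideal.mul_mem_right _ _ (Ideal.subset_span (by simp))
  · rw [mul_pow (a * b) y]
    exact Ideal.mul_mem_right _ _ (Ideal.subset_span (Or.inr rfl))

lemma tensorSpan_eq (a b : R) : tensorSpan k a b =
    Ideal.span {(Algebra.TensorProduct.includeLeft : R →ₐ[k] R ⊗[k] R) a,
      (Algebra.TensorProduct.includeRight : R →ₐ[k] R ⊗[k] R) b} := rfl

/-- Away from u = 0 the points x = 0 and z = 0 are disjoint: u^(2n) lies in (x^n, z^n). One such
factor glues the points in the left direction, another in the right one. -/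
lemma algebraMap_pow_mul_mem_tensorSpan {u : k} {x z : R} {y : R ⊗[k] R} {n : ℕ}
    (hu : algebraMap k R u ^ (n + n) ∈ Ideal.span {x ^ n, z ^ n})
    (hxx : y ∈ tensorSpan k (x ^ n) (x ^ n)) (hxz : y ∈ tensorSpan k (x ^ n) (z ^ n))
    (hzx : y ∈ tensorSpan k (z ^ n) (x ^ n)) (hzz : y ∈ tensorSpan k (z ^ n) (z ^ n)) :
    u ^ (4 * n) • y ∈ tensorSpan k ((x * z) ^ n) ((x * z) ^ n) := by
  have hg : ∀ g : R →ₐ[k] R ⊗[k] R, algebraMap k (R ⊗[k] R) u ^ (n + n) ∈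
      Ideal.span {g (x ^ n), g (z ^ n)} := fun g => by
    obtain ⟨a, b, h⟩ := Ideal.mem_span_pair.1 hu
    refine Ideal.mem_span_pair.2 ⟨g a, g b, ?_⟩
    rw [← map_mul, ← map_mul, ← map_add, h, map_pow, AlgHom.commutes]
  have h1 := mul_mem_span_pair (hg Algebra.TensorProduct.includeLeft) hxx hzx
  have h2 := mul_mem_span_pair (hg Algebra.TensorProduct.includeLeft) hxz hzz
  rw [Set.pair_comm] at h1 h2
  have h3 := mul_mem_span_pair (hg Algebra.TensorProduct.includeRight) h1 h2
  rw [Set.pair_comm, ← mul_assoc, ← pow_add, show n + n + (n + n) = 4 * n by ring, ← map_pow,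
    ← Algebra.smul_def] at h3
  have h4 : ∀ g : R →ₐ[k] R ⊗[k] R, g ((x * z) ^ n) = g (x ^ n) * g (z ^ n) := fun g => by
    rw [mul_pow, map_mul]
  rw [tensorSpan_eq, h4, h4]
  exact h3

/-- An element of the tensor square that vanishes to high order at the four points vanishes. -/
lemma mem_tensorSpan_of_forall {u : k} {x z : R} {p₀ p₁ : R →ₐ[k] k}
    (hx : x ∈ nonZeroDivisors R) (hz : z ∈ nonZeroDivisors R)
    (h₀ : RingHom.ker p₀ = Ideal.span {x}) (h₁ : RingHom.ker p₁ = Ideal.span {z})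
    (hux : p₁ x = u) (huz : p₀ z = u)
    (hu : ∀ a : k, (∃ b, a = u * b) → (∃ M, u ^ M * a = 0) → a = 0)
    {y : R ⊗[k] R} {n : ℕ} (hxx' : y ∈ tensorSpan k (x ^ (n + n)) (x ^ (n + n)))
    (hxx : y ∈ tensorSpan k (x ^ n) (x ^ n)) (hxz : y ∈ tensorSpan k (x ^ n) (z ^ n))
    (hzx : y ∈ tensorSpan k (z ^ n) (x ^ n)) (hzz : y ∈ tensorSpan k (z ^ n) (z ^ n)) :
    y ∈ tensorSpan k ((x * z) ^ n) ((x * z) ^ n) := by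
  obtain ⟨D₀, hD₀⟩ := exists_div hx h₀
  obtain ⟨D₁, hD₁⟩ := exists_div hz h₁
  have hu1 := pow_mem_span_pair (v := algebraMap k R u) (a := x) (b := z) (y := D₀ z)
    (by rw [← huz]; linear_combination -hD₀ z) n
  have hu2 := pow_mem_span_pair' (v := algebraMap k R u) (a := x) (b := z) (y := D₁ x)
    (by rw [← hux]; exact hD₁ x) n
  -- Divide alternately by x and z, so that after 2n divisions the product is (xz)^n.
  obtain ⟨c, hc, hc'⟩ := exists_coeff (p := fun i => if Even i then p₀ else p₁)
    (a := fun i => if Even i then x else z) (fun i => by split_ifs <;> assumption)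
    (fun i => by split_ifs <;> assumption)
  have hprod : ∏ j ∈ Finset.range (2 * n), (if Even j then x else z) = (x * z) ^ n := by
    clear * -
    induction n with
    | zero => simp
    | succ n ih =>
      rw [mul_add, mul_one, Finset.prod_range_succ, Finset.prod_range_succ, ih, if_pos (by simp),
        if_neg (by simp), pow_succ, mul_assoc]
  replace hc := hc (2 * n)
  replace hc' := hc' (2 * n)
  rw [hprod] at hc hc'
  -- Each coordinate of y is a multiple of u, since x^(2n) lies in (u, (xz)^n), and is killed by
  -- u^(4n), since the four local conditions glue after multiplication by it.
  refine mem_tensorSpan_of_functionals hc fun i hi j hj => hu _ ?_ ⟨4 * n, ?_⟩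
  · have h3 : ∀ (g : R →ₐ[k] R ⊗[k] R) (J : Ideal (R ⊗[k] R)), g ((x * z) ^ n) ∈ J →
        g (x ^ (n + n)) ∈ Ideal.span {algebraMap k (R ⊗[k] R) u} ⊔ J := fun g J hJ => by
      obtain ⟨a, b, h⟩ := Ideal.mem_span_pair.1 hu2
      rw [← h, map_add, map_mul, map_mul, AlgHom.commutes]
      exact add_mem (Ideal.mem_sup_left (Ideal.mul_mem_left _ _ (Ideal.mem_span_singleton_self _)))
        (Ideal.mem_sup_right (Ideal.mul_mem_left _ _ hJ))
    have h4 : tensorSpan k (x ^ (n + n)) (x ^ (n + n)) ≤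
        Ideal.span {algebraMap k (R ⊗[k] R) u} ⊔ tensorSpan k ((x * z) ^ n) ((x * z) ^ n) := by
      refine Ideal.span_le.2 ?_
      rintro _ (rfl | rfl)
      · exact h3 Algebra.TensorProduct.includeLeft _ (Ideal.subset_span (Or.inl rfl))
      · exact h3 Algebra.TensorProduct.includeRight _ (Ideal.subset_span (Or.inr rfl))
    obtain ⟨a, ha, b, hb, hab⟩ := Submodule.mem_sup.1 (h4 hxx')
    obtain ⟨a', rfl⟩ := Ideal.mem_span_singleton.1 ha
    refine ⟨tensorFunctional (c i) (c j) a', ?_⟩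
    rw [← hab, map_add, tensorFunctional_eq_zero (hc' i hi) (hc' j hj) hb, add_zero,
      ← Algebra.smul_def, map_smul, smul_eq_mul]
  · rw [← smul_eq_mul, ← map_smul]
    exact tensorFunctional_eq_zero (hc' i hi) (hc' j hj)
      (algebraMap_pow_mul_mem_tensorSpan hu1 hxx hxz hzx hzz)

lemma ker_tensor_le {p q : R →ₐ[k] k} {a b : R} (hp : RingHom.ker p = Ideal.span {a})
    (hq : RingHom.ker q = Ideal.span {b}) :
    RingHom.ker (Algebra.TensorProduct.lift p q (fun _ _ => Commute.all _ _)) ≤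
      tensorSpan k a b := by
  have key : ∀ y : R ⊗[k] R, y - algebraMap k _
      (Algebra.TensorProduct.lift p q (fun _ _ => Commute.all _ _) y) ∈ tensorSpan k a b := by
    intro y
    induction y using TensorProduct.induction_on with
    | zero => simp
    | tmul r s =>
      have h1 : r ⊗ₜ[k] s - algebraMap k _
          (Algebra.TensorProduct.lift p q (fun _ _ => Commute.all _ _) (r ⊗ₜ[k] s)) =
          (r - algebraMap k R (p r)) ⊗ₜ s + algebraMap k R (p r) ⊗ₜ (s - algebraMap k R (q s)) := by
        rw [TensorProduct.sub_tmul, TensorProduct.tmul_sub, Algebra.TensorProduct.lift_tmul,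
          Algebra.algebraMap_eq_smul_one (p r * q s), Algebra.algebraMap_eq_smul_one (p r),
          Algebra.algebraMap_eq_smul_one (q s), TensorProduct.smul_tmul_smul,
          Algebra.TensorProduct.one_def]
        abel
      rw [h1]
      refine add_mem (tmul_mem_tensorSpan_left ?_ _) (tmul_mem_tensorSpan_right _ ?_)
      · rw [← hp]
        simp [RingHom.mem_ker]
      · rw [← hq]
        simp [RingHom.mem_ker]
    | add y y' hy hy' =>
      refine (congrArg (· ∈ tensorSpan k a b) ?_).mp (add_mem hy hy')
      rw [map_add, map_add]
      abel
  intro y hy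
  have h1 := key y
  rwa [RingHom.mem_ker.1 hy, map_zero, sub_zero] at h1

lemma tensorSpan_mul_le {ι : Type*} {a : ι → R} (i₀ i₁ : ι) :
    (⨅ p : ι × ι, tensorSpan k (a p.1) (a p.2)) ^ 4 ≤
      tensorSpan k (a i₀ * a i₁) (a i₀ * a i₁) := by
  set I := ⨅ p : ι × ι, tensorSpan k (a p.1) (a p.2)
  have h1 : ∀ i, I * I ≤ tensorSpan k (a i₀ * a i₁) (a i) := fun i => by
    refine (Ideal.mul_mono (iInf_le _ (i₀, i)) (iInf_le _ (i₁, i))).trans ?_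
    have h2 := span_pair_mul_span_pair_le
      ((Algebra.TensorProduct.includeLeft : R →ₐ[k] R ⊗[k] R) (a i₀))
      ((Algebra.TensorProduct.includeLeft : R →ₐ[k] R ⊗[k] R) (a i₁))
      ((Algebra.TensorProduct.includeRight : R →ₐ[k] R ⊗[k] R) (a i))
    rw [← map_mul] at h2
    exact h2
  rw [show I ^ 4 = I * I * (I * I) by ring]
  refine (Ideal.mul_mono (h1 i₀) (h1 i₁)).trans ?_
  have h2 := span_pair_mul_span_pair_le
    ((Algebra.TensorProduct.includeRight : R →ₐ[k] R ⊗[k] R) (a i₀))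
    ((Algebra.TensorProduct.includeRight : R →ₐ[k] R ⊗[k] R) (a i₁))
    ((Algebra.TensorProduct.includeLeft : R →ₐ[k] R ⊗[k] R) (a i₀ * a i₁))
  rw [← map_mul] at h2
  simp only [tensorSpan_eq, Set.pair_comm (Algebra.TensorProduct.includeLeft (a i₀ * a i₁))]
  exact h2

/-- Membership in an ideal with two generators descends from the completion. -/
lemma mem_sup_of_toCompl {ι B : Type*} [CommRing B] [Algebra k B] {θ : ι → B →ₐ[k] k}
    {c : Compl θ} {a b y : B} {m : ℕ}
    (hy : Ideal.Quotient.mk _ y = AdicCompletion.evalₐ (augIdeal θ) m c)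
    (hc : c ∈ Ideal.span {toCompl θ a, toCompl θ b}) :
    y ∈ Ideal.span {a, b} ⊔ augIdeal θ ^ m := by
  obtain ⟨p, q, rfl⟩ := Ideal.mem_span_pair.1 hc
  obtain ⟨p', hp'⟩ := Ideal.Quotient.mk_surjective (AdicCompletion.evalₐ (augIdeal θ) m p)
  obtain ⟨q', hq'⟩ := Ideal.Quotient.mk_surjective (AdicCompletion.evalₐ (augIdeal θ) m q)
  rw [map_add, map_mul, map_mul, evalₐ_toCompl, evalₐ_toCompl, ← hp', ← hq', ← map_mul,
    ← map_mul, ← map_add, Ideal.Quotient.eq] at hy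
  exact Submodule.mem_sup.2 ⟨_, Ideal.mem_span_pair.2 ⟨p', q', rfl⟩, _, hy, by ring⟩

end Separation
end EqFGL
end

noncomputable section

namespace EqFGL

/-! ### The separation theorem for an arbitrary law. -/

section Points

variable {k R : Type*} [CommRing k] [CommRing R] [Algebra k R]

namespace EquivariantFGL

section

variable {Γ : Type*} [AddCommGroup Γ] [Finite Γ] (E : EquivariantFGL k Γ R)

/-- The exchange of the factors of the completed tensor square. -/
def swap : E.Square →ₐ[k] E.Square := ((AugHom.inr E.θ E.θ).pair (AugHom.inl E.θ E.θ)).extend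

lemma swap_left (r : R) : E.swap (E.left r) = E.right r := AugHom.pair_extend_inl _ _ r

lemma swap_right (r : R) : E.swap (E.right r) = E.left r := AugHom.pair_extend_inr _ _ r

lemma swap_Δ (r : R) : E.swap (E.Δ r) = E.Δ r := E.cocomm r

/-- The translation of the first factor of the completed tensor square. -/
def translateLeft (γ : Γ) : E.Square →ₐ[k] E.Square :=
  (((AugHom.inl E.θ E.θ).comp (E.translateHom γ)).pair (AugHom.inr E.θ E.θ)).extend

lemma translateLeft_left (γ : Γ) (r : R) :
    E.translateLeft γ (E.left r) = E.left (E.translate γ r) := by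
  refine (AugHom.pair_extend_inl _ _ r).trans ?_
  rw [AugHom.comp_toAlgHom]
  exact AugHom.extend_toCompl _ _

lemma translateLeft_right (γ : Γ) (r : R) : E.translateLeft γ (E.right r) = E.right r :=
  AugHom.pair_extend_inr _ _ r

lemma translateLeft_Δ (γ : Γ) (r : R) : E.translateLeft γ (E.Δ r) = E.Δ (E.translate γ r) :=
  (E.Δ_translate γ r).symm

/-- `1 ⊗ θ γ`, on the completed tensor square. -/
def evalRight (γ : Γ) : E.Square →ₐ[k] R :=
  E.ofCompl.comp ((AugHom.id E.θ).pair (AugHom.const E.θ E.θ γ)).extend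

lemma evalRight_left (γ : Γ) (r : R) : E.evalRight γ (E.left r) = r := by
  refine (congrArg E.ofCompl (AugHom.pair_extend_inl _ _ r)).trans ?_
  rw [AugHom.id_toAlgHom, ofCompl_toCompl]

lemma evalRight_right (γ : Γ) (r : R) :
    E.evalRight γ (E.right r) = algebraMap k R (E.θ γ r) := by
  refine (congrArg E.ofCompl (AugHom.pair_extend_inr _ _ r)).trans ?_
  rw [AugHom.const_toAlgHom, AlgHom.commutes]

lemma evalRight_Δ (γ : Γ) (r : R) : E.evalRight γ (E.Δ r) = E.translate γ r := by
  rw [← E.swap_Δ]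
  refine congrArg E.ofCompl ((AugHom.extend_pair _ _ _ _).trans ?_)
  refine DFunLike.congr_fun (AugHom.pair_congr (fun b => ?_) fun b => ?_) _
  · exact AugHom.pair_extend_inr _ _ b
  · exact AugHom.pair_extend_inl _ _ b

end

variable (E : EquivariantFGL k (ZMod 2) R)

/-- The translate `x_α` of the coordinate. -/
def xα : R := E.translate 1 E.x

lemma translate_one_translate_one (r : R) : E.translate 1 (E.translate 1 r) = r := by
  rw [translate_translate, show (1 + 1 : ZMod 2) = 0 from rfl, translate_zero]

lemma translate_one_xα : E.translate 1 E.xα = E.x := E.translate_one_translate_one _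

lemma θ_zero_x : E.θ 0 E.x = 0 := by
  have : E.x ∈ RingHom.ker (E.θ 0) := by
    rw [E.ker_θ_zero]
    exact Ideal.mem_span_singleton_self _
  exact this

lemma θ_zero_xα : E.θ 0 E.xα = E.euler 1 := E.θ_translate 1 0 _

lemma θ_one_xα : E.θ 1 E.xα = 0 := (E.θ_translate 1 1 _).trans E.θ_zero_x

lemma θ_x_mul_xα (γ : ZMod 2) : E.θ γ (E.x * E.xα) = 0 := by
  rcases zmod_two_cases γ with rfl | rfl
  · rw [map_mul, θ_zero_x, zero_mul]
  · rw [map_mul, θ_one_xα, mul_zero]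

lemma ker_θ_one : RingHom.ker (E.θ 1) = Ideal.span {E.xα} := by
  ext r
  rw [Ideal.mem_span_singleton]
  constructor
  · intro hr
    have h1 : E.translate 1 r ∈ RingHom.ker (E.θ 0) := (E.θ_translate 1 0 r).trans hr
    rw [E.ker_θ_zero, Ideal.mem_span_singleton] at h1
    rw [← E.translate_one_translate_one r]
    exact map_dvd _ h1
  · rintro ⟨s, rfl⟩
    rw [RingHom.mem_ker, map_mul, θ_one_xα, zero_mul]

lemma xα_regular : E.xα ∈ nonZeroDivisors R := by
  refine mem_nonZeroDivisors_iff_left.2 fun r hr => ?_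
  have h1 := congrArg (E.translate 1) hr
  rw [map_mul, translate_one_xα, map_zero] at h1
  have h2 := (mul_left_mem_nonZeroDivisors_eq_zero_iff E.x_regular).1 h1
  rw [← E.translate_one_translate_one r, h2, map_zero]

/-- The factor 4 uses one copy of the ideal for each of the four points, and n+n comes from
(s,t)^(2n) ⊆ (s^n, t^n). -/
lemma augIdeal_tensorAug_pow_le (n : ℕ) : augIdeal (tensorAug E.θ E.θ) ^ (4 * (n + n)) ≤
    tensorSpan k ((E.x * E.xα) ^ n) ((E.x * E.xα) ^ n) := by
  have h1 : augIdeal (tensorAug E.θ E.θ) ≤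
      ⨅ p : ZMod 2 × ZMod 2, tensorSpan k ((fun i => if i = 0 then E.x else E.xα) p.1)
        ((fun i => if i = 0 then E.x else E.xα) p.2) := by
    refine iInf_mono fun p => ker_tensor_le ?_ ?_
    · rcases zmod_two_cases p.1 with h | h <;> rw [h]
      · exact E.ker_θ_zero
      · exact E.ker_θ_one
    · rcases zmod_two_cases p.2 with h | h <;> rw [h]
      · exact E.ker_θ_zero
      · exact E.ker_θ_one
  have h2 := tensorSpan_mul_le (k := k) (a := fun i : ZMod 2 => if i = 0 then E.x else E.xα) 0 1
  rw [pow_mul]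
  refine (Ideal.pow_right_mono ((Ideal.pow_right_mono h1 4).trans h2) (n + n)).trans ?_
  have h3 := span_pair_pow_le
    ((Algebra.TensorProduct.includeLeft : R →ₐ[k] R ⊗[k] R) (E.x * E.xα))
    ((Algebra.TensorProduct.includeRight : R →ₐ[k] R ⊗[k] R) (E.x * E.xα)) n
  rw [← map_pow, ← map_pow] at h3
  exact h3

lemma tensorSpan_le_augIdeal_pow (n : ℕ) :
    tensorSpan k ((E.x * E.xα) ^ n) ((E.x * E.xα) ^ n) ≤ augIdeal (tensorAug E.θ E.θ) ^ n := by
  have h1 : ∀ g : R →ₐ[k] R ⊗[k] R, (∀ p r, ∃ i, tensorAug E.θ E.θ p (g r) = E.θ i r) →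
      g ((E.x * E.xα) ^ n) ∈ augIdeal (tensorAug E.θ E.θ) ^ n := fun g hg => by
    rw [map_pow]
    refine Ideal.pow_mem_pow (mem_augIdeal.2 fun p => ?_) n
    obtain ⟨i, hi⟩ := hg p (E.x * E.xα)
    rw [hi, θ_x_mul_xα]
  refine Ideal.span_le.2 ?_
  rintro _ (rfl | rfl)
  · exact h1 Algebra.TensorProduct.includeLeft fun p r => ⟨p.1, by simp [tensorAug]⟩
  · exact h1 Algebra.TensorProduct.includeRight fun p r => ⟨p.2, by simp [tensorAug]⟩

lemma tensorSpan_mono {a b a' b' : R} (ha : a ∣ a') (hb : b ∣ b') :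
    tensorSpan k a' b' ≤ tensorSpan k a b := by
  refine Ideal.span_le.2 ?_
  rintro _ (rfl | rfl)
  · exact tmul_mem_tensorSpan_left (Ideal.mem_span_singleton.2 ha) _
  · exact tmul_mem_tensorSpan_right _ (Ideal.mem_span_singleton.2 hb)

/-- The points of an equivariant formal group law are separated by the Euler class. -/
theorem eq_zero_of_forall_mem
    (hu : ∀ a : k, (∃ b, a = E.euler 1 * b) → (∃ M, E.euler 1 ^ M * a = 0) → a = 0)
    {c : E.Square} (hxx : ∀ n, c ∈ Ideal.span {E.left E.x ^ n, E.right E.x ^ n})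
    (hxz : ∀ n, c ∈ Ideal.span {E.left E.x ^ n, E.right E.xα ^ n})
    (hzx : ∀ n, c ∈ Ideal.span {E.left E.xα ^ n, E.right E.x ^ n})
    (hzz : ∀ n, c ∈ Ideal.span {E.left E.xα ^ n, E.right E.xα ^ n}) : c = 0 := by
  refine AdicCompletion.ext_evalₐ fun n => ?_
  -- At this level the error made in lifting c to the tensor square already lies in the ideal of the
  -- 2n-th powers of x x_α, the exponent needed at the point (0, 0).
  set m := 4 * (n + n + (n + n)) with hm
  obtain ⟨y, hy⟩ := Ideal.Quotient.mk_surjective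
    (AdicCompletion.evalₐ (augIdeal (tensorAug E.θ E.θ)) m c)
  have key : ∀ a b, a ∣ E.x * E.xα → b ∣ E.x * E.xα →
      (∀ n, c ∈ Ideal.span {E.left a ^ n, E.right b ^ n}) →
      y ∈ tensorSpan k (a ^ (n + n)) (b ^ (n + n)) := fun a b ha hb hc => by
    have h1 := hc (n + n)
    rw [← map_pow, ← map_pow] at h1
    refine (sup_le le_rfl ?_ : Ideal.span _ ⊔ _ ≤ _) (mem_sup_of_toCompl hy h1)
    exact (E.augIdeal_tensorAug_pow_le _).trans
      (tensorSpan_mono (pow_dvd_pow_of_dvd ha _) (pow_dvd_pow_of_dvd hb _))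
  have hmono : ∀ a b : R, tensorSpan k (a ^ (n + n)) (b ^ (n + n)) ≤
      tensorSpan k (a ^ n) (b ^ n) := fun a b =>
    tensorSpan_mono (pow_dvd_pow _ (Nat.le_add_right n n)) (pow_dvd_pow _ (Nat.le_add_right n n))
  have hx := dvd_mul_right E.x E.xα
  have hz := dvd_mul_left E.xα E.x
  have h1 := E.tensorSpan_le_augIdeal_pow n (mem_tensorSpan_of_forall E.x_regular E.xα_regular
    E.ker_θ_zero E.ker_θ_one rfl E.θ_zero_xα hu (key _ _ hx hx hxx)
    (hmono _ _ (key _ _ hx hx hxx)) (hmono _ _ (key _ _ hx hz hxz))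
    (hmono _ _ (key _ _ hz hx hzx)) (hmono _ _ (key _ _ hz hz hzz)))
  rw [← factor_eval _ (show n ≤ m by omega), ← hy, Ideal.Quotient.factor_mk, map_zero]
  exact Ideal.Quotient.eq_zero_iff_mem.2 h1

/-- Separation for r ⊗ 1 in the square; r is recovered from it by 1 ⊗ θ_0. -/
lemma eq_zero_of_forall_dvd
    (hu : ∀ a : k, (∃ b, a = E.euler 1 * b) → (∃ M, E.euler 1 ^ M * a = 0) → a = 0)
    {r : R} (hx : ∀ n, E.x ^ n ∣ r) (hz : ∀ n, E.xα ^ n ∣ r) : r = 0 := by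
  have h1 : ∀ a (d : E.Square) n, a ^ n ∣ r → E.left r ∈ Ideal.span {E.left a ^ n, d} :=
    fun a d n ha => by
      obtain ⟨s, hs⟩ := map_dvd E.left ha
      rw [hs, map_pow]
      exact Ideal.mul_mem_right _ _ (Ideal.subset_span (Or.inl rfl))
  rw [← E.evalRight_left 0 r, E.eq_zero_of_forall_mem hu (c := E.left r)
    (fun n => h1 _ _ _ (hx n)) (fun n => h1 _ _ _ (hx n)) (fun n => h1 _ _ _ (hz n))
    (fun n => h1 _ _ _ (hz n)), map_zero]

end EquivariantFGL
end Points
end EqFGL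
end

noncomputable section

namespace EqFGL

/-! ### The translate x_α in an arbitrary law with the given parameters. -/

section Coordinate

variable {k R : Type*} [CommRing k] [CommRing R] [Algebra k R]

lemma pow_dvd_of_pow_dvd_mul_one_add {S : Type*} [CommRing S] {x g c : S} {n : ℕ}
    (h : x ^ n ∣ c * (1 + x * g)) : x ^ n ∣ c := by
  obtain ⟨q, hq⟩ := sub_dvd_pow_sub_pow (1 : S) (-(x * g)) n
  rw [show c = c * (1 + x * g) * q + x ^ n * (c * (-g) ^ n) by
    rw [neg_pow, mul_pow] at hq
    rw [neg_pow]
    linear_combination c * hq]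
  exact dvd_add (Dvd.dvd.mul_right h _) (dvd_mul_right _ _)

/-- Near x = 0 one has z = U+(1+U)x, so x itself solves the quadratic equation of f up to the
annihilator of U(U+2). Both roots are divisible by x, so their difference is multiplied by a factor
of the form 1+xg, which is invertible modulo x^n. -/
lemma pow_dvd_mul_sub {S : Type*} [CommRing S] {U W x z f : S} {n : ℕ}
    (h : U * (U + 2) * (1 - U * W) = 0) (hf : (W + 1) * f ^ 2 + f = W * (x * z)) (hxf : x ∣ f)
    (hz : x ^ n ∣ z - (U + (1 + U) * x)) : x ^ n ∣ U * (U + 2) * (x - f) := by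
  obtain ⟨g, rfl⟩ := hxf
  refine pow_dvd_of_pow_dvd_mul_one_add (g := (W + 1) * (1 + g)) ?_
  rw [show U * (U + 2) * (x - x * g) * (1 + x * ((W + 1) * (1 + g))) =
    (z - (U + (1 + U) * x)) * (-(U * (U + 2) * W * x)) by
      linear_combination -U * (U + 2) * hf + x * (x + 1) * h]
  exact Dvd.dvd.mul_right hz _

namespace EquivariantFGL

variable (E : EquivariantFGL k (ZMod 2) R)

lemma complAug_x_mul_xα (i : ZMod 2) :
    complAug E.θ i (toCompl E.θ E.x * toCompl E.θ E.xα) = 0 := by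
  rw [← map_mul]
  exact E.θ_x_mul_xα i

/-- The element `φ(x x_α)`. -/
def root (w : k) : R := E.ofCompl (evalSeries _ E.complAug_x_mul_xα (rootSeries w))

lemma toCompl_root (w : k) :
    toCompl E.θ (E.root w) = evalSeries _ E.complAug_x_mul_xα (rootSeries w) :=
  E.toCompl_ofCompl _

lemma root_eq (w : k) : (algebraMap k R w + 1) * E.root w ^ 2 + E.root w =
    algebraMap k R w * (E.x * E.xα) := by
  refine E.toCompl_injective ?_
  simp only [map_add, map_mul, map_pow, map_one, AlgHom.commutes, toCompl_root]
  exact evalSeries_rootSeries _ _ w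

lemma x_mul_xα_dvd_root (w : k) : E.x * E.xα ∣ E.root w := by
  obtain ⟨g, hg⟩ := PowerSeries.X_dvd_iff.2 (constantCoeff_rootSeries w)
  refine ⟨E.ofCompl (evalSeries _ E.complAug_x_mul_xα g), ?_⟩
  rw [root, hg, map_mul, evalSeries_X, map_mul, map_mul, ofCompl_toCompl, ofCompl_toCompl]

variable {u w : k}

/-- Apply 1 ⊗ θ_α to the expansion of Δx: x_α has the expansion with coefficients θ_α(B i 0), which
for i ≥ 1 are 1+u, 0, 0, …. -/
lemma pow_dvd_xα_sub (hue : E.euler 1 = u)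
    (hb : ∃ B : ℕ → ℕ → R, (∀ n : ℕ, E.Δ E.x - ∑ i ∈ Finset.range n, E.tmul (E.x ^ i) (B i 0) ∈
      Ideal.span {E.tmul (E.x ^ n) 1}) ∧
      ∀ i j, 1 ≤ i → bParam u i j = E.θ 1 (B i j)) (n : ℕ) :
    E.x ^ n ∣ E.xα - (algebraMap k R u + (1 + algebraMap k R u) * E.x) := by
  obtain ⟨B, hB, hB1⟩ := hb
  have h1 : ∀ n, E.x ^ n ∣ E.xα - ∑ i ∈ Finset.range n, E.x ^ i * algebraMap k R (E.θ 1 (B i 0)) :=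
    fun n => by
      obtain ⟨c, hc⟩ := Ideal.mem_span_singleton.1 (hB n)
      have h2 := congrArg (E.evalRight 1) hc
      simp only [map_sub, map_sum, map_mul, tmul_eq, evalRight_Δ, evalRight_left,
        evalRight_right, map_one, mul_one] at h2
      exact ⟨_, h2⟩
  -- The term i = 0 is not among the parameters; it is found from θ_0(x_α) = u.
  have h0 : E.θ 1 (B 0 0) = u := by
    obtain ⟨c, hc⟩ := h1 1
    have h2 := congrArg (E.θ 0) hc
    exact (sub_eq_zero.1 (by simpa [θ_zero_xα, θ_zero_x, hue] using h2)).symm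
  refine (pow_dvd_pow _ (show n ≤ n + 2 by omega)).trans ?_
  refine (h1 (n + 2)).trans (dvd_of_eq (congrArg (E.xα - ·) ?_))
  rw [Finset.sum_range_succ', Finset.sum_range_succ', Finset.sum_eq_zero]
  · rw [h0, ← hB1 _ _ (by simp)]
    simp [bParam]
    ring
  · intro i _
    rw [← hB1 _ _ (by simp)]
    simp [bParam]

variable (h : u * (u + 2) * (1 - u * w) = 0)
  (hx : ∀ n, E.x ^ n ∣ E.xα - (algebraMap k R u + (1 + algebraMap k R u) * E.x))

include hx in
lemma pow_dvd_x_sub (n : ℕ) :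
    E.xα ^ n ∣ E.x - (algebraMap k R u + (1 + algebraMap k R u) * E.xα) := by
  have h1 := map_dvd (E.translate 1) (hx n)
  rw [map_pow, map_sub, map_add, map_mul, map_add, map_one, AlgHom.commutes,
    translate_one_xα] at h1
  exact h1

include h in
lemma map_relation (S : Type*) [CommRing S] [Algebra k S] : algebraMap k S u *
    (algebraMap k S u + 2) * (1 - algebraMap k S u * algebraMap k S w) = 0 := by
  simpa [map_ofNat] using congrArg (algebraMap k S) h

include h hx in
lemma pow_dvd_mul_x_sub_root (n : ℕ) : E.x ^ n ∣ algebraMap k R u * (algebraMap k R u + 2) *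
    (E.x - E.root w) :=
  pow_dvd_mul_sub (map_relation h R) (E.root_eq w)
    ((dvd_mul_right _ _).trans (E.x_mul_xα_dvd_root w)) (hx n)

include h hx in
lemma pow_dvd_mul_xα_sub_root (n : ℕ) : E.xα ^ n ∣ algebraMap k R u * (algebraMap k R u + 2) *
    (E.xα - E.root w) :=
  pow_dvd_mul_sub (map_relation h R) (by rw [mul_comm E.xα]; exact E.root_eq w)
    ((dvd_mul_left _ _).trans (E.x_mul_xα_dvd_root w)) (E.pow_dvd_x_sub hx n)

include h hx in
/-- The translate of the coordinate, in terms of the coordinate and `x x_α`. -/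
lemma xα_eq (hue : E.euler 1 = u)
    (hu : ∀ a : k, (∃ b, a = u * b) → (∃ M, u ^ M * a = 0) → a = 0) :
    E.xα = algebraMap k R u + algebraMap k R (1 + u - u * (u + 2) * w) * E.x +
      algebraMap k R (u * (u + 2) * w) * E.root w := by
  have h0 := map_relation h R
  rw [← hue] at hu
  simp only [map_add, map_sub, map_mul, map_one, map_ofNat]
  -- Near x = 0 use x_α = u+(1+u)x with φ in the role of x; near x_α = 0 use the translated formula
  -- with φ in the role of x_α. Each replacement by φ is valid after multiplication by u(u+2).
  refine sub_eq_zero.1 (E.eq_zero_of_forall_dvd hu (fun n => ?_) fun n => ?_)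
  · refine (dvd_add (hx n) (Dvd.dvd.mul_left (E.pow_dvd_mul_x_sub_root h hx n)
      (algebraMap k R w))).trans (dvd_of_eq ?_)
    ring
  · refine (dvd_add (Dvd.dvd.mul_left (E.pow_dvd_x_sub hx n)
      (-(1 + algebraMap k R u - algebraMap k R u * (algebraMap k R u + 2) * algebraMap k R w)))
      (Dvd.dvd.mul_left (E.pow_dvd_mul_xα_sub_root h hx n)
      (algebraMap k R w))).trans (dvd_of_eq ?_)
    linear_combination (1 + E.xα) * h0

end EquivariantFGL
end Coordinate
end EqFGL
end

noncomputable section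

namespace EqFGL

/-! ### Identification of the coordinate rings, and polynomial congruences near the four points. -/

section Classification

variable {k R : Type*} [CommRing k] [CommRing R] [Algebra k R]

lemma map_mem_span_pair {S T F : Type*} [CommRing S] [CommRing T] [FunLike F S T]
    [RingHomClass F S T] (g : F) {a b c : S} (h : c ∈ Ideal.span {a, b}) :
    g c ∈ Ideal.span {g a, g b} := by
  obtain ⟨p, q, rfl⟩ := Ideal.mem_span_pair.1 h
  exact Ideal.mem_span_pair.2 ⟨g p, g q, by rw [map_add, map_mul, map_mul]⟩

lemma pow_mem_of_sub_mem {S : Type*} [CommRing S] {a b d p : S} {n : ℕ}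
    (h : d - (a * p + b) ∈ Ideal.span {a ^ n, b ^ n}) :
    d ^ (n + n) ∈ Ideal.span {a ^ n, b ^ n} := by
  have h1 : (a * p + b) ^ (n + n) ∈ Ideal.span {a ^ n, b ^ n} := by
    refine Ideal.add_pow_mem_of_pow_mem_of_le _ (m := n) (n := n) ?_
      (Ideal.subset_span (Or.inr rfl)) (Nat.le_succ _)
    rw [mul_pow a p]
    exact Ideal.mul_mem_right _ _ (Ideal.subset_span (Or.inl rfl))
  have h2 := Ideal.mem_of_dvd _ (sub_dvd_pow_sub_pow d (a * p + b) (n + n)) h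
  simpa using add_mem h2 h1

lemma comul_sub_mem_zero_zero {S : Type*} [CommRing S] {I : Ideal S} {U x₁ x₂ s₁ s₂ d : S}
    (hd : d - (x₁ + x₂ + x₁ * x₂) ∈ I) (hs : U * (U + 2) * s₁ ∈ I) :
    d - ((1 + x₁) * (1 + x₂) - 1 - U * (U + 2) * (s₁ * s₂)) ∈ I := by
  rw [show d - ((1 + x₁) * (1 + x₂) - 1 - U * (U + 2) * (s₁ * s₂)) =
    d - (x₁ + x₂ + x₁ * x₂) + s₂ * (U * (U + 2) * s₁) by ring]
  exact add_mem hd (Ideal.mul_mem_left _ _ hs)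

lemma comul_sub_mem_one_zero {S : Type*} [CommRing S] {I : Ideal S} {U x₁ x₂ z₁ s₁ s₂ d : S}
    (hd : d - (U + (1 + U) * (z₁ + x₂ + z₁ * x₂)) ∈ I) (hx : x₁ - (U + (1 + U) * z₁) ∈ I)
    (hs : U * (U + 2) * s₂ ∈ I) :
    d - ((1 + x₁) * (1 + x₂) - 1 - U * (U + 2) * (s₁ * s₂)) ∈ I := by
  rw [show d - ((1 + x₁) * (1 + x₂) - 1 - U * (U + 2) * (s₁ * s₂)) =
    d - (U + (1 + U) * (z₁ + x₂ + z₁ * x₂)) + (-(1 + x₂)) * (x₁ - (U + (1 + U) * z₁)) +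
      s₁ * (U * (U + 2) * s₂) by ring]
  exact add_mem (add_mem hd (Ideal.mul_mem_left _ _ hx)) (Ideal.mul_mem_left _ _ hs)

/-- At the point (α, α) the correction does not vanish; it is exactly what turns the product of two
translated coordinates back into the multiplicative law in z₁ and z₂. -/
lemma comul_sub_mem_one_one {S : Type*} [CommRing S] {I : Ideal S} {U x₁ x₂ z₁ z₂ s₁ s₂ d : S}
    (hd : d - (z₁ + z₂ + z₁ * z₂) ∈ I) (hx : x₁ - (U + (1 + U) * z₁) ∈ I)
    (hs₁ : U * (U + 2) * s₁ = U + (1 + U) * x₁ - z₁)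
    (hs₂ : U * (U + 2) * s₂ = U + (1 + U) * x₂ - z₂) :
    d - ((1 + x₁) * (1 + x₂) - 1 - U * (U + 2) * (s₁ * s₂)) ∈ I := by
  rw [show d - ((1 + x₁) * (1 + x₂) - 1 - U * (U + 2) * (s₁ * s₂)) =
    d - (z₁ + z₂ + z₁ * z₂) + ((1 + U) * s₂ - (1 + x₂)) * (x₁ - (U + (1 + U) * z₁)) by
      linear_combination s₂ * hs₁ + (1 + z₁) * hs₂]
  exact add_mem hd (Ideal.mul_mem_left _ _ hx)

namespace EquivariantFGL

variable (E : EquivariantFGL k (ZMod 2) R) {u w : k}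

variable (h : u * (u + 2) * (1 - u * w) = 0)
  (hz : E.xα = algebraMap k R u + algebraMap k R (1 + u - u * (u + 2) * w) * E.x +
      algebraMap k R (u * (u + 2) * w) * E.root w)

include hz in
lemma toCompl_xα_eq : toCompl E.θ E.xα = algebraMap k _ u +
    algebraMap k _ (1 + u - u * (u + 2) * w) * toCompl E.θ E.x +
      algebraMap k _ (u * (u + 2) * w) *
        evalSeries _ E.complAug_x_mul_xα (rootSeries w) := by
  have h1 := congrArg (toCompl E.θ) hz
  simp only [map_add (toCompl E.θ), map_mul (toCompl E.θ), AlgHom.commutes, toCompl_root] at h1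
  exact h1

/-- The classifying homomorphism of an equivariant formal group law. -/
def ofCoord : CoordRing u w →ₐ[k] R :=
  E.ofCompl.comp (CoordRing.liftCompl h (toCompl E.θ E.x) (toCompl E.θ E.xα) E.complAug_x_mul_xα
    (E.toCompl_xα_eq hz))

lemma ofCoord_x : E.ofCoord h hz (CoordRing.x u w) = E.x :=
  (congrArg E.ofCompl (CoordRing.liftCompl_x h _ _ _ (E.toCompl_xα_eq hz))).trans (E.ofCompl_toCompl _)

lemma ofCoord_z : E.ofCoord h hz (CoordRing.z u w) = E.xα :=
  (congrArg E.ofCompl (CoordRing.liftCompl_z h _ _ _ (E.toCompl_xα_eq hz))).trans (E.ofCompl_toCompl _)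

lemma ofCoord_t : E.ofCoord h hz (CoordRing.t u w) = E.x * E.xα := by
  rw [← CoordRing.x_mul_z h, map_mul (E.ofCoord h hz), ofCoord_x, ofCoord_z]

lemma θ_ofCoord (hue : E.euler 1 = u) (γ : ZMod 2) (r : CoordRing u w) :
    E.θ γ (E.ofCoord h hz r) = CoordRing.θ u w γ r := by
  obtain ⟨r', hr⟩ := CoordRing.exists_eq_add_t_mul r
  have h1 : E.θ γ E.x = CoordRing.θ u w γ (CoordRing.x u w) := by
    rcases zmod_two_cases γ with rfl | rfl
    · rw [θ_zero_x, CoordRing.θ_zero_x]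
    · rw [CoordRing.θ_one_x]
      exact hue
  rw [hr, map_add (E.ofCoord h hz), map_mul (E.ofCoord h hz), ofCoord_t, map_add (E.θ γ),
    map_mul (E.θ γ), θ_x_mul_xα, zero_mul, map_add (CoordRing.θ u w γ),
    map_mul (CoordRing.θ u w γ), CoordRing.θ_t, zero_mul, map_add (E.ofCoord h hz),
    map_mul (E.ofCoord h hz), ofCoord_x, map_add (E.θ γ), map_mul (E.θ γ), h1,
    map_add (CoordRing.θ u w γ), map_mul (CoordRing.θ u w γ)]
  simp only [AlgHom.commutes]

/-- If a + bx + t r' goes to zero, θ_0 gives a = 0; cancelling x and applying θ_α gives b = 0;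
cancelling x_α shows that r' goes to zero. Hence the kernel lies in every (t^n). -/
lemma ofCoord_injective : Function.Injective (E.ofCoord h hz) := by
  have key : ∀ n r, E.ofCoord h hz r = 0 → r ∈ Ideal.span {CoordRing.t u w ^ n} := by
    intro n
    induction n with
    | zero => simp
    | succ n ih =>
      intro r hr
      obtain ⟨r', hr'⟩ := CoordRing.exists_eq_add_t_mul r
      generalize PowerSeries.constantCoeff r.re = a at hr'
      generalize PowerSeries.constantCoeff r.im = b at hr'
      subst hr'
      rw [map_add (E.ofCoord h hz), map_add (E.ofCoord h hz), map_mul (E.ofCoord h hz),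
        map_mul (E.ofCoord h hz), ofCoord_t, ofCoord_x, AlgHom.commutes, AlgHom.commutes] at hr
      have h0 : a = 0 := by
        have h1 := congrArg (E.θ 0) hr
        simpa [θ_zero_x] using h1
      have hr2 : E.x * (algebraMap k R b + E.xα * E.ofCoord h hz r') = 0 := by
        rw [h0, map_zero] at hr
        linear_combination hr
      have h1 := (mul_left_mem_nonZeroDivisors_eq_zero_iff E.x_regular).1 hr2
      have h2 : b = 0 := by
        have h1 := congrArg (E.θ 1) h1
        simpa [θ_one_xα] using h1
      rw [h2, map_zero, zero_add] at h1
      have h3 := ih r' ((mul_left_mem_nonZeroDivisors_eq_zero_iff E.xα_regular).1 h1)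
      rw [h0, h2, map_zero, zero_mul, zero_add, zero_add, Ideal.mem_span_singleton, pow_succ']
      exact mul_dvd_mul_left _ (Ideal.mem_span_singleton.1 h3)
  refine (injective_iff_map_eq_zero _).2 fun r hr => ?_
  have h1 := fun n => CoordRing.mem_span_t_pow.1 (key n r hr)
  ext n
  · exact PowerSeries.X_pow_dvd_iff.1 (h1 (n + 1)).1 n (Nat.lt_succ_self n)
  · exact PowerSeries.X_pow_dvd_iff.1 (h1 (n + 1)).2 n (Nat.lt_succ_self n)

lemma coordRing_mk_eq (a b : ℕ → k) (i : ℕ) :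
    (⟨PowerSeries.mk fun p => a (p + i), PowerSeries.mk fun p => b (p + i)⟩ : CoordRing u w) =
    algebraMap k _ (a i) + algebraMap k _ (b i) * CoordRing.x u w + CoordRing.t u w *
      ⟨PowerSeries.mk fun p => a (p + (i + 1)), PowerSeries.mk fun p => b (p + (i + 1))⟩ := by
  have key : ∀ a : ℕ → k, PowerSeries.mk (fun p => a (p + i)) =
      PowerSeries.C (a i) + PowerSeries.X * PowerSeries.mk fun p => a (p + (i + 1)) := fun a => by
    ext n
    rcases n with _ | n
    · simp
    · simp [PowerSeries.coeff_succ_X_mul, add_assoc, add_comm 1]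
  rw [← CoordRing.ofSeries_C, ← CoordRing.ofSeries_C, CoordRing.t_mul, key a, key b]
  ext1 <;> simp [CoordRing.ofSeries_apply, CoordRing.x]

lemma ofCoord_surjective : Function.Surjective (E.ofCoord h hz) := by
  obtain ⟨D₀, hD₀⟩ := exists_div E.x_regular E.ker_θ_zero
  obtain ⟨D₁, hD₁⟩ := exists_div E.xα_regular E.ker_θ_one
  intro r
  -- Alternate division of r by x and x_α produces the coefficients of the power series a and b,
  -- with r = Σ (a_i + b_i x)(x x_α)^i.
  let q : ℕ → R := fun n => Nat.rec r (fun _ s => D₁ (D₀ s)) n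
  let a : ℕ → k := fun n => E.θ 0 (q n)
  let b : ℕ → k := fun n => E.θ 1 (D₀ (q n))
  have hq : ∀ i, q i = algebraMap k R (a i) + algebraMap k R (b i) * E.x +
      E.x * E.xα * q (i + 1) := fun i => by
    linear_combination hD₀ (q i) + E.x * hD₁ (D₀ (q i))
  let s : ℕ → CoordRing u w := fun i =>
    ⟨PowerSeries.mk fun p => a (p + i), PowerSeries.mk fun p => b (p + i)⟩
  have hs : ∀ i, E.ofCoord h hz (s i) = algebraMap k R (a i) + algebraMap k R (b i) * E.x +
      E.x * E.xα * E.ofCoord h hz (s (i + 1)) := fun i => by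
    conv_lhs => rw [show s i = _ from coordRing_mk_eq a b i]
    rw [map_add (E.ofCoord h hz), map_add (E.ofCoord h hz), map_mul (E.ofCoord h hz),
      map_mul (E.ofCoord h hz), ofCoord_t, ofCoord_x, AlgHom.commutes, AlgHom.commutes]
  have key : ∀ n i, E.ofCoord h hz (s i) - q i ∈ Ideal.span {(E.x * E.xα) ^ n} := by
    intro n
    induction n with
    | zero => simp
    | succ n ih =>
      intro i
      rw [hs, hq, Ideal.mem_span_singleton, pow_succ', add_sub_add_left_eq_sub, ← mul_sub]
      exact mul_dvd_mul_left _ (Ideal.mem_span_singleton.1 (ih (i + 1)))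
  have := E.complete
  refine ⟨s 0, sub_eq_zero.1 (IsHausdorff.haus (I := augIdeal E.θ) inferInstance _ fun n => ?_)⟩
  rw [SModEq.zero, smul_eq_mul, Ideal.mul_top]
  exact (Ideal.span_singleton_le_iff_mem _).2
    (Ideal.pow_mem_pow (mem_augIdeal.2 E.θ_x_mul_xα) n) (key n 0)

end EquivariantFGL
end Classification
end EqFGL
end

noncomputable section

namespace EqFGL

/-! ### The coproduct of an arbitrary law with the given parameters. -/

section Classification

variable {k R : Type*} [CommRing k] [CommRing R] [Algebra k R]

namespace EquivariantFGL

variable (E : EquivariantFGL k (ZMod 2) R) {u w : k}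

section Congruences

variable (hF : ∀ n, E.Δ E.x - (E.left E.x + E.right E.x + E.left E.x * E.right E.x) ∈
  Ideal.span {E.left E.x ^ n, E.right E.x ^ n})

include hF in
lemma Δ_xα_sub_mem (n : ℕ) : E.Δ E.xα -
    (E.left E.xα + E.right E.x + E.left E.xα * E.right E.x) ∈
      Ideal.span {E.left E.xα ^ n, E.right E.x ^ n} := by
  have h1 := map_mem_span_pair (E.translateLeft 1) (hF n)
  simp only [map_sub, map_add, map_mul, map_pow, translateLeft_left, translateLeft_right,
    translateLeft_Δ] at h1
  exact h1

include hF in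
-- Translate the congruence at (0, 0) by α in both factors; this leaves Δx unchanged, as α+α = 0.
lemma Δ_x_sub_mem_one_one (n : ℕ) : E.Δ E.x -
    (E.left E.xα + E.right E.xα + E.left E.xα * E.right E.xα) ∈
      Ideal.span {E.left E.xα ^ n, E.right E.xα ^ n} := by
  have h1 := map_mem_span_pair (E.translateLeft 1)
    (map_mem_span_pair E.swap (E.Δ_xα_sub_mem hF n))
  simp only [map_sub, map_add, map_mul, map_pow, translateLeft_left, translateLeft_right,
    translateLeft_Δ, swap_left, swap_right, swap_Δ, translate_one_xα] at h1
  change E.Δ E.x - (E.right E.xα + E.left E.xα + E.right E.xα * E.left E.xα) ∈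
      Ideal.span {E.right E.xα ^ n, E.left E.xα ^ n} at h1
  rwa [Set.pair_comm, add_comm (E.right E.xα), mul_comm (E.right E.xα)] at h1

variable (hx : ∀ n, E.x ^ n ∣ E.xα - (algebraMap k R u + (1 + algebraMap k R u) * E.x))

include hF hx in
lemma Δ_x_sub_mem_one_zero (n : ℕ) : E.Δ E.x - (algebraMap k _ u + (1 + algebraMap k _ u) *
    (E.left E.xα + E.right E.x + E.left E.xα * E.right E.x)) ∈
      Ideal.span {E.left E.xα ^ n, E.right E.x ^ n} := by
  have h1 := E.Δ_xα_sub_mem hF n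
  -- Take the coproduct of the congruence between x and u+(1+u)x_α. By the congruence for Δx_α, its
  -- 2n-th power falls into the ideal, which accounts for the doubled exponent.
  obtain ⟨c, hc⟩ := E.pow_dvd_x_sub hx (n + n)
  have h2 := congrArg E.Δ hc
  simp only [map_sub, map_add, map_mul, map_pow, map_one, AlgHom.commutes] at h2
  have h3 : E.Δ E.xα ^ (n + n) ∈ Ideal.span {E.left E.xα ^ n, E.right E.x ^ n} :=
    pow_mem_of_sub_mem (p := 1 + E.right E.x) (by
      rw [show E.left E.xα * (1 + E.right E.x) + E.right E.x =
        E.left E.xα + E.right E.x + E.left E.xα * E.right E.x by ring]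
      exact h1)
  rw [show E.Δ E.x - (algebraMap k _ u + (1 + algebraMap k _ u) *
    (E.left E.xα + E.right E.x + E.left E.xα * E.right E.x)) = E.Δ E.xα ^ (n + n) * E.Δ c +
      (1 + algebraMap k _ u) * (E.Δ E.xα -
        (E.left E.xα + E.right E.x + E.left E.xα * E.right E.x)) by
      linear_combination h2]
  exact add_mem (Ideal.mul_mem_right _ _ h3) (Ideal.mul_mem_left _ _ h1)

variable {s : R} (hs : algebraMap k R u * (algebraMap k R u + 2) * s =
  algebraMap k R u + (1 + algebraMap k R u) * E.x - E.xα)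

include hF hx hs in
/-- The coproduct of the coordinate. -/
lemma Δ_x_eq (hu : ∀ a : k, (∃ b, a = E.euler 1 * b) → (∃ M, E.euler 1 ^ M * a = 0) → a = 0) :
    E.Δ E.x = (1 + E.left E.x) * (1 + E.right E.x) - 1 -
      algebraMap k _ u * (algebraMap k _ u + 2) * (E.left s * E.right s) := by
  have hs' : ∀ g : R →ₐ[k] E.Square, algebraMap k _ u * (algebraMap k _ u + 2) * g s =
      algebraMap k _ u + (1 + algebraMap k _ u) * g E.x - g E.xα := fun g => by
    have h1 := congrArg g hs
    simp only [map_sub, map_add, map_mul, map_ofNat, map_one, AlgHom.commutes] at h1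
    exact h1
  have hsn : ∀ (g : R →ₐ[k] E.Square) (n : ℕ), g E.x ^ n ∣
      algebraMap k _ u * (algebraMap k _ u + 2) * g s := fun g n => by
    rw [hs', ← map_pow]
    have h1 := map_dvd g (hx n)
    rw [← dvd_neg] at h1
    simpa using h1
  have hxn : ∀ (g : R →ₐ[k] E.Square) (n : ℕ), g E.xα ^ n ∣
      g E.x - (algebraMap k _ u + (1 + algebraMap k _ u) * g E.xα) := fun g n => by
    rw [← map_pow]
    simpa using map_dvd g (E.pow_dvd_x_sub hx n)
  have hl : ∀ {a b c : E.Square}, a ∣ c → c ∈ Ideal.span {a, b} := fun h =>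
    Ideal.mem_of_dvd _ h (Ideal.subset_span (Or.inl rfl))
  have hr : ∀ {a b c : E.Square}, b ∣ c → c ∈ Ideal.span {a, b} := fun h =>
    Ideal.mem_of_dvd _ h (Ideal.subset_span (Or.inr rfl))
  have h10 : ∀ n, E.Δ E.x - ((1 + E.left E.x) * (1 + E.right E.x) - 1 -
      algebraMap k _ u * (algebraMap k _ u + 2) * (E.left s * E.right s)) ∈
        Ideal.span {E.left E.xα ^ n, E.right E.x ^ n} := fun n =>
    comul_sub_mem_one_zero (E.Δ_x_sub_mem_one_zero hF hx n) (hl (hxn _ n)) (hr (hsn _ n))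
  -- Check the four points separately; (0, α) follows from (α, 0) by cocommutativity.
  refine sub_eq_zero.1 (E.eq_zero_of_forall_mem hu (fun n => ?_) (fun n => ?_) h10 fun n => ?_)
  · exact comul_sub_mem_zero_zero (hF n) (hl (hsn _ n))
  · have h1 := map_mem_span_pair E.swap (h10 n)
    simp only [map_sub, map_add, map_mul, map_pow, swap_left, swap_right, swap_Δ, map_one,
      map_ofNat, AlgHom.commutes] at h1
    rw [Set.pair_comm] at h1
    refine (congrArg (· ∈ Ideal.span {E.left E.x ^ n, E.right E.xα ^ n}) ?_).mp h1
    ring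
  · exact comul_sub_mem_one_one (E.Δ_x_sub_mem_one_one hF n) (hl (hxn _ n)) (hs' _) (hs' _)

end Congruences

lemma comul_translate_aux {S : Type*} [CommRing S] {U x₁ x₂ z₁ s₁ s₂ s₁' : S}
    (hs : U * (U + 2) * s₁ = U + (1 + U) * x₁ - z₁)
    (hs' : U * (U + 2) * s₁' = U + (1 + U) * z₁ - x₁) :
    (1 + U) * ((1 + x₁) * (1 + x₂)) - U * (U + 2) * ((1 + x₁) * s₂ + s₁ * (1 + x₂)) +
      U * (U + 2) * (1 + U) * (s₁ * s₂) - 1 =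
    (1 + z₁) * (1 + x₂) - 1 - U * (U + 2) * (s₁' * s₂) := by
  linear_combination (-(1 + x₂) + (1 + U) * s₂) * hs + s₂ * hs'

/-- Translate the formula for Δx in the first factor: the translate of s satisfies the relation of s
with x and x_α exchanged. -/
lemma Δ_xα_eq {s : R} (hs : algebraMap k R u * (algebraMap k R u + 2) * s =
      algebraMap k R u + (1 + algebraMap k R u) * E.x - E.xα)
    (hΔ : E.Δ E.x = (1 + E.left E.x) * (1 + E.right E.x) - 1 -
      algebraMap k _ u * (algebraMap k _ u + 2) * (E.left s * E.right s)) :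
    (1 + algebraMap k _ u) * ((1 + E.left E.x) * (1 + E.right E.x)) -
      algebraMap k _ u * (algebraMap k _ u + 2) *
        ((1 + E.left E.x) * E.right s + E.left s * (1 + E.right E.x)) +
      algebraMap k _ u * (algebraMap k _ u + 2) * (1 + algebraMap k _ u) *
        (E.left s * E.right s) - 1 = E.Δ E.xα := by
  have h1 := congrArg (E.translateLeft 1) hΔ
  simp only [map_sub, map_add, map_mul, translateLeft_left, translateLeft_right,
    translateLeft_Δ, map_one, map_ofNat, AlgHom.commutes] at h1
  refine Eq.trans ?_ h1.symm
  have h2 := congrArg E.left hs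
  have h3 := congrArg (fun r => E.left (E.translate 1 r)) hs
  simp only [map_sub, map_add, map_mul, map_one, map_ofNat, AlgHom.commutes,
    translate_one_xα] at h2 h3
  exact comul_translate_aux h2 h3

variable (h : u * (u + 2) * (1 - u * w) = 0)

/-- An equivariant formal group law with multiplicative parameters is isomorphic to the
standard one. -/
theorem nonempty_iso {q : ℕ → k}
    (hu : ∀ a : k, (∃ b, a = u * b) → (∃ M, u ^ M * a = 0) → a = 0)
    (hE : HasParameters E FormalGroup.𝔾ₘ u q (bParam u)) :
    Nonempty ((CoordRing.fgl h).Iso E) := by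
  have hue := hE.euler
  have hF := (E.hasUnderlying_multiplicative_iff).1 hE.underlying
  obtain ⟨B, hB, -, hB1⟩ := hE.b_eq
  have hx := E.pow_dvd_xα_sub hue ⟨B, hB, hB1⟩
  have hz := E.xα_eq h hx hue hu
  -- The image of σ supplies the element s required by the formula for the coproduct.
  have hs : algebraMap k R u * (algebraMap k R u + 2) *
      E.ofCoord h hz (CoordRing.σ u w) = _ := CoordRing.map_mul_σ (E.ofCoord h hz)
  rw [ofCoord_x, ofCoord_z] at hs
  have hΔ := E.Δ_x_eq hF hx hs (by rw [hue]; exact hu)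
  have hΔz := E.Δ_xα_eq hs hΔ
  let φ : AugHom (CoordRing.θ u w) E.θ := AugHom.ofAlgHom (E.ofCoord h hz) (fun γ => γ)
    (E.θ_ofCoord h hz hue)
  have hl : ∀ r, ((AugHom.inl E.θ E.θ).comp φ).toAlgHom r = E.left (E.ofCoord h hz r) :=
    fun r => AugHom.extend_toCompl _ _
  have hr : ∀ r, ((AugHom.inr E.θ E.θ).comp φ).toAlgHom r = E.right (E.ofCoord h hz r) :=
    fun r => AugHom.extend_toCompl _ _
  refine ⟨⟨AlgEquiv.ofBijective (E.ofCoord h hz)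
    ⟨E.ofCoord_injective h hz, E.ofCoord_surjective h hz⟩, E.ofCoord_x h hz,
    E.θ_ofCoord h hz hue, fun r => ?_⟩⟩
  refine (CoordRing.extend_comul_ext h (g := E.Δ.comp (E.ofCoord h hz))
    (f := ((AugHom.inl E.θ E.θ).comp φ).pair ((AugHom.inr E.θ E.θ).comp φ)) ?_ ?_ r).symm
  · rw [CoordRing.pair_extend_comulX, hl, hl, hr, hr, AlgHom.comp_apply, ofCoord_x, hΔ]
  · rw [CoordRing.pair_extend_comulZ, hl, hl, hr, hr, AlgHom.comp_apply, ofCoord_x, ofCoord_z,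
      hΔz]

end EquivariantFGL
end Classification
end EqFGL
end

noncomputable section

namespace EqFGL

/-! ### The ring `A` -/

section Idempotents

lemma connectedSpace_primeSpectrum {R : Type*} [CommRing R] [Nontrivial R]
    (h : ∀ e : R, IsIdempotentElem e → e = 0 ∨ e = 1) : ConnectedSpace (PrimeSpectrum R) := by
  have : PreconnectedSpace (PrimeSpectrum R) := by
    refine preconnectedSpace_iff_clopen.2 fun s hs => ?_
    obtain ⟨e, he, rfl⟩ := PrimeSpectrum.isClopen_iff.1 hs
    rcases h e he with rfl | rfl <;> simp
  exact ⟨inferInstance⟩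

/-- On a domain an idempotent is constant, 0 or 1, and its value at a single point of that component
decides which. -/
lemma map_idempotent_eq_zero {R T F : Type*} [CommRing R] [CommRing T] [CommRing F] [IsDomain T]
    [Nontrivial F] {e : R} (he : IsIdempotentElem e) (g : R →+* T) (p : R →+* F) (q : T →+* F)
    (hq : q.comp g = p) (hp : p e = 0) : g e = 0 := by
  rcases IsIdempotentElem.iff_eq_zero_or_one.1 (he.map g) with h | h
  · exact h
  · rw [← hq, RingHom.comp_apply, h, map_one] at hp
    exact absurd hp one_ne_zero

/-- The quotient map modulo f factors through g, so ker g ⊆ (f); this is how T is recognised as the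
ring of the locus f = 0. -/
lemma mem_span_of_map_eq_zero {R T : Type*} [CommRing R] [CommRing T] {f e : R} (g : R →+* T)
    (ψ : T →+* R ⧸ Ideal.span {f}) (h : ψ.comp g = Ideal.Quotient.mk _) (he : g e = 0) :
    f ∣ e := by
  rw [← Ideal.mem_span_singleton, ← Ideal.Quotient.eq_zero_iff_mem, ← h, RingHom.comp_apply, he,
    map_zero]

end Idempotents

section RingA

lemma A_relation : u * (u + 2) * (1 - u * w) = 0 := by
  rw [u, w, ← map_mul, ← map_one (Ideal.Quotient.mk _), ← map_sub, ← map_ofNat (Ideal.Quotient.mk _),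
    ← map_add, ← map_mul, ← map_mul]
  exact Ideal.Quotient.eq_zero_iff_mem.2 (Ideal.mem_span_singleton_self _)

variable {T : Type*} [CommRing T]

/-- The homomorphism from `A` with given values on the generators. -/
def evalA (a b : T) (h : a * (a + 2) * (1 - a * b) = 0) : A →+* T :=
  Ideal.Quotient.lift _ (MvPolynomial.eval₂Hom (Int.castRingHom T) ![a, b]) fun p hp => by
    obtain ⟨q, rfl⟩ := Ideal.mem_span_singleton.1 hp
    rw [map_mul]
    simp [h]

lemma evalA_u {a b : T} (h : a * (a + 2) * (1 - a * b) = 0) : evalA a b h u = a := by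
  rw [evalA, u, Ideal.Quotient.lift_mk]
  simp

lemma evalA_w {a b : T} (h : a * (a + 2) * (1 - a * b) = 0) : evalA a b h w = b := by
  rw [evalA, w, Ideal.Quotient.lift_mk]
  simp

lemma A_hom_ext {f g : A →+* T} (hu : f u = g u) (hw : f w = g w) : f = g := by
  refine Ideal.Quotient.ringHom_ext (MvPolynomial.ringHom_ext' (RingHom.ext_int _ _) fun i => ?_)
  fin_cases i
  · exact hu
  · exact hw

/-- The restriction to the component `u = 0`. -/
def resZero : A →+* Polynomial ℤ := evalA 0 Polynomial.X (by ring)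

/-- The restriction to the component `u = -2`. -/
def resNegTwo : A →+* Polynomial ℤ := evalA (-2) Polynomial.X (by ring)

/-- The restriction to the component `u w = 1`. -/
def resInv : A →+* LaurentPolynomial ℤ :=
  evalA (LaurentPolynomial.T 1) (LaurentPolynomial.T (-1)) (by
    rw [← LaurentPolynomial.T_add, add_neg_cancel, LaurentPolynomial.T_zero, sub_self, mul_zero])

lemma A_nontrivial : Nontrivial A :=
  (evalA (0 : ℤ) 0 (by norm_num)).domain_nontrivial

lemma A_mul_sq_ne_zero : u * (u + 2) * w ^ 2 ≠ 0 := fun h => by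
  have h1 := congrArg (evalA (1 : ℤ) 1 (by norm_num)) h
  simp only [map_mul, map_add, map_pow, map_ofNat, evalA_u, evalA_w, map_zero] at h1
  norm_num at h1

/-- The defining polynomial is u times a polynomial prime to u, as its cofactor has value 2 at the
origin. Once one factor u has been absorbed, further powers of the prime u cancel. -/
lemma A_eq_zero_of_torsion (a : A) (ha : ∃ b, a = u * b) (hM : ∃ M, u ^ M * a = 0) : a = 0 := by
  obtain ⟨b, rfl⟩ := ha
  obtain ⟨M, hM⟩ := hM
  obtain ⟨B, rfl⟩ := Ideal.Quotient.mk_surjective b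
  rw [u, ← map_mul, ← map_pow, ← map_mul, Ideal.Quotient.eq_zero_iff_mem,
    Ideal.mem_span_singleton] at hM
  rw [u, ← map_mul, Ideal.Quotient.eq_zero_iff_mem, Ideal.mem_span_singleton]
  have h0 : (MvPolynomial.X 0 : MvPolynomial (Fin 2) ℤ) ≠ 0 := MvPolynomial.X_ne_zero 0
  rw [mul_left_comm, mul_assoc] at hM
  have hM := (mul_dvd_mul_iff_left h0).1 hM
  rw [mul_assoc]
  refine mul_dvd_mul_left _ ?_
  obtain ⟨C, hC⟩ := hM
  have h1 : ¬ (MvPolynomial.X 0 : MvPolynomial (Fin 2) ℤ) ∣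
      (MvPolynomial.X 0 + 2) * (1 - MvPolynomial.X 0 * MvPolynomial.X 1) := fun h => by
    have h2 := map_dvd (MvPolynomial.eval ![(0 : ℤ), 0]) h
    simp at h2
  obtain ⟨D, rfl⟩ := (MvPolynomial.X_prime (R := ℤ) (i := (0 : Fin 2))).pow_dvd_of_dvd_mul_left M h1
    (Dvd.intro _ hC)
  rw [mul_left_comm] at hC
  exact ⟨D, mul_left_cancel₀ (pow_ne_zero M h0) hC⟩

lemma A_u_dvd {e : A} (he : resZero e = 0) : u ∣ e := by
  refine mem_span_of_map_eq_zero _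
    (Polynomial.eval₂RingHom (Int.castRingHom _) (Ideal.Quotient.mk _ w)) (A_hom_ext ?_ ?_) he
  · rw [RingHom.comp_apply, resZero, evalA_u, map_zero, eq_comm, Ideal.Quotient.eq_zero_iff_mem]
    exact Ideal.mem_span_singleton_self _
  · simp [resZero, evalA_w]

lemma A_u_add_two_dvd {e : A} (he : resNegTwo e = 0) :
    u + 2 ∣ e := by
  refine mem_span_of_map_eq_zero _
    (Polynomial.eval₂RingHom (Int.castRingHom _) (Ideal.Quotient.mk _ w)) (A_hom_ext ?_ ?_) he
  · rw [RingHom.comp_apply, resNegTwo, evalA_u, map_neg, map_ofNat, eq_comm, eq_neg_iff_add_eq_zero,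
      ← map_ofNat (Ideal.Quotient.mk (Ideal.span {u + 2})), ← map_add,
      Ideal.Quotient.eq_zero_iff_mem]
    exact Ideal.mem_span_singleton_self _
  · simp [resNegTwo, evalA_w]

lemma A_one_sub_dvd {e : A} (he : resInv e = 0) :
    1 - u * w ∣ e := by
  have h1 : Ideal.Quotient.mk (Ideal.span {1 - u * w}) u * Ideal.Quotient.mk _ w = 1 := by
    rw [eq_comm, ← sub_eq_zero, ← map_mul, ← map_one (Ideal.Quotient.mk (Ideal.span {1 - u * w})),
      ← map_sub, Ideal.Quotient.eq_zero_iff_mem]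
    exact Ideal.mem_span_singleton_self _
  refine mem_span_of_map_eq_zero _ (LaurentPolynomial.eval₂ (Int.castRingHom _)
    (Units.mkOfMulEqOne _ _ h1)) (A_hom_ext ?_ ?_) he
  · rw [RingHom.comp_apply, resInv, evalA_u, LaurentPolynomial.eval₂_T]
    simp
  · rw [RingHom.comp_apply, resInv, evalA_w, LaurentPolynomial.eval₂_T]
    simp only [zpow_neg, zpow_one]
    rfl

lemma A_idempotent_eq_zero {e : A} (he : IsIdempotentElem e)
    (h0 : resZero e = 0) : e = 0 := by
  -- The loci u = 0 and u = -2 meet modulo 2, here at w = 0.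
  have h1 : resNegTwo e = 0 := by
    refine map_idempotent_eq_zero he _
      ((Polynomial.eval₂RingHom (Int.castRingHom (ZMod 2)) 0).comp resZero)
      (Polynomial.eval₂RingHom (Int.castRingHom (ZMod 2)) 0)
      (A_hom_ext ?_ ?_)
      (by rw [RingHom.comp_apply, h0, map_zero])
    · rw [RingHom.comp_apply, RingHom.comp_apply, resZero, resNegTwo, evalA_u, evalA_u, map_neg,
        map_ofNat, map_zero]
      decide
    · rw [RingHom.comp_apply, RingHom.comp_apply, resZero, resNegTwo, evalA_w, evalA_w]
  -- The loci u = -2 and uw = 1 meet modulo 3, at u = w = 1.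
  have h2 : resInv e = 0 := by
    refine map_idempotent_eq_zero he _
      ((Polynomial.eval₂RingHom (Int.castRingHom (ZMod 3)) 1).comp
        resNegTwo)
      (LaurentPolynomial.eval₂ (Int.castRingHom (ZMod 3)) 1)
      (A_hom_ext ?_ ?_)
      (by rw [RingHom.comp_apply, h1, map_zero])
    · rw [RingHom.comp_apply, RingHom.comp_apply, resInv, resNegTwo, evalA_u, evalA_u,
        LaurentPolynomial.eval₂_T,        map_neg, map_ofNat, one_zpow]
      decide
    · rw [RingHom.comp_apply, RingHom.comp_apply, resInv, resNegTwo, evalA_w, evalA_w,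
        LaurentPolynomial.eval₂_T,        one_zpow]
      simp
  obtain ⟨a, ha⟩ := A_u_dvd h0
  obtain ⟨b, hb⟩ := A_u_add_two_dvd h1
  obtain ⟨c, hc⟩ := A_one_sub_dvd h2
  -- Divisibility by the three factors separately does not give divisibility by their product in A,
  -- but it does for the cube, which equals e.
  calc e = e * e * e := by rw [he, he]
    _ = u * a * ((u + 2) * b) * ((1 - u * w) * c) := by rw [← ha, ← hb, ← hc]
    _ = 0 := by linear_combination a * b * c * A_relation

lemma A_connectedSpace : ConnectedSpace (PrimeSpectrum A) := by
  have := A_nontrivial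
  refine connectedSpace_primeSpectrum fun e he => ?_
  rcases IsIdempotentElem.iff_eq_zero_or_one.1
    (he.map resZero) with h | h
  · exact Or.inl (A_idempotent_eq_zero he h)
  · exact Or.inr (sub_eq_zero.1 (A_idempotent_eq_zero he.one_sub
      (by rw [map_sub, map_one, h, sub_self]))).symm

end RingA
end EqFGL
end

/-! ### The theorem over A. -/

theorem mainTheorem5 :
    IsNoetherianRing EqFGL.A ∧
    ConnectedSpace (PrimeSpectrum EqFGL.A) ∧
    -- the assignment on generators determines a solution `(q, b)` of the relations
    ∃ (q : ℕ → EqFGL.A) (b : ℕ → ℕ → EqFGL.A),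
      (∀ k, 3 ≤ k → q k = -(EqFGL.u * (EqFGL.u + 2)) * EqFGL.w ^ k) ∧
      b 1 1 = 1 ∧
      (∀ i j, 1 ≤ i → (1 < i ∨ 1 < j) → b i j = 0) ∧
      EqFGL.IsParameterSystem FormalGroup.𝔾ₘ EqFGL.u q b ∧
      (∀ (q' : ℕ → EqFGL.A) (b' : ℕ → ℕ → EqFGL.A),
        (∀ k, 3 ≤ k → q' k = -(EqFGL.u * (EqFGL.u + 2)) * EqFGL.w ^ k) →
        b' 1 1 = 1 →
        (∀ i j, 1 ≤ i → (1 < i ∨ 1 < j) → b' i j = 0) →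
        EqFGL.IsParameterSystem FormalGroup.𝔾ₘ EqFGL.u q' b' →
        q' = q ∧ ∀ i j, 1 ≤ i → b' i j = b i j) ∧
      -- these parameters define an equivariant formal group law `E`, unique up to isomorphism
      ∃ (R : Type) (_ : CommRing R) (_ : Algebra EqFGL.A R)
        (E : EqFGL.EquivariantFGL EqFGL.A (ZMod 2) R),
        EqFGL.HasParameters E FormalGroup.𝔾ₘ EqFGL.u q b ∧
        (∀ (R' : Type) (_ : CommRing R') (_ : Algebra EqFGL.A R')
          (E' : EqFGL.EquivariantFGL EqFGL.A (ZMod 2) R'),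
          EqFGL.HasParameters E' FormalGroup.𝔾ₘ EqFGL.u q b → Nonempty (E.Iso E')) ∧
        E.HasUnderlying FormalGroup.𝔾ₘ ∧
        ¬ E.IsMultiplicative ∧
        -- the coproduct: `φ` is the power series `φ(t, w⁻¹)`, integral in `t` and `w`, and `e` is
        -- an element of `R` lifting the idempotent `ι₁` of `R / (1 - u w)`
        ∃ (φ : PowerSeries (Polynomial ℤ)) (s ρ e : R),
          PowerSeries.constantCoeff φ = 0 ∧
          PowerSeries.C (Polynomial.X + 1) * φ ^ 2 + φ =
            PowerSeries.C Polynomial.X * PowerSeries.X ∧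
          E.HasValue (φ.map (Polynomial.aeval EqFGL.w : Polynomial ℤ →ₐ[ℤ] EqFGL.A).toRingHom)
            (E.x * E.translate 1 E.x) s ∧
          ρ = EqFGL.w • (E.x - s) ∧
          e * e - e ∈ Ideal.span {algebraMap EqFGL.A R (1 - EqFGL.u * EqFGL.w)} ∧
          E.θ 0 e ∈ Ideal.span {1 - EqFGL.u * EqFGL.w} ∧
          E.θ 1 e - 1 ∈ Ideal.span {1 - EqFGL.u * EqFGL.w} ∧
          E.Δ E.x = E.tmul E.x E.x + E.tmul 1 E.x + E.tmul E.x 1 -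
            (EqFGL.u * (EqFGL.u + 2)) •
              E.tmul (e * ρ) (e * ρ) := by
  refine ⟨inferInstance, EqFGL.A_connectedSpace, EqFGL.qParam EqFGL.u EqFGL.w,
    EqFGL.bParam EqFGL.u, fun j hj => EqFGL.qParam_of_le hj, rfl, fun i j hi hij => ?_,
    EqFGL.isParameterSystem EqFGL.A_relation, fun q' b' hq hb₁ hb hs => ?_, ?_⟩
  · rcases hij with hij | hij
    · rw [EqFGL.bParam, if_neg (by omega)]
    · rw [EqFGL.bParam, if_neg (by omega : ¬ j = 0), if_neg (by omega : ¬ j = 1), ite_self]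
  · refine EqFGL.parameterSystem_unique (fun j hj => ?_) hb₁ (fun i j hi hij => ?_)
      (EqFGL.isParameterSystem EqFGL.A_relation) hs
    · rw [hq j hj, EqFGL.qParam_of_le hj]
    · rw [hb i j hi hij]
      rcases hij with hij | hij
      · rw [EqFGL.bParam, if_neg (by omega)]
      · rw [EqFGL.bParam, if_neg (by omega : ¬ j = 0), if_neg (by omega : ¬ j = 1), ite_self]
  obtain ⟨e, he, he₀, he₁, heσ⟩ := EqFGL.CoordRing.exists_idempotent EqFGL.A_relation
  refine ⟨EqFGL.CoordRing EqFGL.u EqFGL.w, inferInstance, inferInstance,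
    EqFGL.CoordRing.fgl EqFGL.A_relation, EqFGL.CoordRing.fgl_hasParameters EqFGL.A_relation,
    fun R' _ _ E' hE' => E'.nonempty_iso EqFGL.A_relation EqFGL.A_eq_zero_of_torsion hE',
    EqFGL.CoordRing.fgl_hasUnderlying EqFGL.A_relation,
    EqFGL.CoordRing.fgl_not_isMultiplicative EqFGL.A_relation EqFGL.A_mul_sq_ne_zero,
    EqFGL.universalRoot, EqFGL.CoordRing.φ EqFGL.u EqFGL.w, EqFGL.CoordRing.σ EqFGL.u EqFGL.w, e,
    EqFGL.constantCoeff_universalRoot, EqFGL.universalRoot_eq, ?_, ?_, he, ?_, ?_,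
    EqFGL.CoordRing.fgl_Δ_x_eq EqFGL.A_relation heσ⟩
  · have h1 : (Polynomial.aeval EqFGL.w : Polynomial ℤ →ₐ[ℤ] EqFGL.A).toRingHom =
        Polynomial.eval₂RingHom (Int.castRingHom EqFGL.A) EqFGL.w :=
      Polynomial.ringHom_ext' (RingHom.ext_int _ _) (by simp)
    rw [h1]
    exact EqFGL.CoordRing.fgl_hasValue EqFGL.A_relation
  · exact (Algebra.smul_def _ _).symm
  · exact (congrArg (· ∈ Ideal.span {1 - EqFGL.u * EqFGL.w}) he₀).mpr (Ideal.zero_mem _)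
  · refine (congrArg (· - 1 ∈ Ideal.span {1 - EqFGL.u * EqFGL.w}) he₁).mpr ?_
    exact Ideal.mem_span_singleton.2 ⟨-1, by ring⟩
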